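/- Let $\Sigma\subset\mathbb{R}^2$ be a compact (embedded) $C^2$ curve with nowhere vanishing curvature, that is, a regular simple $C^2$ arc including its endpoints or a regular simple closed $C^2$ curve; let $\mu$ be the arc length measure on $\Sigma$, $n(\xi)$ a unit normal to $\Sigma$ at $\xi\in\Sigma$, and for $f\in\mathcal{S}(\mathbb{R}^2)$ put $$E_\Sigma f(x)=\int_\Sigma f(\xi)\,e^{2\pi i\xi\cdot x}\,d\mu(\xi),\qquad x\in\mathbb{R}^2 .$$ Let $\omega\in\mathbb{S}^1$ and $p,q\in[1,\infty]$ (with $1/\infty=0$). For $g\ge 0$ let $\mathcal{R}g(\omega,t)=\int_{\{x\cdot\omega=t\}}g\,d\lambda_{\omega,t}$, where $\lambda_{\omega,t}$ is Lebesgue measure on the line $\{x\cdot\omega=t\}$. Consider the two estimates (S) there is a constant $C<\infty$ such that $\|E_\Sigma f\|_{L^q(\{x:\,|x\cdot\omega-t|\le 1/2\})}\le C\,\|f\|_{L^p(\Sigma,\mu)}$ for all $f\in\mathcal{S}(\mathbb{R}^2)$ and all $t\in\mathbb{R}$; (R) there is a constant $C<\infty$ such that $\big(\mathcal{R}(|E_\Sigma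 f|^q)(\omega,t)\big)^{1/q}\le C\,\|f\|_{L^p(\Sigma,\mu)}$ for all $f\in\mathcal{S}(\mathbb{R}^2)$ and all $t\in\mathbb{R}$, where for $q=\infty$ the left-hand side is the essential supremum of $|E_\Sigma f|$ on the line $\{x\cdot\omega=t\}$. (a) (Transversal case) If $n(\xi)\cdot\omega\ne 0$ for all $\xi\in\Sigma$, then (S) holds if and only if $\frac1p+\frac1q\le 1$ and $q\ge 2$, and (R) holds if and only if the same condition is satisfied. (b) (Non-transversal case) If $n(\xi)\cdot\omega=0$ for some $\xi\in\Sigma$, then (S) holds if and only if $$\begin{cases}\frac1p+\frac2q\le 1 & \text{if } p\le q,\\[2pt] \frac1p+\frac2q<1 & \text{if } p>q,\end{cases}$$ and (R) holds if and only if the same condition is satisfied. In both cases the same characterization holds for the estimate (S) on a single strip, that is, with $t\in\mathbb{R}$ fixed. -/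

import Mathlib

open scoped ENNReal NNReal

noncomputable section

/-- The Euclidean plane. -/
abbrev Plane : Type := EuclideanSpace ℝ (Fin 2)

/-- Counterclockwise rotation by a right angle. -/
def rot (v : Plane) : Plane := !₂[-(v 1), v 0]

/-- A compact embedded `C²` curve in the plane, given by a regular parametrization on `[a, b]`:
either a simple arc with its endpoints, or a simple closed curve. (A map that is `C²` on `[a, b]`
up to the endpoints extends to a `C²` map on the line, so nothing is lost by taking `γ` to be `C²`
on all of `ℝ`; nothing is asked of an arc outside `[a, b]`.) -/
structure CompactC2Curve where
  γ : ℝ → Plane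
  a : ℝ
  b : ℝ
  lt : a < b
  contDiff : ContDiff ℝ 2 γ
  regular : ∀ s ∈ Set.Icc a b, deriv γ s ≠ 0
  simple : Set.InjOn γ (Set.Icc a b) ∨
    (Function.Periodic γ (b - a) ∧ Set.InjOn γ (Set.Ico a b))

namespace CompactC2Curve

/-- The signed curvature `det(γ', γ'') / |γ'|³` at the point `γ s`. -/
def curvature (Γ : CompactC2Curve) (s : ℝ) : ℝ :=
  (deriv Γ.γ s 0 * deriv (deriv Γ.γ) s 1 - deriv Γ.γ s 1 * deriv (deriv Γ.γ) s 0)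
    / ‖deriv Γ.γ s‖ ^ 3

/-- The unit normal vector at the point `γ s`. -/
def normal (Γ : CompactC2Curve) (s : ℝ) : Plane :=
  ‖deriv Γ.γ s‖⁻¹ • rot (deriv Γ.γ s)

/-- The transversality condition: `n(ξ) · ω ≠ 0` for all points `ξ = γ s` of the curve. -/
def Transversal (Γ : CompactC2Curve) (ω : Plane) : Prop :=
  ∀ s ∈ Set.Icc Γ.a Γ.b, inner ℝ (Γ.normal s) ω ≠ 0

/-- The arc length measure on the curve, as a measure on the plane: the image under `γ` of
`|γ'(s)| ds` on `[a, b]`. -/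
def arcLength (Γ : CompactC2Curve) : MeasureTheory.Measure Plane :=
  ((MeasureTheory.volume.restrict (Set.Icc Γ.a Γ.b)).withDensity
    (fun s => ‖deriv Γ.γ s‖ₑ)).map Γ.γ

/-- The Fourier extension operator `E f(x) = ∫ f(ξ) e^{2π i ξ·x} dμ(ξ)`. -/
def extension (Γ : CompactC2Curve) (f : Plane → ℂ) (x : Plane) : ℂ :=
  ∫ ξ, f ξ * Complex.exp (2 * Real.pi * Complex.I * (inner ℝ ξ x : ℝ)) ∂Γ.arcLength

end CompactC2Curve

/-- The strip `{x : |x · ω - t| ≤ 1/2}` of unit width. -/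
def strip (ω : Plane) (t : ℝ) : Set Plane := {x | |inner ℝ x ω - t| ≤ 1 / 2}

/-- Lebesgue measure on the line `{x : x · ω = t}`, for a unit vector `ω`. -/
def lineMeasure (ω : Plane) (t : ℝ) : MeasureTheory.Measure Plane :=
  (MeasureTheory.volume : MeasureTheory.Measure ℝ).map (fun s => t • ω + s • rot ω)

/-- The Radon transform of a nonnegative function. -/
def radon (g : Plane → ℝ≥0∞) (ω : Plane) (t : ℝ) : ℝ≥0∞ := ∫⁻ x, g x ∂(lineMeasure ω t)

/-- `(R(|F|^q)(ω, t))^{1/q}`, understood as the essential supremum of `|F|` on the line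
if `q = ∞`. -/
def radonRoot (F : Plane → ℂ) (q : ℝ≥0∞) (ω : Plane) (t : ℝ) : ℝ≥0∞ :=
  if q = ∞ then essSup (fun x => ‖F x‖ₑ) (lineMeasure ω t)
  else (radon (fun x => ‖F x‖ₑ ^ q.toReal) ω t) ^ (1 / q.toReal)

/-- The extension estimate on the single strip `{|x · ω - t| ≤ 1/2}`. -/
def StripEstimateAt (Γ : CompactC2Curve) (ω : Plane) (p q : ℝ≥0∞) (t : ℝ) : Prop :=
  ∃ C : ℝ≥0, ∀ f : SchwartzMap Plane ℂ,
    MeasureTheory.eLpNorm (Γ.extension f) q (MeasureTheory.volume.restrict (strip ω t))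
      ≤ C * MeasureTheory.eLpNorm f p Γ.arcLength

/-- The extension estimate on the strips `{|x · ω - t| ≤ 1/2}`, uniformly in `t`. -/
def StripEstimate (Γ : CompactC2Curve) (ω : Plane) (p q : ℝ≥0∞) : Prop :=
  ∃ C : ℝ≥0, ∀ (f : SchwartzMap Plane ℂ) (t : ℝ),
    MeasureTheory.eLpNorm (Γ.extension f) q (MeasureTheory.volume.restrict (strip ω t))
      ≤ C * MeasureTheory.eLpNorm f p Γ.arcLength

/-- The Radon transform estimate, uniformly in `t`. -/
def RadonEstimate (Γ : CompactC2Curve) (ω : Plane) (p q : ℝ≥0∞) : Prop :=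
  ∃ C : ℝ≥0, ∀ (f : SchwartzMap Plane ℂ) (t : ℝ),
    radonRoot (Γ.extension f) q ω t ≤ C * MeasureTheory.eLpNorm f p Γ.arcLength

end

/-!
On the line `x · ω = t` the extension `E f` is the one-dimensional Fourier transform of `f μ` pushed
forward by `ξ ↦ rot ξ · ω`. By duality and Hölder's inequality along the curve, the Radon estimate
follows from a bound `L^{q'}(ℝ) → L^{p'}(ν)` for the Fourier transform, where `ν` is the image of
the parameter interval under `σ ↦ rot (γ σ) · ω`. In the transversal case `ν` has bounded density,
and Hausdorff–Young suffices. In general, curvature makes the critical points nondegenerate, so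
that `ν` has singularities of type `|u - u₀|^{-1/2}`. Interpolating between Hausdorff–Young and
Paley's inequality with the weight `|u - u₀|^{q' - 2}` then gives the bound, the endpoint included
exactly when `p ≤ q`. The Radon estimate implies the strip estimates by integration in `t`.

Conversely, Knapp examples, i.e. bump functions at scale `r` around a point where the curve has
contact of order `m = 1` or `m = 2` with the direction `ω`, give `1/p + m/q ≤ 1` on a single strip.
Random signs, through Khintchine's inequality, give the remaining conditions: `N` disjoint bumps
of size `1/N` force `q ≥ 2` in the transversal case, and bumps at lacunary scales exclude equality
for `p > q` in the other one.
-/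

open MeasureTheory Set Filter Topology FourierTransform

section Marcinkiewicz

theorem lintegral_Ioi_ofReal_rpow {a c : ℝ} (ha : a < -1) (hc : 0 < c) :
    ∫⁻ x in Ioi c, ENNReal.ofReal (x ^ a) = ENNReal.ofReal (c ^ (a + 1) / (-(a + 1))) := by
  rw [← ofReal_integral_eq_lintegral_ofReal (integrableOn_Ioi_rpow_of_lt ha hc),
    integral_Ioi_rpow_of_lt ha hc, div_neg, neg_div]
  exact (ae_restrict_mem measurableSet_Ioi).mono fun x hx => Real.rpow_nonneg (hc.trans hx).le _

variable {α β : Type*} [MeasurableSpace α] [MeasurableSpace β] {μ : Measure α} {ν : Measure β}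
  {f : α → ℝ} {F : β → ℝ} {r : ℝ}

theorem lintegral_rpow_mul_setLIntegral_lt (hf : Measurable f) (hf0 : 0 ≤ f) (hr : 1 < r) :
    ∫⁻ t in Ioi 0, (∫⁻ x in {x | t < f x}, ENNReal.ofReal (f x) ∂μ) *
        ENNReal.ofReal (t ^ (r - 2)) =
      ENNReal.ofReal (r - 1)⁻¹ * ∫⁻ x, ENNReal.ofReal (f x ^ r) ∂μ := by
  set μ' := μ.withDensity fun x => ENNReal.ofReal (f x)
  have layerCake := lintegral_rpow_eq_lintegral_meas_lt_mul μ' (ae_of_all _ hf0) hf.aemeasurable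
    (sub_pos.2 hr)
  have moment : ∫⁻ x, ENNReal.ofReal (f x ^ (r - 1)) ∂μ' = ∫⁻ x, ENNReal.ofReal (f x ^ r) ∂μ := by
    rw [lintegral_withDensity_eq_lintegral_mul _ (by fun_prop) (by fun_prop)]
    refine lintegral_congr fun x => ?_
    rw [Pi.mul_apply, ← ENNReal.ofReal_mul (hf0 x), ← Real.rpow_one_add' (hf0 x) (by linarith)]
    ring_nf
  rw [← moment, layerCake, ← mul_assoc, ← ENNReal.ofReal_mul (inv_nonneg.2 (by linarith)),
    inv_mul_cancel₀ (by linarith), ENNReal.ofReal_one, one_mul]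
  refine lintegral_congr fun t => ?_
  rw [withDensity_apply _ (measurableSet_lt measurable_const hf), sub_sub]
  norm_num

theorem setLIntegral_Ici_rpow_mul_sq {y : ℝ} (hy : 0 < y) (hr : r < 2) :
    ∫⁻ t in Ici y, ENNReal.ofReal (y ^ 2) * ENNReal.ofReal (t ^ (r - 3)) =
      ENNReal.ofReal (2 - r)⁻¹ * ENNReal.ofReal (y ^ r) := by
  rw [setLIntegral_congr Ioi_ae_eq_Ici.symm, lintegral_const_mul _ (by fun_prop),
    lintegral_Ioi_ofReal_rpow (by linarith) hy, ← ENNReal.ofReal_mul (by positivity),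
    ← ENNReal.ofReal_mul (inv_nonneg.2 (by linarith)), ← mul_div_assoc, ← Real.rpow_two,
    ← Real.rpow_add hy, div_eq_inv_mul]
  ring_nf

theorem lintegral_rpow_mul_setLIntegral_le [SFinite μ] (hf : Measurable f) (hf0 : 0 ≤ f)
    (hr : r < 2) :
    ∫⁻ t in Ioi 0, (∫⁻ x in {x | f x ≤ t}, ENNReal.ofReal (f x ^ 2) ∂μ) *
        ENNReal.ofReal (t ^ (r - 3)) ≤
      ENNReal.ofReal (2 - r)⁻¹ * ∫⁻ x, ENNReal.ofReal (f x ^ r) ∂μ := by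
  let k : ℝ × α → ℝ≥0∞ := {z | f z.2 ≤ z.1}.indicator
    fun z => ENNReal.ofReal (f z.2 ^ 2) * ENNReal.ofReal (z.1 ^ (r - 3))
  have hk : Measurable k :=
    Measurable.indicator (by fun_prop) (measurableSet_le (by fun_prop) measurable_fst)
  calc _ = ∫⁻ t in Ioi 0, ∫⁻ x, k (t, x) ∂μ := by
        refine lintegral_congr fun t => ?_
        rw [← lintegral_mul_const' _ _ ENNReal.ofReal_ne_top,
          ← lintegral_indicator (measurableSet_le hf measurable_const)]
        rfl
    _ = ∫⁻ x, (∫⁻ t in Ioi 0, k (t, x)) ∂μ :=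
        lintegral_lintegral_swap (f := fun t x => k (t, x)) hk.aemeasurable
    _ ≤ ∫⁻ x, ENNReal.ofReal (2 - r)⁻¹ * ENNReal.ofReal (f x ^ r) ∂μ := by
        refine lintegral_mono fun x => ?_
        rcases (hf0 x).eq_or_lt with h0 | h0
        · simp [k, indicator, ← h0]
        rw [← setLIntegral_Ici_rpow_mul_sq h0 hr, ← lintegral_indicator measurableSet_Ici]
        exact setLIntegral_le_lintegral _ _
    _ = _ := lintegral_const_mul _ (by fun_prop)

/- Marcinkiewicz interpolation between the weak types `(1, 1)` and `(2, 2)`: the hypothesis is what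
they give for the splitting of `f` at height `t`. -/
theorem lintegral_rpow_le_of_meas_lt_le [SFinite μ] (hf : Measurable f) (hf0 : 0 ≤ f)
    (hF : Measurable F) (hF0 : 0 ≤ F) (hr1 : 1 < r) (hr2 : r < 2) {A B : ℝ≥0}
    (h : ∀ t : ℝ, 0 < t → ν {y | t < F y} ≤
      A * ENNReal.ofReal t⁻¹ * ∫⁻ x in {x | t < f x}, ENNReal.ofReal (f x) ∂μ +
      B * ENNReal.ofReal (t ^ (-2 : ℝ)) * ∫⁻ x in {x | f x ≤ t}, ENNReal.ofReal (f x ^ 2) ∂μ) :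
    ∫⁻ y, ENNReal.ofReal (F y ^ r) ∂ν ≤
      ENNReal.ofReal r * (A * ENNReal.ofReal (r - 1)⁻¹ + B * ENNReal.ofReal (2 - r)⁻¹) *
        ∫⁻ x, ENNReal.ofReal (f x ^ r) ∂μ := by
  have hmeas : Measurable fun t : ℝ => A * ((∫⁻ x in {x | t < f x}, ENNReal.ofReal (f x) ∂μ) *
      ENNReal.ofReal (t ^ (r - 2))) := by
    have : Antitone fun t : ℝ => ∫⁻ x in {x | t < f x}, ENNReal.ofReal (f x) ∂μ :=
      fun s t hst => lintegral_mono_set fun x hx => hst.trans_lt hx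
    exact (this.measurable.mul (by fun_prop)).const_mul _
  rw [lintegral_rpow_eq_lintegral_meas_lt_mul ν (ae_of_all _ hF0) hF.aemeasurable
    (by linarith), mul_assoc]
  gcongr
  calc ∫⁻ t in Ioi 0, ν {y | t < F y} * ENNReal.ofReal (t ^ (r - 1))
      ≤ ∫⁻ t in Ioi 0, (A * ((∫⁻ x in {x | t < f x}, ENNReal.ofReal (f x) ∂μ) *
            ENNReal.ofReal (t ^ (r - 2))) +
          B * ((∫⁻ x in {x | f x ≤ t}, ENNReal.ofReal (f x ^ 2) ∂μ) *
            ENNReal.ofReal (t ^ (r - 3)))) := by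
        refine setLIntegral_mono' measurableSet_Ioi fun t (ht : 0 < t) => ?_
        have e1 : ENNReal.ofReal (t ^ (r - 2)) =
            ENNReal.ofReal t⁻¹ * ENNReal.ofReal (t ^ (r - 1)) := by
          rw [← ENNReal.ofReal_mul (by positivity), ← Real.rpow_neg_one, ← Real.rpow_add ht]
          ring_nf
        have e2 : ENNReal.ofReal (t ^ (r - 3)) =
            ENNReal.ofReal (t ^ (-2 : ℝ)) * ENNReal.ofReal (t ^ (r - 1)) := by
          rw [← ENNReal.ofReal_mul (by positivity), ← Real.rpow_add ht]
          ring_nf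
        refine (mul_le_mul_left (h t ht) _).trans_eq ?_
        rw [e1, e2]
        ring
    _ ≤ _ := by
        rw [lintegral_add_left hmeas, lintegral_const_mul' _ _ ENNReal.coe_ne_top,
          lintegral_const_mul' _ _ ENNReal.coe_ne_top,
          lintegral_rpow_mul_setLIntegral_lt hf hf0 hr1, add_mul, mul_assoc, mul_assoc]
        gcongr
        exact lintegral_rpow_mul_setLIntegral_le hf hf0 hr2

end Marcinkiewicz

section FourierLp

variable {V : Type*} [NormedAddCommGroup V] [InnerProductSpace ℝ V] [MeasurableSpace V]
  [BorelSpace V] [FiniteDimensional ℝ V] {f g : V → ℂ}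

theorem norm_fourier_le_integral_norm (g : V → ℂ) (u : V) : ‖𝓕 g u‖ ≤ ∫ v, ‖g v‖ :=
  VectorFourier.norm_fourierIntegral_le_integral_norm _ _ _ g u

theorem continuous_fourier (hg : Integrable g) : Continuous (𝓕 g) :=
  VectorFourier.fourierIntegral_continuous Real.continuous_fourierChar
    (by exact continuous_inner) hg

theorem fourier_add_apply_of_integrable (hf : Integrable f) (hg : Integrable g) (u : V) :
    𝓕 (f + g) u = 𝓕 f u + 𝓕 g u := by
  simp only [Real.fourier_eq, Pi.add_apply, smul_add]
  exact integral_add ((Real.fourierIntegral_convergent_iff u).2 hf)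
    ((Real.fourierIntegral_convergent_iff u).2 hg)

/- Both sides define the same tempered distribution, hence have the same integrals against test
functions. -/
theorem fourier_toLp_ae_eq (hg : Integrable g) (hg2 : MemLp g 2) :
    (𝓕 (hg2.toLp g) : Lp ℂ 2 (volume : Measure V)) =ᵐ[volume] 𝓕 g := by
  have hloc := (Lp.memLp (𝓕 (hg2.toLp g))).locallyIntegrable (by norm_num)
  have hc := continuous_fourier hg
  rw [← sub_ae_eq_zero]
  refine ae_eq_zero_of_integral_contDiff_smul_eq_zero (hloc.sub hc.locallyIntegrable) ?_
  intro φ hφ hφc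
  have hφ₁ : HasCompactSupport (Complex.ofRealCLM ∘ φ) := hφc.comp_left rfl
  have hφ₂ : ContDiff ℝ ((⊤ : ℕ∞) : WithTop ℕ∞) (Complex.ofRealCLM ∘ φ) := by fun_prop
  let ψ := hφ₁.toSchwartzMap hφ₂
  have flip : ∫ x, (𝓕 ψ) x • (hg2.toLp g) x = ∫ x, ψ x • 𝓕 g x := by
    have e := VectorFourier.integral_fourierIntegral_smul_eq_flip (L := innerₗ V)
      Real.continuous_fourierChar continuous_inner (ψ.integrable (μ := volume)) hg
    rw [flip_innerₗ] at e
    refine Eq.trans (integral_congr_ae ?_) e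
    filter_upwards [hg2.coeFn_toLp] with x hx
    rw [hx]
    rfl
  have hpair := DFunLike.congr_fun (Lp.fourier_toTemperedDistribution_eq (hg2.toLp g)) ψ
  rw [TemperedDistribution.fourier_apply, Lp.toTemperedDistribution_apply,
    Lp.toTemperedDistribution_apply, flip] at hpair
  simp only [Pi.sub_apply, smul_sub]
  rw [integral_sub (hloc.integrable_smul_left_of_hasCompactSupport hφ.continuous hφc)
    (hc.locallyIntegrable.integrable_smul_left_of_hasCompactSupport hφ.continuous hφc),
    sub_eq_zero]
  simpa [ψ] using hpair.symm

theorem eLpNorm_two_fourier (hg : Integrable g) (hg2 : MemLp g 2) :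
    eLpNorm (𝓕 g) 2 volume = eLpNorm g 2 volume := by
  rw [← eLpNorm_congr_ae (fourier_toLp_ae_eq hg hg2), ← eLpNorm_congr_ae hg2.coeFn_toLp]
  have plancherel := Lp.norm_fourier_eq (hg2.toLp g)
  rw [Lp.norm_def, Lp.norm_def] at plancherel
  exact (ENNReal.toReal_eq_toReal_iff' (Lp.memLp _).2.ne (Lp.memLp _).2.ne).1 plancherel

theorem lintegral_enorm_fourier_sq (hg : Integrable g) (hg2 : MemLp g 2) :
    ∫⁻ u, ‖𝓕 g u‖ₑ ^ 2 = ∫⁻ v, ‖g v‖ₑ ^ 2 := by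
  have h := eLpNorm_two_fourier hg hg2
  rw [eLpNorm_eq_lintegral_rpow_enorm_toReal (by norm_num) (by norm_num),
    eLpNorm_eq_lintegral_rpow_enorm_toReal (by norm_num) (by norm_num)] at h
  simpa using ENNReal.rpow_left_injective (x := 1 / (2 : ℝ)) (by norm_num) (by simpa using h)

theorem enorm_rpow_eq_ofReal (z : ℂ) {r : ℝ} (hr : 0 ≤ r) :
    ‖z‖ₑ ^ r = ENNReal.ofReal (‖z‖ ^ r) := by
  rw [← ofReal_norm, ENNReal.ofReal_rpow_of_nonneg (norm_nonneg _) hr]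

theorem setLIntegral_sq_le_of_meas_lt_le {α : Type*} [MeasurableSpace α] {μ : Measure α}
    {φ : α → ℝ} (hφ : Measurable φ) (hφ0 : 0 ≤ φ)
    (hweak : ∀ s : ℝ, 0 < s → ENNReal.ofReal s * μ {x | s < φ x} ≤ 1) {c : ℝ} (hc : 0 ≤ c) :
    ∫⁻ x in {x | φ x < c}, ENNReal.ofReal (φ x ^ 2) ∂μ ≤ ENNReal.ofReal (2 * c) := by
  have layerCake := lintegral_rpow_eq_lintegral_meas_lt_mul μ
    (ae_of_all _ fun x => le_min (hφ0 x) hc) (hφ.min measurable_const).aemeasurable two_pos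
  calc ∫⁻ x in {x | φ x < c}, ENNReal.ofReal (φ x ^ 2) ∂μ
      ≤ ∫⁻ x, ENNReal.ofReal (min (φ x) c ^ (2 : ℝ)) ∂μ := by
        rw [← lintegral_indicator (measurableSet_lt hφ measurable_const)]
        refine lintegral_mono fun x => indicator_apply_le' (fun hx : φ x < c => ?_)
          (fun _ => zero_le)
        rw [min_eq_left hx.le, Real.rpow_two]
    _ ≤ ENNReal.ofReal 2 * ∫⁻ t in Ioi 0, (Iio c).indicator 1 t := by
        rw [layerCake]
        gcongr 1
        refine setLIntegral_mono' measurableSet_Ioi fun t (ht : 0 < t) => ?_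
        rcases lt_or_ge t c with htc | htc
        · norm_num [htc]
          exact (mul_comm _ _).trans_le (hweak t ht)
        · simp [htc.not_gt]
    _ = ENNReal.ofReal (2 * c) := by
        rw [lintegral_indicator_one measurableSet_Iio, Measure.restrict_apply measurableSet_Iio,
          inter_comm, Ioi_inter_Iio, Real.volume_Ioo, sub_zero,
          ENNReal.ofReal_mul zero_le_two]

theorem withDensity_sq_lt_norm_fourier_div_le {φ : V → ℝ} (hφ : Measurable φ) (hφ0 : 0 ≤ φ)
    (hweak : ∀ s : ℝ, 0 < s → ENNReal.ofReal s * volume {u | s < φ u} ≤ 1) (hg : Integrable g)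
    {t : ℝ} (ht : 0 < t) :
    volume.withDensity (fun u => ENNReal.ofReal (φ u ^ 2)) {u | t < ‖𝓕 g u‖ / φ u} ≤
      ENNReal.ofReal (2 / t) * ∫⁻ v, ‖g v‖ₑ := by
  set J := ∫ v, ‖g v‖
  have hJ : 0 ≤ J := integral_nonneg fun v => norm_nonneg _
  have hsub : {u | t < ‖𝓕 g u‖ / φ u} ⊆ {u | φ u < J / t} := fun u (hu : t < _) => by
    have hφu : 0 < φ u := (hφ0 u).lt_of_ne' fun h0 => by simp [h0, ht.not_gt] at hu
    exact (lt_div_iff₀' ht).2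
      (((lt_div_iff₀ hφu).1 hu).trans_le (norm_fourier_le_integral_norm g u))
  calc _ ≤ volume.withDensity (fun u => ENNReal.ofReal (φ u ^ 2)) {u | φ u < J / t} :=
        measure_mono hsub
    _ ≤ ENNReal.ofReal (2 * (J / t)) := by
        rw [withDensity_apply _ (measurableSet_lt hφ measurable_const)]
        exact setLIntegral_sq_le_of_meas_lt_le hφ hφ0 hweak (div_nonneg hJ ht.le)
    _ = ENNReal.ofReal (2 / t) * ∫⁻ v, ‖g v‖ₑ := by
        rw [← ofReal_integral_norm_eq_lintegral_enorm hg, ← ENNReal.ofReal_mul (by positivity),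
          mul_div_left_comm, mul_comm]

theorem withDensity_sq_lt_norm_fourier_div_le_sq {φ : V → ℝ} (hφ : Measurable φ)
    (hg : Integrable g) (hg2 : MemLp g 2) {t : ℝ} (ht : 0 < t) :
    volume.withDensity (fun u => ENNReal.ofReal (φ u ^ 2)) {u | t < ‖𝓕 g u‖ / φ u} ≤
      ENNReal.ofReal (t ^ (-2 : ℝ)) * ∫⁻ v, ‖g v‖ₑ ^ 2 := by
  have hm : Measurable fun u => ‖𝓕 g u‖ := (continuous_fourier hg).norm.measurable
  have hset : MeasurableSet {u | t < ‖𝓕 g u‖ / φ u} :=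
    measurableSet_lt measurable_const (hm.div hφ)
  rw [withDensity_apply _ hset, ← lintegral_indicator hset, ← lintegral_enorm_fourier_sq hg hg2,
    ← lintegral_const_mul' _ _ ENNReal.ofReal_ne_top]
  refine lintegral_mono fun u => indicator_apply_le' (fun hu : t < _ => ?_) (fun _ => zero_le)
  rw [← ofReal_norm, ← ENNReal.ofReal_pow (norm_nonneg _), ← ENNReal.ofReal_mul (by positivity),
    Real.rpow_neg ht.le, Real.rpow_two, inv_mul_eq_div]
  refine ENNReal.ofReal_le_ofReal ((le_div_iff₀ (by positivity)).2 ?_)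
  rw [← mul_pow]
  rcases eq_or_ne (φ u) 0 with h0 | h0
  · simp [h0]
  · calc (φ u * t) ^ 2 ≤ (φ u * (‖𝓕 g u‖ / φ u)) ^ 2 := by
          rw [mul_pow, mul_pow]
          gcongr
      _ = ‖𝓕 g u‖ ^ 2 := by rw [mul_div_cancel₀ _ h0]

theorem withDensity_sq_lt_norm_fourier_div_le_add {φ : V → ℝ} (hφ : Measurable φ) (hφ0 : 0 ≤ φ)
    (hweak : ∀ s : ℝ, 0 < s → ENNReal.ofReal s * volume {u | s < φ u} ≤ 1)
    (hgm : Measurable g) (hg : Integrable g) (hg2 : MemLp g 2) {t : ℝ} (ht : 0 < t) :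
    volume.withDensity (fun u => ENNReal.ofReal (φ u ^ 2)) {u | t < ‖𝓕 g u‖ / φ u} ≤
      (4 : ℝ≥0) * ENNReal.ofReal t⁻¹ * (∫⁻ v in {v | t < ‖g v‖}, ENNReal.ofReal ‖g v‖) +
      (4 : ℝ≥0) * ENNReal.ofReal (t ^ (-2 : ℝ)) *
        ∫⁻ v in {v | ‖g v‖ ≤ t}, ENNReal.ofReal (‖g v‖ ^ 2) := by
  set S := {v | t < ‖g v‖}
  have hS : MeasurableSet S := measurableSet_lt measurable_const hgm.norm
  have hSc : Sᶜ = {v | ‖g v‖ ≤ t} := by ext; simp [S]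
  have hsub : {u | t < ‖𝓕 g u‖ / φ u} ⊆
      {u | t / 2 < ‖𝓕 (S.indicator g) u‖ / φ u} ∪ {u | t / 2 < ‖𝓕 (Sᶜ.indicator g) u‖ / φ u} := by
    intro u (hu : t < _)
    have hsplit := norm_add_le (𝓕 (S.indicator g) u) (𝓕 (Sᶜ.indicator g) u)
    rw [← fourier_add_apply_of_integrable (hg.indicator hS) (hg.indicator hS.compl),
      indicator_self_add_compl] at hsplit
    have := div_le_div_of_nonneg_right hsplit (hφ0 u)
    rw [add_div] at this
    by_contra! hcon
    simp only [mem_union, mem_ofPred_eq, not_or, not_lt] at hcon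
    linarith
  refine (measure_mono hsub).trans ((measure_union_le _ _).trans (add_le_add ?_ ?_))
  · refine (withDensity_sq_lt_norm_fourier_div_le hφ hφ0 hweak (hg.indicator hS)
      (half_pos ht)).trans_eq ?_
    simp_rw [enorm_indicator_eq_indicator_enorm, lintegral_indicator hS, ofReal_norm]
    rw [show 2 / (t / 2) = 4 * t⁻¹ by field_simp; norm_num, ENNReal.ofReal_mul (by norm_num)]
    norm_num
  · refine (withDensity_sq_lt_norm_fourier_div_le_sq hφ (hg.indicator hS.compl)
      (hg2.indicator hS.compl) (half_pos ht)).trans_eq ?_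
    have hind : ∀ v, ‖Sᶜ.indicator g v‖ₑ ^ 2 =
        Sᶜ.indicator (fun v => ENNReal.ofReal (‖g v‖ ^ 2)) v := fun v => by
      by_cases hv : v ∈ Sᶜ <;> simp [hv, ENNReal.ofReal_pow]
    simp_rw [hind, lintegral_indicator hS.compl, hSc]
    rw [show (t / 2) ^ (-2 : ℝ) = 4 * t ^ (-2 : ℝ) by
      rw [Real.div_rpow ht.le zero_le_two]; norm_num [div_eq_mul_inv, mul_comm],
      ENNReal.ofReal_mul (by norm_num)]
    norm_num

/- Hörmander's form of Paley's inequality, for `φ` in weak `L¹`: the operator `g ↦ 𝓕 g / φ` has weak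
type `(1, 1)` and strong type `(2, 2)` with respect to the measure `φ² du`. -/
theorem exists_lintegral_fourier_rpow_mul_rpow_le {r : ℝ} (hr1 : 1 < r) (hr2 : r < 2) :
    ∃ C : ℝ≥0, ∀ φ : V → ℝ, Measurable φ → 0 ≤ φ →
      (∀ s : ℝ, 0 < s → ENNReal.ofReal s * volume {u | s < φ u} ≤ 1) →
      ∀ g : V → ℂ, Measurable g → Integrable g → MemLp g 2 →
        ∫⁻ u, ‖𝓕 g u‖ₑ ^ r * ENNReal.ofReal (φ u ^ (2 - r)) ≤ C * ∫⁻ v, ‖g v‖ₑ ^ r := by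
  have hr0 : 0 < r := by linarith
  refine ⟨r.toNNReal * (4 * (r - 1)⁻¹.toNNReal + 4 * (2 - r)⁻¹.toNNReal),
    fun φ hφ hφ0 hweak g hgm hg hg2 => ?_⟩
  have hm : Measurable fun u => ‖𝓕 g u‖ := (continuous_fourier hg).norm.measurable
  have interp := lintegral_rpow_le_of_meas_lt_le (μ := volume) hgm.norm (fun v => norm_nonneg _)
    (hm.div hφ) (fun u => div_nonneg (norm_nonneg _) (hφ0 u)) hr1 hr2
    fun t ht => withDensity_sq_lt_norm_fourier_div_le_add hφ hφ0 hweak hgm hg hg2 ht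
  simp_rw [enorm_rpow_eq_ofReal _ hr0.le]
  refine Eq.trans_le ?_ interp
  rw [lintegral_withDensity_eq_lintegral_mul _ (by fun_prop) (by fun_prop)]
  refine lintegral_congr fun u => ?_
  rw [Pi.mul_apply, ← ENNReal.ofReal_mul (by positivity),
    ← ENNReal.ofReal_mul (sq_nonneg _), Pi.div_apply]
  rcases (hφ0 u).eq_or_lt with h0 | h0
  · simp [← h0, Real.zero_rpow (sub_ne_zero.2 hr2.ne')]
  · rw [Real.div_rpow (norm_nonneg _) h0.le, Real.rpow_sub h0, Real.rpow_two]
    ring_nf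

end FourierLp

section FourierBound

variable {V : Type*} [NormedAddCommGroup V] [InnerProductSpace ℝ V] [MeasurableSpace V]
  [BorelSpace V] [FiniteDimensional ℝ V]

/-- The Fourier transform is bounded from `Lʳ(V)` to `Lᴾ(ν)`, in the a priori sense of an
inequality for functions in `L¹ ∩ L²`. The case `P = 0` says that `ν` is finite. -/
def FourierBound (ν : Measure V) (r P : ℝ) : Prop :=
  ∃ C : ℝ≥0, ∀ g : V → ℂ, Measurable g → Integrable g → MemLp g 2 →
    ∫⁻ u, ‖𝓕 g u‖ₑ ^ P ∂ν ≤ C * (∫⁻ v, ‖g v‖ₑ ^ r) ^ (P / r)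

namespace FourierBound

variable {ν ν' : Measure V} {r P P₀ P₁ : ℝ}

theorem of_isFiniteMeasure (ν : Measure V) [IsFiniteMeasure ν] (r : ℝ) : FourierBound ν r 0 :=
  ⟨(ν univ).toNNReal, fun g _ _ _ => by simp⟩

theorem of_le_smul (h : FourierBound ν' r P) {c : ℝ≥0} (hν : ν ≤ c • ν') :
    FourierBound ν r P := by
  obtain ⟨C, hC⟩ := h
  refine ⟨c * C, fun g hgm hg hg2 => (lintegral_mono' hν le_rfl).trans ?_⟩
  rw [lintegral_smul_measure, ENNReal.smul_def, smul_eq_mul, ENNReal.coe_mul, mul_assoc]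
  gcongr
  exact hC g hgm hg hg2

theorem mono (h : FourierBound ν' r P) (hν : ν ≤ ν') : FourierBound ν r P :=
  h.of_le_smul (c := 1) (by rwa [one_smul])

theorem add (h : FourierBound ν r P) (h' : FourierBound ν' r P) : FourierBound (ν + ν') r P := by
  obtain ⟨C, hC⟩ := h
  obtain ⟨D, hD⟩ := h'
  refine ⟨C + D, fun g hgm hg hg2 => ?_⟩
  rw [lintegral_add_measure, ENNReal.coe_add, add_mul]
  exact add_le_add (hC g hgm hg hg2) (hD g hgm hg hg2)

/- The case of the Stein–Weiss interpolation theorem with a common source space, where Hölder's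
inequality suffices. -/
theorem interpolate {w₀ w₁ : V → ℝ≥0∞} (hw₀ : Measurable w₀) (hw₁ : Measurable w₁)
    (h₀ : FourierBound (ν.withDensity w₀) r P₀) (h₁ : FourierBound (ν.withDensity w₁) r P₁)
    (hP₀ : 0 ≤ P₀) (hP₁ : 0 ≤ P₁) (hr : 0 < r) {θ : ℝ} (hθ₀ : 0 ≤ θ) (hθ₁ : θ ≤ 1) :
    FourierBound (ν.withDensity fun u => w₀ u ^ (1 - θ) * w₁ u ^ θ) r
      ((1 - θ) * P₀ + θ * P₁) := by
  obtain ⟨C₀, hC₀⟩ := h₀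
  obtain ⟨C₁, hC₁⟩ := h₁
  have hθ : 0 ≤ 1 - θ := sub_nonneg.2 hθ₁
  refine ⟨C₀ ^ (1 - θ) * C₁ ^ θ, fun g hgm hg hg2 => ?_⟩
  have hF : Measurable fun u => ‖𝓕 g u‖ₑ := (continuous_fourier hg).enorm.measurable
  have hF₀ : Measurable fun u => w₀ u * ‖𝓕 g u‖ₑ ^ P₀ := hw₀.mul (hF.pow_const _)
  have hF₁ : Measurable fun u => w₁ u * ‖𝓕 g u‖ₑ ^ P₁ := hw₁.mul (hF.pow_const _)
  specialize hC₀ g hgm hg hg2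
  specialize hC₁ g hgm hg hg2
  rw [lintegral_withDensity_eq_lintegral_mul _ hw₀ (by fun_prop)] at hC₀
  rw [lintegral_withDensity_eq_lintegral_mul _ hw₁ (by fun_prop)] at hC₁
  rw [lintegral_withDensity_eq_lintegral_mul _ (by fun_prop) (by fun_prop)]
  calc _ = ∫⁻ u, (w₀ u * ‖𝓕 g u‖ₑ ^ P₀) ^ (1 - θ) * (w₁ u * ‖𝓕 g u‖ₑ ^ P₁) ^ θ ∂ν := by
        refine lintegral_congr fun u => ?_
        rw [Pi.mul_apply, ENNReal.mul_rpow_of_nonneg _ _ hθ, ENNReal.mul_rpow_of_nonneg _ _ hθ₀,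
          ← ENNReal.rpow_mul, ← ENNReal.rpow_mul, mul_mul_mul_comm,
          ← ENNReal.rpow_add_of_nonneg _ _ (mul_nonneg hP₀ hθ) (mul_nonneg hP₁ hθ₀),
          mul_comm P₀, mul_comm P₁]
    _ ≤ (∫⁻ u, w₀ u * ‖𝓕 g u‖ₑ ^ P₀ ∂ν) ^ (1 - θ) *
          (∫⁻ u, w₁ u * ‖𝓕 g u‖ₑ ^ P₁ ∂ν) ^ θ :=
        ENNReal.lintegral_mul_norm_pow_le hF₀.aemeasurable hF₁.aemeasurable hθ hθ₀ (by ring)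
    _ ≤ (C₀ * (∫⁻ v, ‖g v‖ₑ ^ r) ^ (P₀ / r)) ^ (1 - θ) *
          (C₁ * (∫⁻ v, ‖g v‖ₑ ^ r) ^ (P₁ / r)) ^ θ := by
        gcongr
        exacts [hC₀, hC₁]
    _ = _ := by
        rw [ENNReal.mul_rpow_of_nonneg _ _ hθ, ENNReal.mul_rpow_of_nonneg _ _ hθ₀,
          ← ENNReal.rpow_mul, ← ENNReal.rpow_mul, mul_mul_mul_comm,
          ← ENNReal.rpow_add_of_nonneg _ _ (by positivity) (by positivity), ENNReal.coe_mul,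
          ENNReal.coe_rpow_of_nonneg _ hθ, ENNReal.coe_rpow_of_nonneg _ hθ₀]
        ring_nf

theorem of_le_of_isFiniteMeasure [IsFiniteMeasure ν] (h : FourierBound ν r P₁) (hr : 0 < r)
    (hP : 0 ≤ P) (hP₁ : 0 < P₁) (hle : P ≤ P₁) : FourierBound ν r P := by
  have h₀ : FourierBound (ν.withDensity 1) r 0 := by simpa using of_isFiniteMeasure ν r
  have h₁ : FourierBound (ν.withDensity 1) r P₁ := by simpa using h
  have := h₀.interpolate measurable_one measurable_one h₁ le_rfl hP₁.le hr
    (div_nonneg hP hP₁.le) (div_le_one_of_le₀ hle hP₁.le)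
  simpa [div_mul_cancel₀ P hP₁.ne', ← Pi.one_def] using this

end FourierBound

theorem lintegral_enorm_fourier_rpow_lt_top {g : V → ℂ} (hg : Integrable g) (hg2 : MemLp g 2)
    {q : ℝ} (hq : 2 ≤ q) : ∫⁻ u, ‖𝓕 g u‖ₑ ^ q < ∞ := by
  have hsq : ∫⁻ u, ‖𝓕 g u‖ₑ ^ 2 < ∞ := by
    rw [lintegral_enorm_fourier_sq hg hg2]
    simpa using lintegral_rpow_enorm_lt_top_of_eLpNorm_lt_top two_ne_zero
      ENNReal.ofNat_ne_top hg2.2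
  calc ∫⁻ u, ‖𝓕 g u‖ₑ ^ q
      ≤ ∫⁻ u, ENNReal.ofReal (∫ v, ‖g v‖) ^ (q - 2) * ‖𝓕 g u‖ₑ ^ 2 := by
        refine lintegral_mono fun u => ?_
        rw [← ENNReal.rpow_ofNat, show q = q - 2 + 2 by ring,
          ENNReal.rpow_add_of_nonneg _ _ (sub_nonneg.2 hq) zero_le_two, add_sub_cancel_right]
        gcongr
        rw [← ofReal_norm]
        exact ENNReal.ofReal_le_ofReal (norm_fourier_le_integral_norm g u)
    _ < ∞ := by
        rw [lintegral_const_mul' _ _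
          (ENNReal.rpow_ne_top_of_nonneg (sub_nonneg.2 hq) ENNReal.ofReal_ne_top)]
        exact ENNReal.mul_lt_top (ENNReal.rpow_lt_top_of_nonneg (sub_nonneg.2 hq)
          ENNReal.ofReal_ne_top) hsq

theorem ofReal_mul_meas_lt_le_lintegral {α : Type*} [MeasurableSpace α] {μ : Measure α}
    {φ : α → ℝ} (hφ : Measurable φ) (s : ℝ) :
    ENNReal.ofReal s * μ {x | s < φ x} ≤ ∫⁻ x, ENNReal.ofReal (φ x) ∂μ := by
  refine le_trans ?_ (mul_meas_ge_le_lintegral hφ.ennreal_ofReal (ENNReal.ofReal s))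
  gcongr with x
  exact fun h => ENNReal.ofReal_le_ofReal h.le

/- The Hausdorff–Young inequality, from the Hörmander–Paley inequality with the weight
`|𝓕 g| ^ q / ∫ |𝓕 g| ^ q`. -/
theorem fourierBound_volume {r q : ℝ} (hrq : r.HolderConjugate q) (hr2 : r ≤ 2) :
    FourierBound (volume : Measure V) r q := by
  rcases hr2.eq_or_lt with rfl | hr2
  · obtain rfl : q = 2 := by linarith [hrq.mul_eq_add]
    exact ⟨1, fun g _ hg hg2 => by simpa using (lintegral_enorm_fourier_sq hg hg2).le⟩
  obtain ⟨C, hC⟩ := exists_lintegral_fourier_rpow_mul_rpow_le (V := V) hrq.lt hr2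
  have hmul := hrq.mul_eq_add
  have hr1 := hrq.lt
  have h2r : 0 ≤ 2 - r := by linarith
  have hqr : 0 ≤ q / r := (div_pos hrq.symm.pos hrq.pos).le
  refine ⟨C ^ (q / r), fun g hgm hg hg2 => ?_⟩
  have hF : Measurable fun u => ‖𝓕 g u‖ := (continuous_fourier hg).norm.measurable
  have hFe : Measurable fun u => ‖𝓕 g u‖ₑ ^ q :=
    (continuous_fourier hg).enorm.measurable.pow_const q
  set X := ∫⁻ u, ‖𝓕 g u‖ₑ ^ q with hX
  have hXtop : X ≠ ∞ := (lintegral_enorm_fourier_rpow_lt_top hg hg2 (by nlinarith)).ne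
  rcases eq_or_ne X 0 with hX0 | hX0
  · simp [hX0]
  set φ : V → ℝ := fun u => ‖𝓕 g u‖ ^ q / X.toReal
  have hφ : Measurable φ := by fun_prop
  have hφ0 : 0 ≤ φ := fun u => by positivity
  have hφX : ∀ u, ENNReal.ofReal (φ u) = ‖𝓕 g u‖ₑ ^ q * X⁻¹ := fun u => by
    rw [ENNReal.ofReal_div_of_pos (ENNReal.toReal_pos hX0 hXtop), ENNReal.ofReal_toReal hXtop,
      enorm_rpow_eq_ofReal _ hrq.symm.nonneg, div_eq_mul_inv]
  have hφ1 : ∫⁻ u, ENNReal.ofReal (φ u) = 1 := by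
    simp_rw [hφX]
    rw [lintegral_mul_const _ hFe, ← hX, ENNReal.mul_inv_cancel hX0 hXtop]
  have hweight : ∀ u, ‖𝓕 g u‖ₑ ^ r * ENNReal.ofReal (φ u ^ (2 - r)) =
      ‖𝓕 g u‖ₑ ^ q * X⁻¹ ^ (2 - r) := fun u => by
    rw [← ENNReal.ofReal_rpow_of_nonneg (hφ0 u) h2r, hφX, ENNReal.mul_rpow_of_nonneg _ _ h2r,
      ← mul_assoc, ← ENNReal.rpow_mul, ← ENNReal.rpow_add_of_nonneg _ _ hrq.nonneg
        (mul_nonneg hrq.symm.nonneg h2r), show r + q * (2 - r) = q by linear_combination -hmul]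
  have paley : X ^ (r - 1) ≤ C * ∫⁻ v, ‖g v‖ₑ ^ r := by
    have := hC φ hφ hφ0
      (fun s _ => (ofReal_mul_meas_lt_le_lintegral hφ s).trans_eq hφ1) g hgm hg hg2
    simp_rw [hweight] at this
    rw [lintegral_mul_const _ hFe, ← hX, ENNReal.inv_rpow, ← ENNReal.rpow_neg] at this
    rwa [show r - 1 = 1 + -(2 - r) by ring, ENNReal.rpow_add _ _ hX0 hXtop, ENNReal.rpow_one]
  calc X = (X ^ (r - 1)) ^ (q / r) := by
        rw [← ENNReal.rpow_mul, ← mul_div_assoc, show (r - 1) * q = r by linear_combination hmul,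
          div_self hrq.ne_zero, ENNReal.rpow_one]
    _ ≤ (C * ∫⁻ v, ‖g v‖ₑ ^ r) ^ (q / r) := by gcongr
    _ = _ := by rw [ENNReal.mul_rpow_of_nonneg _ _ hqr, ENNReal.coe_rpow_of_nonneg _ hqr]

end FourierBound

section FoldMeasure

theorem lintegral_ball_enorm_sub_rpow_lt_top (u₀ R : ℝ) {a : ℝ} (ha : -1 < a) :
    ∫⁻ u in Metric.ball u₀ R, ‖u - u₀‖ₑ ^ a < ∞ := by
  have hint : IntegrableOn (fun u : ℝ => ‖u‖ ^ a) (Metric.ball 0 R) :=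
    integrableOn_ball_of_norm_le_rpow (C := 1) (α := -a) (by simp) (by simpa using neg_lt.1 ha)
      (ae_of_all _ fun u => by
        rw [Real.norm_of_nonneg (by positivity), neg_neg, one_mul])
      (measurable_norm.pow_const a).aestronglyMeasurable
  calc ∫⁻ u in Metric.ball u₀ R, ‖u - u₀‖ₑ ^ a
      = ∫⁻ u in Metric.ball (0 : ℝ) R, ‖u‖ₑ ^ a := by
        have := (measurePreserving_sub_right volume u₀).setLIntegral_comp_preimage
          (s := Metric.ball (0 : ℝ) R) Metric.isOpen_ball.measurableSet
          (f := fun u => ‖u‖ₑ ^ a) (by fun_prop)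
        rw [← this]
        congr 2
        ext u
        simp [dist_eq_norm]
    _ = ∫⁻ u in Metric.ball (0 : ℝ) R, ‖‖u‖ ^ a‖ₑ := by
        refine lintegral_congr_ae (ae_restrict_of_ae ?_)
        filter_upwards [compl_mem_ae_iff.2 (measure_singleton (0 : ℝ))] with u hu
        have hu' : 0 < ‖u‖ := norm_pos_iff.2 hu
        change ‖u‖ₑ ^ a = ‖‖u‖ ^ a‖ₑ
        rw [Real.enorm_of_nonneg (Real.rpow_nonneg hu'.le a), ← ENNReal.ofReal_rpow_of_pos hu',
          ofReal_norm]
    _ < ∞ := hint.2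

/- Paley's inequality, which is the Hörmander–Paley inequality for the weak `L¹` function
`u ↦ (2 |u - u₀|)⁻¹`. -/
theorem fourierBound_withDensity_enorm_sub_rpow (u₀ : ℝ) {r : ℝ} (hr1 : 1 < r) (hr2 : r < 2) :
    FourierBound (volume.withDensity fun u : ℝ => ‖u - u₀‖ₑ ^ (r - 2)) r r := by
  obtain ⟨C, hC⟩ := exists_lintegral_fourier_rpow_mul_rpow_le (V := ℝ) hr1 hr2
  have hweak : ∀ s : ℝ, 0 < s → ENNReal.ofReal s * volume {u | s < (2 * ‖u - u₀‖)⁻¹} ≤ 1 := by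
    intro s hs
    have hsub : {u | s < (2 * ‖u - u₀‖)⁻¹} ⊆ Metric.ball u₀ (2 * s)⁻¹ := fun u hu => by
      have h0 : 0 < 2 * ‖u - u₀‖ := inv_pos.1 (hs.trans hu)
      rw [mem_ball_iff_norm, mul_inv, ← div_eq_inv_mul, lt_div_iff₀' two_pos]
      exact (lt_inv_comm₀ hs h0).1 hu
    calc _ ≤ ENNReal.ofReal s * volume (Metric.ball u₀ (2 * s)⁻¹) := by gcongr
      _ = 1 := by
        rw [Real.volume_ball, ← ENNReal.ofReal_mul hs.le, ENNReal.ofReal_eq_one]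
        field_simp
  refine ⟨(2 : ℝ≥0) ^ (2 - r) * C, fun g hgm hg hg2 => ?_⟩
  have hF : Measurable fun u => ‖𝓕 g u‖ₑ ^ r :=
    (continuous_fourier hg).enorm.measurable.pow_const r
  have hweight : ∀ᵐ u, ‖u - u₀‖ₑ ^ (r - 2) * ‖𝓕 g u‖ₑ ^ r =
      (2 : ℝ≥0) ^ (2 - r) * (‖𝓕 g u‖ₑ ^ r * ENNReal.ofReal ((2 * ‖u - u₀‖)⁻¹ ^ (2 - r))) := by
    filter_upwards [compl_mem_ae_iff.2 (measure_singleton u₀)] with u hu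
    have hu' : 0 < ‖u - u₀‖ := norm_pos_iff.2 (sub_ne_zero.2 hu)
    have h2 : ((2 : ℝ≥0) : ℝ≥0∞) = ENNReal.ofReal 2 := by norm_num
    rw [mul_left_comm, h2, ENNReal.ofReal_rpow_of_pos two_pos, ← ENNReal.ofReal_mul (by positivity),
      ← Real.mul_rpow zero_le_two (by positivity), mul_inv, mul_inv_cancel_left₀ two_ne_zero,
      Real.inv_rpow hu'.le, ← Real.rpow_neg hu'.le, neg_sub, ← ENNReal.ofReal_rpow_of_pos hu',
      ofReal_norm, mul_comm]
  rw [lintegral_withDensity_eq_lintegral_mul _ (by fun_prop) hF]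
  simp only [Pi.mul_apply]
  rw [lintegral_congr_ae hweight,
    lintegral_const_mul' _ _ (by simp), div_self (by linarith), ENNReal.rpow_one, ENNReal.coe_mul,
    mul_assoc, ENNReal.coe_rpow_of_nonneg _ (by linarith)]
  gcongr
  exact hC _ (by fun_prop) (fun u => by positivity) hweak g hgm hg hg2

/-- The model for the image of Lebesgue measure under a function with a nondegenerate critical
point of critical value `u₀`. -/
noncomputable def foldMeasure (u₀ : ℝ) : Measure ℝ :=
  (volume.restrict (Metric.ball u₀ 1)).withDensity fun u => ‖u - u₀‖ₑ ^ (-1 / 2 : ℝ)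

theorem restrict_ball_le_foldMeasure (u₀ : ℝ) :
    volume.restrict (Metric.ball u₀ 1) ≤ foldMeasure u₀ := by
  rw [← withDensity_one (μ := volume.restrict _), foldMeasure]
  refine withDensity_mono
    (ae_restrict_of_forall_mem Metric.isOpen_ball.measurableSet fun u hu => ?_)
  change 1 ≤ ‖u - u₀‖ₑ ^ (-1 / 2 : ℝ)
  rw [neg_div, ENNReal.rpow_neg, ENNReal.one_le_inv]
  refine ENNReal.rpow_le_one ?_ (by norm_num)
  rw [← ofReal_norm, ENNReal.ofReal_le_one]
  exact (mem_ball_iff_norm.1 hu).le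

theorem fourierBound_foldMeasure_of_lt (u₀ : ℝ) {r q P : ℝ} (hrq : r.HolderConjugate q)
    (hr2 : r ≤ 2) (hP : 0 < P) (hPq : P < q / 2) : FourierBound (foldMeasure u₀) r P := by
  have hq := hrq.symm.pos
  have hPq1 : P / q < 1 / 2 := by rwa [div_lt_iff₀ hq, one_div_mul_eq_div]
  set a := -1 / (2 * (1 - P / q)) with ha
  set ν := (volume : Measure ℝ).restrict (Metric.ball u₀ 1) with hν
  have : IsFiniteMeasure (ν.withDensity fun u => ‖u - u₀‖ₑ ^ a) :=
    isFiniteMeasure_withDensity (lintegral_ball_enorm_sub_rpow_lt_top u₀ 1 (by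
      rw [ha, lt_div_iff₀ (by linarith)]
      linarith)).ne
  have h₁ : FourierBound (ν.withDensity 1) r q := by
    rw [withDensity_one]
    exact (fourierBound_volume hrq hr2).mono Measure.restrict_le_self
  have hinterp :=
    (FourierBound.of_isFiniteMeasure (ν.withDensity fun u => ‖u - u₀‖ₑ ^ a) r).interpolate
    (by fun_prop) measurable_one h₁ le_rfl hq.le hrq.pos (θ := P / q) (by positivity) (by linarith)
  have hexp : a * (1 - P / q) = -1 / 2 := by
    rw [ha, div_mul_eq_mul_div, ← mul_div_mul_right (-1) 2 (show 1 - P / q ≠ 0 by linarith)]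
  simpa only [foldMeasure, ← hν, ← ENNReal.rpow_mul, hexp, Pi.one_apply, ENNReal.one_rpow, mul_one,
    mul_zero, zero_add, div_mul_cancel₀ P hq.ne'] using hinterp

theorem fourierBound_foldMeasure_half (u₀ : ℝ) {r q : ℝ} (hrq : r.HolderConjugate q)
    (hq : 3 ≤ q) : FourierBound (foldMeasure u₀) r (q / 2) := by
  have hmul := hrq.mul_eq_add
  have hr : r ≤ 3 / 2 := by nlinarith [hrq.pos]
  have h2r : 0 < 2 - r := by linarith
  set θ := 1 - 1 / (2 * (2 - r)) with hθ
  have hθr : (1 - θ) * (2 - r) = 1 / 2 := by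
    rw [hθ]
    field_simp
    ring
  have hθ1 : 1 / (2 * (2 - r)) ≤ 1 := div_le_one_of_le₀ (by linarith) (by linarith)
  have hθ0 : 0 < 1 / (2 * (2 - r)) := by positivity
  set ν := (volume : Measure ℝ).restrict (Metric.ball u₀ 1) with hν
  have h₀ : FourierBound (ν.withDensity fun u => ‖u - u₀‖ₑ ^ (r - 2)) r r :=
    (fourierBound_withDensity_enorm_sub_rpow u₀ hrq.lt (by linarith)).mono
      (by rw [hν, ← restrict_withDensity Metric.isOpen_ball.measurableSet]
          exact Measure.restrict_le_self)
  have h₁ : FourierBound (ν.withDensity 1) r q := by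
    rw [withDensity_one]
    exact (fourierBound_volume hrq (by linarith)).mono Measure.restrict_le_self
  have hinterp := h₀.interpolate (by fun_prop) measurable_one h₁ hrq.nonneg hrq.symm.nonneg hrq.pos
    (θ := θ) (by linarith) (by linarith)
  have hP : (1 - θ) * r + θ * q = q / 2 := by
    refine mul_right_cancel₀ h2r.ne' ?_
    linear_combination (r - q) * hθr - (1 / 2) * hmul
  have hexp : (r - 2) * (1 - θ) = -1 / 2 := by linear_combination -hθr
  simpa only [foldMeasure, ← hν, ← ENNReal.rpow_mul, hexp, Pi.one_apply, ENNReal.one_rpow, mul_one,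
    hP] using hinterp

end FoldMeasure

section ImageMeasure

theorem injOn_of_hasDerivAt_ne_zero {H H' : ℝ → ℝ} {S : Set ℝ} [S.OrdConnected]
    (hH : ∀ x ∈ S, HasDerivAt H (H' x) x) (h : ∀ x ∈ S, H' x ≠ 0) : InjOn H S := by
  have hlt : ∀ x ∈ S, ∀ y ∈ S, x < y → H x ≠ H y := fun x hx y hy hxy hHxy => by
    have hS : Icc x y ⊆ S := Set.Icc_subset S hx hy
    obtain ⟨z, hz, hz0⟩ := exists_hasDerivAt_eq_zero hxy
      (fun z hz => (hH z (hS hz)).continuousAt.continuousWithinAt) hHxy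
      fun z hz => hH z (hS (Ioo_subset_Icc_self hz))
    exact h z (hS (Ioo_subset_Icc_self hz)) hz0
  intro x hx y hy hxy
  rcases lt_trichotomy x y with hlt' | heq | hlt'
  · exact absurd hxy (hlt x hx y hy hlt')
  · exact heq
  · exact absurd hxy.symm (hlt y hy x hx hlt')

theorem map_restrict_le_smul_withDensity {H H' : ℝ → ℝ} {S T : Set ℝ} {w : ℝ → ℝ≥0∞} {c : ℝ≥0}
    (hHm : Measurable H) (hS : MeasurableSet S)
    (hH : ∀ x ∈ S, HasDerivAt H (H' x) x) (hinj : InjOn H S) (hST : MapsTo H S T)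
    (hw : ∀ x ∈ S, 1 ≤ c * (‖H' x‖ₑ * w (H x))) :
    (volume.restrict S).map H ≤ c • (volume.restrict T).withDensity w := by
  refine Measure.le_iff.2 fun B hB => ?_
  have hSB : MeasurableSet (H ⁻¹' B ∩ S) := (hHm hB).inter hS
  have hsub : H '' (H ⁻¹' B ∩ S) ⊆ B ∩ T :=
    image_subset_iff.2 fun _ hx => ⟨hx.1, hST hx.2⟩
  rw [Measure.map_apply hHm hB, Measure.restrict_apply (hHm hB), Measure.smul_apply,
    withDensity_apply _ hB, Measure.restrict_restrict hB, ENNReal.smul_def, smul_eq_mul]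
  calc volume (H ⁻¹' B ∩ S)
      = ∫⁻ _ in H ⁻¹' B ∩ S, 1 := (setLIntegral_one _).symm
    _ ≤ ∫⁻ x in H ⁻¹' B ∩ S, c * (‖H' x‖ₑ * w (H x)) :=
        setLIntegral_mono' hSB fun _ hx => hw _ hx.2
    _ = c * ∫⁻ u in H '' (H ⁻¹' B ∩ S), w u := by
        rw [lintegral_const_mul' _ _ ENNReal.coe_ne_top,
          lintegral_image_eq_lintegral_abs_deriv_mul hSB
            (fun _ hx => (hH _ hx.2).hasDerivWithinAt) (hinj.mono inter_subset_right)]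
        simp only [Real.enorm_eq_ofReal_abs]
    _ ≤ c * ∫⁻ u in B ∩ T, w u := by gcongr

theorem exists_map_restrict_le_smul_restrict_ball {H H' : ℝ → ℝ}
    (hH : ∀ x, HasDerivAt H (H' x) x) (hH' : Continuous H') {x₀ : ℝ} (h : H' x₀ ≠ 0) :
    ∃ U ∈ 𝓝 x₀, ∃ c : ℝ≥0, (volume.restrict U).map H ≤
      c • volume.restrict (Metric.ball (H x₀) 1) := by
  have hHc : Continuous H := continuous_iff_continuousAt.2 fun x => (hH x).continuousAt
  have hpos : 0 < |H' x₀| := abs_pos.2 h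
  have hev : ∀ᶠ x in 𝓝 x₀, |H' x₀| / 2 < |H' x| ∧ H x ∈ Metric.ball (H x₀) 1 :=
    (hH'.abs.continuousAt.eventually (lt_mem_nhds (half_lt_self hpos))).and
      (hHc.continuousAt (Metric.ball_mem_nhds _ one_pos))
  obtain ⟨R, hR, hball⟩ := Metric.eventually_nhds_iff_ball.1 hev
  have hord : (Metric.ball x₀ R).OrdConnected := by
    rw [Real.ball_eq_Ioo]
    exact ordConnected_Ioo
  refine ⟨_, Metric.ball_mem_nhds x₀ hR, (|H' x₀| / 2).toNNReal⁻¹, ?_⟩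
  have hne : ∀ x ∈ Metric.ball x₀ R, H' x ≠ 0 := fun x hx =>
    abs_pos.1 ((half_pos hpos).trans (hball x hx).1)
  simpa only [withDensity_one] using map_restrict_le_smul_withDensity (w := 1) hHc.measurable
    measurableSet_ball (fun x _ => hH x)
    (injOn_of_hasDerivAt_ne_zero (fun x _ => hH x) hne) (fun x hx => (hball x hx).2) fun x hx => by
      rw [Pi.one_apply, mul_one, ENNReal.coe_inv (by positivity), ← ENNReal.div_eq_inv_mul,
        ENNReal.le_div_iff_mul_le (by simp [hpos]) (by simp), one_mul, Real.enorm_eq_ofReal_abs]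
      exact ENNReal.ofReal_le_ofReal (hball x hx).1.le

theorem eventually_mul_norm_sub_le_norm_sub {E : Type*} [NormedAddCommGroup E] [NormedSpace ℝ E]
    {f : ℝ → E} {v : E} {τ : ℝ} (hf : HasDerivAt f v τ) (hv : v ≠ 0) :
    ∀ᶠ s in 𝓝 τ, ‖v‖ / 2 * ‖s - τ‖ ≤ ‖f s - f τ‖ := by
  filter_upwards [hf.isLittleO.def (half_pos (norm_pos_iff.2 hv))] with s hs
  have h1 := norm_sub_norm_le ((s - τ) • v) (f s - f τ)
  rw [norm_sub_rev ((s - τ) • v), norm_smul] at h1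
  linarith

theorem eventually_norm_sub_le_of_deriv_eq_zero {H H' : ℝ → ℝ} {d τ : ℝ}
    (hH : ∀ s, HasDerivAt H (H' s) s) (hH' : HasDerivAt H' d τ) (h0 : H' τ = 0) :
    ∃ K, 0 < K ∧ ∀ᶠ s in 𝓝 τ, ‖H s - H τ‖ ≤ K * ‖s - τ‖ ^ 2 := by
  obtain ⟨K, hK, hO⟩ := hH'.isBigO_sub.exists_pos
  obtain ⟨δ, hδ, hball⟩ := Metric.eventually_nhds_iff_ball.1 hO.bound
  refine ⟨K, hK, Metric.eventually_nhds_iff_ball.2 ⟨δ, hδ, fun s hs => ?_⟩⟩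
  rw [sq, ← mul_assoc]
  refine (convex_uIcc τ s).norm_image_sub_le_of_norm_hasDerivWithin_le
    (fun y _ => (hH y).hasDerivWithinAt) (fun y hy => ?_) left_mem_uIcc right_mem_uIcc
  have hyδ : y ∈ Metric.ball τ δ :=
    (mem_ball_iff_norm.2 ((abs_sub_left_of_mem_uIcc hy).trans_lt (mem_ball_iff_norm.1 hs)))
  calc ‖H' y‖ = ‖H' y - H' τ‖ := by rw [h0, sub_zero]
    _ ≤ K * ‖y - τ‖ := hball y hyδ
    _ ≤ K * ‖s - τ‖ := mul_le_mul_of_nonneg_left (abs_sub_left_of_mem_uIcc hy) hK.le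

theorem one_le_mul_enorm_mul_enorm_rpow_neg_half {a b k K t : ℝ} (hk : 0 < k) (hK : 0 < K)
    (ht : 0 < ‖t‖) (ha : k * ‖t‖ ≤ ‖a‖) (hb : ‖b‖ ≤ K * ‖t‖ ^ 2) :
    1 ≤ ((K ^ (1 / 2 : ℝ) / k).toNNReal : ℝ≥0∞) * (‖a‖ₑ * ‖b‖ₑ ^ (-1 / 2 : ℝ)) := by
  have hbt : ‖b‖ₑ ^ (1 / 2 : ℝ) ≤ ENNReal.ofReal (K ^ (1 / 2 : ℝ) * ‖t‖) := by
    calc ‖b‖ₑ ^ (1 / 2 : ℝ) ≤ ENNReal.ofReal (K * ‖t‖ ^ 2) ^ (1 / 2 : ℝ) := by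
          rw [← ofReal_norm]
          gcongr
      _ = ENNReal.ofReal (K ^ (1 / 2 : ℝ) * ‖t‖) := by
          rw [ENNReal.ofReal_rpow_of_pos (by positivity), Real.mul_rpow hK.le (by positivity),
            ← Real.sqrt_eq_rpow (‖t‖ ^ 2), Real.sqrt_sq ht.le]
  calc (1 : ℝ≥0∞)
      = ENNReal.ofReal (K ^ (1 / 2 : ℝ) * ‖t‖) / ENNReal.ofReal (K ^ (1 / 2 : ℝ) * ‖t‖) :=
        (ENNReal.div_self (ENNReal.ofReal_pos.2 (by positivity)).ne' ENNReal.ofReal_ne_top).symm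
    _ = ENNReal.ofReal (K ^ (1 / 2 : ℝ) / k) * ENNReal.ofReal (k * ‖t‖) /
          ENNReal.ofReal (K ^ (1 / 2 : ℝ) * ‖t‖) := by
        rw [← ENNReal.ofReal_mul (by positivity)]
        congr 2
        field_simp
    _ ≤ ENNReal.ofReal (K ^ (1 / 2 : ℝ) / k) * ‖a‖ₑ / ‖b‖ₑ ^ (1 / 2 : ℝ) := by
        rw [← ofReal_norm a]
        gcongr
    _ = _ := by
        rw [ENNReal.ofReal, div_eq_mul_inv, mul_assoc, neg_div, ENNReal.rpow_neg]

theorem exists_map_restrict_le_smul_foldMeasure_of_eq_zero {H H' : ℝ → ℝ} {d x₀ : ℝ}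
    (hH : ∀ x, HasDerivAt H (H' x) x) (hH' : HasDerivAt H' d x₀) (h0 : H' x₀ = 0) (hd : d ≠ 0) :
    ∃ U ∈ 𝓝 x₀, ∃ c : ℝ≥0, (volume.restrict U).map H ≤ c • foldMeasure (H x₀) := by
  have hHc : Continuous H := continuous_iff_continuousAt.2 fun x => (hH x).continuousAt
  obtain ⟨K, hK, hquad⟩ := eventually_norm_sub_le_of_deriv_eq_zero hH hH' h0
  obtain ⟨R, hR, hball⟩ := Metric.eventually_nhds_iff_ball.1
    (((eventually_mul_norm_sub_le_norm_sub hH' hd).and hquad).and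
      (hHc.continuousAt (Metric.ball_mem_nhds _ one_pos)))
  simp only [h0, sub_zero] at hball
  have hk : 0 < ‖d‖ / 2 := half_pos (norm_pos_iff.2 hd)
  set c := (K ^ (1 / 2 : ℝ) / (‖d‖ / 2)).toNNReal
  have hside : ∀ S : Set ℝ, S ⊆ Metric.ball x₀ R → x₀ ∉ S → S.OrdConnected → MeasurableSet S →
      (volume.restrict S).map H ≤ c • foldMeasure (H x₀) := fun S hS hx₀ _ hSm => by
    have hpos : ∀ x ∈ S, 0 < ‖x - x₀‖ := fun x hx =>
      norm_pos_iff.2 (sub_ne_zero.2 (ne_of_mem_of_not_mem hx hx₀))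
    have hne : ∀ x ∈ S, H' x ≠ 0 := fun x hx =>
      norm_pos_iff.1 ((mul_pos hk (hpos x hx)).trans_le (hball x (hS hx)).1.1)
    exact map_restrict_le_smul_withDensity hHc.measurable hSm
      (fun x _ => hH x) (injOn_of_hasDerivAt_ne_zero (fun x _ => hH x) hne)
      (fun x hx => (hball x (hS hx)).2) fun x hx =>
        one_le_mul_enorm_mul_enorm_rpow_neg_half hk hK (hpos x hx) (hball x (hS hx)).1.1
          (hball x (hS hx)).1.2
  have hL := hside (Ioo (x₀ - R) x₀) (Real.ball_eq_Ioo x₀ R ▸ Ioo_subset_Ioo_right (by linarith))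
    (fun h => lt_irrefl _ h.2) ordConnected_Ioo measurableSet_Ioo
  have hR' := hside (Ioo x₀ (x₀ + R)) (Real.ball_eq_Ioo x₀ R ▸ Ioo_subset_Ioo_left (by linarith))
    (fun h => lt_irrefl _ h.1) ordConnected_Ioo measurableSet_Ioo
  refine ⟨_, Metric.ball_mem_nhds x₀ hR, c + c, ?_⟩
  have hunion : Metric.ball x₀ R =ᵐ[volume] (Ioo (x₀ - R) x₀ ∪ Ioo x₀ (x₀ + R) : Set ℝ) := by
    rw [Real.ball_eq_Ioo, ← Ioo_union_Ico_eq_Ioo (sub_lt_self x₀ hR) (by linarith)]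
    exact (ae_eq_refl _).union Ioo_ae_eq_Ico.symm
  calc (volume.restrict (Metric.ball x₀ R)).map H
      ≤ (volume.restrict (Ioo (x₀ - R) x₀)).map H + (volume.restrict (Ioo x₀ (x₀ + R))).map H := by
        rw [Measure.restrict_congr_set hunion, ← Measure.map_add _ _ hHc.measurable]
        exact Measure.map_mono (Measure.restrict_union_le _ _) hHc.measurable
    _ ≤ (c + c) • foldMeasure (H x₀) := by
        rw [add_smul]
        exact add_le_add hL hR'

theorem FourierBound.map_restrict_of_isCompact {H : ℝ → ℝ} (hH : Measurable H) {r P : ℝ}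
    {S : Set ℝ} (hS : IsCompact S)
    (h : ∀ x ∈ S, ∃ U ∈ 𝓝 x, FourierBound ((volume.restrict U).map H) r P) :
    FourierBound ((volume.restrict S).map H) r P := by
  refine hS.induction_on (p := fun T => FourierBound ((volume.restrict T).map H) r P) ?_ ?_ ?_ ?_
  · exact ⟨0, by simp⟩
  · exact fun T T' hTT' hT' => hT'.mono (Measure.map_mono (Measure.restrict_mono_set _ hTT') hH)
  · exact fun T T' hT hT' => (hT.add hT').mono <| by
      rw [← Measure.map_add _ _ hH]
      exact Measure.map_mono (Measure.restrict_union_le _ _) hH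
  · exact fun x hx => (h x hx).imp fun U hU => ⟨mem_nhdsWithin_of_mem_nhds hU.1, hU.2⟩

theorem fourierBound_map_of_deriv_ne_zero {r q : ℝ} (hrq : r.HolderConjugate q) (hr2 : r ≤ 2)
    {H H' : ℝ → ℝ} (hH : ∀ x, HasDerivAt H (H' x) x) (hH' : Continuous H') {S : Set ℝ}
    (hS : IsCompact S) (h : ∀ x ∈ S, H' x ≠ 0) :
    FourierBound ((volume.restrict S).map H) r q := by
  have hHc : Continuous H := continuous_iff_continuousAt.2 fun x => (hH x).continuousAt
  refine .map_restrict_of_isCompact hHc.measurable hS fun x hx => ?_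
  obtain ⟨U, hU, c, hc⟩ := exists_map_restrict_le_smul_restrict_ball hH hH' (h x hx)
  exact ⟨U, hU, ((fourierBound_volume hrq hr2).mono Measure.restrict_le_self).of_le_smul hc⟩

theorem fourierBound_map_of_nondegenerate {r q P : ℝ} (hrq : r.HolderConjugate q) (hr2 : r ≤ 2)
    (hP : 0 < P) (hPq : P < q / 2 ∨ 3 ≤ q ∧ P = q / 2) {H H' H'' : ℝ → ℝ}
    (hH : ∀ x, HasDerivAt H (H' x) x) (hH' : ∀ x, HasDerivAt H' (H'' x) x) {S : Set ℝ}
    (hS : IsCompact S) (h : ∀ x ∈ S, H' x = 0 → H'' x ≠ 0) :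
    FourierBound ((volume.restrict S).map H) r P := by
  have hHc : Continuous H := continuous_iff_continuousAt.2 fun x => (hH x).continuousAt
  have hHc' : Continuous H' := continuous_iff_continuousAt.2 fun x => (hH' x).continuousAt
  have hfold : ∀ u₀, FourierBound (foldMeasure u₀) r P := fun u₀ => by
    rcases hPq with hlt | ⟨hq, rfl⟩
    · exact fourierBound_foldMeasure_of_lt u₀ hrq hr2 hP hlt
    · exact fourierBound_foldMeasure_half u₀ hrq hq
  refine .map_restrict_of_isCompact hHc.measurable hS fun x hx => ?_
  by_cases hx0 : H' x = 0
  · obtain ⟨U, hU, c, hc⟩ :=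
      exists_map_restrict_le_smul_foldMeasure_of_eq_zero hH (hH' x) hx0 (h x hx hx0)
    exact ⟨U, hU, (hfold _).of_le_smul hc⟩
  · obtain ⟨U, hU, c, hc⟩ := exists_map_restrict_le_smul_restrict_ball hH hHc' hx0
    exact ⟨U, hU, ((hfold _).mono (restrict_ball_le_foldMeasure _)).of_le_smul hc⟩

end ImageMeasure

section Plane

theorem inner_plane (x y : Plane) : inner ℝ x y = x 0 * y 0 + x 1 * y 1 := by
  simp [PiLp.inner_apply, Fin.sum_univ_two, mul_comm]

theorem norm_rot (v : Plane) : ‖rot v‖ = ‖v‖ := by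
  simp [EuclideanSpace.norm_eq, rot, Fin.sum_univ_two, add_comm]

theorem inner_rot_left (v w : Plane) : inner ℝ (rot v) w = -inner ℝ v (rot w) := by
  simp [inner_plane, rot]

theorem inner_rot_self (v : Plane) : inner ℝ v (rot v) = 0 := by
  simp only [inner_plane, rot, Matrix.cons_val_zero, Matrix.cons_val_one]
  ring

variable {ω : Plane}

theorem orthonormal_self_rot (hω : ‖ω‖ = 1) : Orthonormal ℝ ![ω, rot ω] := by
  rw [orthonormal_iff_ite]
  intro i j
  fin_cases i <;> fin_cases j <;>
    simp [inner_rot_self, hω, norm_rot, real_inner_comm]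

theorem measurePreserving_smul_add_smul_rot (hω : ‖ω‖ = 1) :
    MeasurePreserving (fun z : ℝ × ℝ => z.1 • ω + z.2 • rot ω) := by
  have hcard : Fintype.card (Fin 2) = Module.finrank ℝ Plane := by simp
  set b := (basisOfOrthonormalOfCardEqFinrank (orthonormal_self_rot hω) hcard).toOrthonormalBasis
    (by simpa using orthonormal_self_rot hω) with hb
  have hb_repr := (b.measurePreserving_repr_symm.comp (PiLp.volume_preserving_toLp (Fin 2))).comp
    (volume_preserving_finTwoArrow ℝ).symm
  refine (congrArg (MeasurePreserving · volume volume) (funext fun z => ?_)).mpr hb_repr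
  refine Eq.trans ?_ (b.sum_repr_symm (WithLp.toLp 2 ![z.1, z.2]))
  simp [Fin.sum_univ_two, hb]

theorem inner_smul_add_smul_rot (hω : ‖ω‖ = 1) (t s : ℝ) :
    inner ℝ (t • ω + s • rot ω) ω = t := by
  rw [inner_add_left, real_inner_smul_left, real_inner_smul_left, inner_rot_left, inner_rot_self,
    real_inner_self_eq_norm_sq, hω]
  ring

theorem measurableSet_strip (ω : Plane) (t : ℝ) : MeasurableSet (strip ω t) :=
  measurableSet_le (by fun_prop) measurable_const

theorem smul_add_smul_rot_mem_strip (hω : ‖ω‖ = 1) {t t' s : ℝ} :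
    t' • ω + s • rot ω ∈ strip ω t ↔ t' ∈ Icc (t - 1 / 2) (t + 1 / 2) := by
  rw [strip, mem_ofPred_eq, inner_smul_add_smul_rot hω, abs_le, mem_Icc]
  constructor <;> rintro ⟨h₁, h₂⟩ <;> constructor <;> linarith

theorem setLIntegral_strip (hω : ‖ω‖ = 1) (t : ℝ) {φ : Plane → ℝ≥0∞} (hφ : Measurable φ) :
    ∫⁻ x in strip ω t, φ x =
      ∫⁻ t' in Icc (t - 1 / 2) (t + 1 / 2), ∫⁻ s : ℝ, φ (t' • ω + s • rot ω) := by
  have hcoord := measurePreserving_smul_add_smul_rot hω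
  have hind := hφ.indicator (measurableSet_strip ω t)
  rw [← lintegral_indicator (measurableSet_strip ω t), ← hcoord.lintegral_comp hind,
    Measure.volume_eq_prod, lintegral_prod (fun z => (strip ω t).indicator φ _)
      (hind.comp hcoord.measurable).aemeasurable, ← lintegral_indicator measurableSet_Icc]
  refine lintegral_congr fun t' => ?_
  by_cases h : t' ∈ Icc (t - 1 / 2) (t + 1 / 2)
  · simp only [indicator, smul_add_smul_rot_mem_strip hω, h, if_true]
  · simp only [indicator, smul_add_smul_rot_mem_strip hω, h, if_false, lintegral_zero]

theorem radon_eq_lintegral {g : Plane → ℝ≥0∞} (hg : Measurable g) (ω : Plane) (t : ℝ) :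
    radon g ω t = ∫⁻ s : ℝ, g (t • ω + s • rot ω) := by
  rw [radon, lineMeasure, lintegral_map hg (by fun_prop)]

theorem setLIntegral_strip_eq_lintegral_radon (hω : ‖ω‖ = 1) (t : ℝ) {φ : Plane → ℝ≥0∞}
    (hφ : Measurable φ) :
    ∫⁻ x in strip ω t, φ x = ∫⁻ t' in Icc (t - 1 / 2) (t + 1 / 2), radon φ ω t' := by
  simp only [setLIntegral_strip hω t hφ, radon_eq_lintegral hφ]

theorem volume_strip_inter_eq_lintegral (hω : ‖ω‖ = 1) (t : ℝ) {A : Set Plane}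
    (hA : MeasurableSet A) :
    volume.restrict (strip ω t) A = ∫⁻ t' in Icc (t - 1 / 2) (t + 1 / 2), lineMeasure ω t' A := by
  have h := setLIntegral_strip_eq_lintegral_radon hω t (measurable_one.indicator hA)
  simpa only [radon, lintegral_indicator_one hA] using h

end Plane

theorem norm_exp_two_pi_I_mul (x : ℝ) :
    ‖Complex.exp (2 * Real.pi * Complex.I * (x : ℝ))‖ = 1 := by
  rw [show (2 * Real.pi * Complex.I * (x : ℝ) : ℂ) = ((2 * Real.pi * x : ℝ) : ℂ) * Complex.I by
    push_cast; ring]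
  exact Complex.norm_exp_ofReal_mul_I _

theorem enorm_exp_two_pi_I_mul (x : ℝ) :
    ‖Complex.exp (2 * Real.pi * Complex.I * (x : ℝ))‖ₑ = 1 := by
  rw [← ofReal_norm, norm_exp_two_pi_I_mul, ENNReal.ofReal_one]

namespace CompactC2Curve

variable (Γ : CompactC2Curve)

@[fun_prop]
theorem continuous_γ : Continuous Γ.γ := Γ.contDiff.continuous

theorem contDiff_deriv : ContDiff ℝ 1 (deriv Γ.γ) :=
  (contDiff_succ_iff_deriv.1 (show ContDiff ℝ (1 + 1) Γ.γ from Γ.contDiff)).2.2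

@[fun_prop]
theorem continuous_deriv : Continuous (deriv Γ.γ) := Γ.contDiff_deriv.continuous

theorem hasDerivAt_γ (s : ℝ) : HasDerivAt Γ.γ (deriv Γ.γ s) s :=
  (Γ.contDiff.differentiable two_ne_zero s).hasDerivAt

theorem hasDerivAt_deriv (s : ℝ) : HasDerivAt (deriv Γ.γ) (deriv (deriv Γ.γ) s) s :=
  (Γ.contDiff_deriv.differentiable one_ne_zero s).hasDerivAt

/-- The measure `|γ'(s)| ds` on the parameter interval, of which the arc length measure is the
image under `γ`. -/
noncomputable def paramMeasure : Measure ℝ :=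
  (volume.restrict (Icc Γ.a Γ.b)).withDensity fun s => ‖deriv Γ.γ s‖ₑ

theorem arcLength_eq_map : Γ.arcLength = Γ.paramMeasure.map Γ.γ := rfl

theorem exists_norm_deriv_le : ∃ L : ℝ≥0, 0 < L ∧ ∀ s ∈ Icc Γ.a Γ.b, ‖deriv Γ.γ s‖ ≤ L := by
  obtain ⟨L, hL⟩ := isCompact_Icc.exists_bound_of_continuousOn
    (Γ.continuous_deriv.continuousOn (s := Icc Γ.a Γ.b))
  exact ⟨max L.toNNReal 1, by positivity, fun s hs =>
    (hL s hs).trans ((Real.le_coe_toNNReal L).trans (NNReal.coe_le_coe.2 (le_max_left _ _)))⟩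

theorem exists_le_norm_deriv : ∃ c : ℝ, 0 < c ∧ ∀ s ∈ Icc Γ.a Γ.b, c ≤ ‖deriv Γ.γ s‖ := by
  obtain ⟨x, hx, hmin⟩ := isCompact_Icc.exists_isMinOn (nonempty_Icc.2 Γ.lt.le)
    (Γ.continuous_deriv.norm.continuousOn (s := Icc Γ.a Γ.b))
  exact ⟨_, norm_pos_iff.2 (Γ.regular x hx), fun s hs => hmin hs⟩

theorem exists_paramMeasure_le :
    ∃ L : ℝ≥0, Γ.paramMeasure ≤ L • volume.restrict (Icc Γ.a Γ.b) := by
  obtain ⟨L, -, hL⟩ := Γ.exists_norm_deriv_le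
  refine ⟨L, ?_⟩
  rw [paramMeasure, ENNReal.smul_def, ← withDensity_const]
  refine withDensity_mono ((ae_restrict_mem measurableSet_Icc).mono fun s hs => ?_)
  exact enorm_le_coe.2 (hL s hs)

instance : IsFiniteMeasure Γ.paramMeasure := by
  obtain ⟨L, hL⟩ := Γ.exists_paramMeasure_le
  exact isFiniteMeasure_of_le _ hL

instance : IsFiniteMeasure Γ.arcLength := by
  rw [arcLength_eq_map]; infer_instance

theorem ae_paramMeasure_mem : ∀ᵐ s ∂Γ.paramMeasure, s ∈ Icc Γ.a Γ.b :=
  (withDensity_absolutelyContinuous _ _).ae_le (ae_restrict_mem measurableSet_Icc)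

variable {Γ} {f : Plane → ℂ}

theorem eLpNorm_arcLength (hf : Continuous f) (p : ℝ≥0∞) :
    eLpNorm f p Γ.arcLength = eLpNorm (f ∘ Γ.γ) p Γ.paramMeasure :=
  eLpNorm_map_measure hf.aestronglyMeasurable Γ.continuous_γ.measurable.aemeasurable

theorem extension_eq (hf : Continuous f) (x : Plane) :
    Γ.extension f x = ∫ s, f (Γ.γ s) *
      Complex.exp (2 * Real.pi * Complex.I * (inner ℝ (Γ.γ s) x : ℝ)) ∂Γ.paramMeasure := by
  rw [extension, arcLength_eq_map, integral_map Γ.continuous_γ.measurable.aemeasurable]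
  exact Continuous.aestronglyMeasurable (by fun_prop)

theorem enorm_extension_le (f : Plane → ℂ) (x : Plane) :
    ‖Γ.extension f x‖ₑ ≤ eLpNorm f 1 Γ.arcLength := by
  rw [extension, eLpNorm_one_eq_lintegral_enorm]
  refine (enorm_integral_le_lintegral_enorm _).trans_eq (lintegral_congr fun ξ => ?_)
  rw [enorm_mul, enorm_exp_two_pi_I_mul, mul_one]

theorem integrable_comp {E : Type*} [NormedAddCommGroup E] {g : Plane → E} (hg : Continuous g) :
    Integrable (g ∘ Γ.γ) Γ.paramMeasure := by
  have hc : Continuous (g ∘ Γ.γ) := hg.comp Γ.continuous_γ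
  obtain ⟨B, hB⟩ := isCompact_Icc.exists_bound_of_continuousOn
    (hc.continuousOn (s := Icc Γ.a Γ.b))
  exact Integrable.of_bound hc.aestronglyMeasurable B (Γ.ae_paramMeasure_mem.mono hB)

theorem continuous_extension (hf : Continuous f) : Continuous (Γ.extension f) := by
  rw [show Γ.extension f = _ from funext (extension_eq hf)]
  refine continuous_of_dominated (bound := fun s => ‖f (Γ.γ s)‖)
    (fun x => Continuous.aestronglyMeasurable (by fun_prop))
    (fun x => ae_of_all _ fun _ => ?_) (integrable_comp hf).norm
    (ae_of_all _ fun _ => by fun_prop)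
  rw [norm_mul, norm_exp_two_pi_I_mul, mul_one]

theorem integrable_prod_mul_exp_mul (hf : Continuous f) (ω : Plane) (t : ℝ) {g : ℝ → ℂ}
    (hg : Integrable g) :
    Integrable (Function.uncurry fun s σ => f (Γ.γ σ) *
      Complex.exp (2 * Real.pi * Complex.I * (inner ℝ (Γ.γ σ) (t • ω + s • rot ω) : ℝ)) * g s)
      (volume.prod Γ.paramMeasure) := by
  refine (Integrable.bdd_mul (c := 1) (hg.mul_prod (integrable_comp (Γ := Γ) hf))
    (f := fun z : ℝ × ℝ => Complex.exp (2 * Real.pi * Complex.I *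
      (inner ℝ (Γ.γ z.2) (t • ω + z.1 • rot ω) : ℝ)))
    (Continuous.aestronglyMeasurable (by fun_prop))
    (ae_of_all _ fun z => (norm_exp_two_pi_I_mul _).le)).congr (ae_of_all _ fun z => ?_)
  simp only [Function.uncurry, Function.comp]
  ring

/- On the line `x · ω = t`, `E f` is a one-dimensional Fourier transform: the phase at
`x = t ω + s rot ω` is linear in `s` with frequency `γ(σ) · rot ω = -rot (γ(σ)) · ω`. -/
theorem integral_extension_mul (hf : Continuous f) (ω : Plane) (t : ℝ) {g : ℝ → ℂ}
    (hg : Integrable g) :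
    ∫ s, Γ.extension f (t • ω + s • rot ω) * g s =
      ∫ σ, f (Γ.γ σ) * Complex.exp (2 * Real.pi * Complex.I * (t * inner ℝ (Γ.γ σ) ω : ℝ)) *
        𝓕 g (inner ℝ (rot (Γ.γ σ)) ω) ∂Γ.paramMeasure := by
  have split_phase (σ s : ℝ) :
      (2 * Real.pi * Complex.I * (inner ℝ (Γ.γ σ) (t • ω + s • rot ω) : ℝ) : ℂ) =
        2 * Real.pi * Complex.I * (t * inner ℝ (Γ.γ σ) ω : ℝ) +
        (-2 * Real.pi * inner ℝ s (inner ℝ (rot (Γ.γ σ)) ω) : ℝ) * Complex.I := by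
    rw [inner_rot_left]
    simp only [inner_add_right, real_inner_smul_right, RCLike.inner_apply, conj_trivial]
    push_cast
    ring
  calc ∫ s, Γ.extension f (t • ω + s • rot ω) * g s
      = ∫ s, ∫ σ, f (Γ.γ σ) * Complex.exp (2 * Real.pi * Complex.I *
          (inner ℝ (Γ.γ σ) (t • ω + s • rot ω) : ℝ)) * g s ∂Γ.paramMeasure := by
        simp only [extension_eq hf, integral_mul_const]
    _ = ∫ σ, (∫ s, f (Γ.γ σ) * Complex.exp (2 * Real.pi * Complex.I *
          (inner ℝ (Γ.γ σ) (t • ω + s • rot ω) : ℝ)) * g s) ∂Γ.paramMeasure :=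
        integral_integral_swap (integrable_prod_mul_exp_mul hf ω t hg)
    _ = _ := by
        congr! 2 with σ
        rw [Real.fourier_eq', ← integral_const_mul]
        congr! 2
        rw [split_phase, Complex.exp_add, smul_eq_mul]
        ring

variable {ω : Plane}

theorem hasDerivAt_inner_rot (Γ : CompactC2Curve) (ω : Plane) (s : ℝ) :
    HasDerivAt (fun σ => inner ℝ (rot (Γ.γ σ)) ω) (inner ℝ (rot (deriv Γ.γ s)) ω) s := by
  simpa only [inner_rot_left, inner_zero_right, zero_add] using
    ((Γ.hasDerivAt_γ s).inner ℝ (hasDerivAt_const s (rot ω))).fun_neg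

theorem hasDerivAt_inner_rot_deriv (Γ : CompactC2Curve) (ω : Plane) (s : ℝ) :
    HasDerivAt (fun σ => inner ℝ (rot (deriv Γ.γ σ)) ω)
      (inner ℝ (rot (deriv (deriv Γ.γ) s)) ω) s := by
  simpa only [inner_rot_left, inner_zero_right, zero_add] using
    ((Γ.hasDerivAt_deriv s).inner ℝ (hasDerivAt_const s (rot ω))).fun_neg

theorem inner_normal_eq_zero_iff {s : ℝ} (hs : s ∈ Icc Γ.a Γ.b) :
    inner ℝ (Γ.normal s) ω = 0 ↔ inner ℝ (rot (deriv Γ.γ s)) ω = 0 := by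
  simp [normal, real_inner_smul_left, Γ.regular s hs]

theorem inner_rot_deriv_deriv_ne_zero (hω : ω ≠ 0) {s : ℝ} (hcurv : Γ.curvature s ≠ 0)
    (h : inner ℝ (rot (deriv Γ.γ s)) ω = 0) : inner ℝ (rot (deriv (deriv Γ.γ) s)) ω ≠ 0 := by
  contrapose! hω with h'
  simp only [inner_plane, rot, Matrix.cons_val_zero, Matrix.cons_val_one] at h h'
  have hdet := (div_ne_zero_iff.1 hcurv).1
  ext i
  fin_cases i
  · refine (mul_eq_zero.1 (?_ : ω 0 * _ = 0)).resolve_right hdet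
    linear_combination deriv Γ.γ s 0 * (-h') + deriv (deriv Γ.γ) s 0 * h
  · refine (mul_eq_zero.1 (?_ : ω 1 * _ = 0)).resolve_right hdet
    linear_combination deriv (deriv Γ.γ) s 1 * h - deriv Γ.γ s 1 * h'

end CompactC2Curve

section Duality

/-- The function `z ↦ z̄ |z|^(q-2)`, whose composition with `F ∈ L^q` is the extremiser of the
pairing with `F` in the dual space. -/
noncomputable def dualPower (q : ℝ) (z : ℂ) : ℂ := starRingEnd ℂ z * (‖z‖ ^ (q - 2) : ℝ)

theorem continuous_dualPower {q : ℝ} (hq : 2 ≤ q) : Continuous (dualPower q) :=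
  Complex.continuous_conj.mul (Complex.continuous_ofReal.comp
    (continuous_norm.rpow_const fun _ => Or.inr (by linarith)))

theorem norm_dualPower {q : ℝ} (hq : 2 ≤ q) (z : ℂ) : ‖dualPower q z‖ = ‖z‖ ^ (q - 1) := by
  rw [dualPower, norm_mul, RCLike.norm_conj, Complex.norm_real, Real.norm_of_nonneg (by positivity),
    ← Real.rpow_one_add' (norm_nonneg z) (by linarith)]
  ring_nf

theorem mul_dualPower {q : ℝ} (hq : 2 ≤ q) (z : ℂ) : z * dualPower q z = (‖z‖ ^ q : ℝ) := by
  have hpow : ‖z‖ ^ q = ‖z‖ ^ (2 : ℝ) * ‖z‖ ^ (q - 2) := by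
    rw [← Real.rpow_add_of_nonneg (norm_nonneg z) two_pos.le (by linarith)]
    ring_nf
  rw [dualPower, ← mul_assoc, Complex.mul_conj, Complex.normSq_eq_norm_sq, hpow, Real.rpow_two,
    Complex.ofReal_mul]

theorem enorm_dualPower_rpow {r q : ℝ} (hrq : r.HolderConjugate q) (hq : 2 ≤ q) (z : ℂ) :
    ‖dualPower q z‖ₑ ^ r = ‖z‖ₑ ^ q := by
  rw [enorm_rpow_eq_ofReal _ hrq.nonneg, enorm_rpow_eq_ofReal _ hrq.symm.nonneg, norm_dualPower hq,
    ← Real.rpow_mul (norm_nonneg z)]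
  congr 2
  linarith [hrq.mul_eq_add]

variable {X : Type*} [TopologicalSpace X] [T2Space X] [MeasurableSpace X] [OpensMeasurableSpace X]
  {μ : Measure X} [IsFiniteMeasureOnCompacts μ] {F : X → ℂ} {K : Set X} {r q : ℝ}

theorem memLp_indicator_of_isCompact (hF : Continuous F) (hK : IsCompact K) (p : ℝ≥0∞) :
    MemLp (K.indicator F) p μ := by
  obtain ⟨B, hB⟩ := hK.exists_bound_of_continuousOn hF.continuousOn
  have : IsFiniteMeasure (μ.restrict K) := isFiniteMeasure_restrict.2 hK.measure_ne_top
  exact (memLp_indicator_iff_restrict hK.measurableSet).2 (MemLp.of_bound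
    hF.measurable.aestronglyMeasurable B ((ae_restrict_mem hK.measurableSet).mono hB))

theorem setLIntegral_enorm_rpow_lt_top (hF : Continuous F) (hK : IsCompact K) (hq : 0 < q) :
    ∫⁻ x in K, ‖F x‖ₑ ^ q ∂μ < ∞ := by
  have h := (memLp_indicator_iff_restrict hK.measurableSet).1
    (memLp_indicator_of_isCompact (μ := μ) hF hK (ENNReal.ofReal q))
  simpa [ENNReal.toReal_ofReal hq.le] using lintegral_rpow_enorm_lt_top_of_eLpNorm_lt_top
    (by simpa using hq) ENNReal.ofReal_ne_top h.2

theorem enorm_integral_mul_indicator_dualPower (hF : Continuous F) (hK : IsCompact K)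
    (hq : 2 ≤ q) :
    ‖∫ x, F x * K.indicator (dualPower q ∘ F) x ∂μ‖ₑ = ∫⁻ x in K, ‖F x‖ₑ ^ q ∂μ := by
  have hpair : (fun x => F x * K.indicator (dualPower q ∘ F) x) =
      K.indicator fun x => ((‖F x‖ ^ q : ℝ) : ℂ) := by
    ext x
    by_cases hx : x ∈ K <;> simp [hx, mul_dualPower hq]
  have hmeas : Measurable fun x => ‖F x‖ ^ q := hF.norm.measurable.pow_const q
  rw [hpair, integral_indicator hK.measurableSet, integral_complex_ofReal,
    integral_eq_lintegral_of_nonneg_ae (ae_of_all _ fun x => by positivity)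
      hmeas.aestronglyMeasurable]
  simp only [← enorm_rpow_eq_ofReal _ (show 0 ≤ q by linarith)]
  rw [← ofReal_norm, Complex.norm_real, Real.norm_of_nonneg ENNReal.toReal_nonneg,
    ENNReal.ofReal_toReal (setLIntegral_enorm_rpow_lt_top hF hK (by linarith)).ne]

theorem setLIntegral_rpow_le_of_forall_integral_mul_le (hrq : r.HolderConjugate q) (hq : 2 ≤ q)
    (hF : Continuous F) {D : ℝ≥0∞}
    (h : ∀ g : X → ℂ, Measurable g → Integrable g μ → MemLp g 2 μ →
      ‖∫ x, F x * g x ∂μ‖ₑ ≤ D * (∫⁻ x, ‖g x‖ₑ ^ r ∂μ) ^ (1 / r)) (hK : IsCompact K) :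
    ∫⁻ x in K, ‖F x‖ₑ ^ q ∂μ ≤ D ^ q := by
  have hq0 : 0 < q := by linarith
  have hdual : Continuous (dualPower q ∘ F) := (continuous_dualPower hq).comp hF
  have test := h (K.indicator (dualPower q ∘ F)) (hdual.measurable.indicator hK.measurableSet)
    (memLp_one_iff_integrable.1 (memLp_indicator_of_isCompact hdual hK 1))
    (memLp_indicator_of_isCompact hdual hK 2)
  have hnorm : ∫⁻ x, ‖K.indicator (dualPower q ∘ F) x‖ₑ ^ r ∂μ = ∫⁻ x in K, ‖F x‖ₑ ^ q ∂μ := by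
    rw [← lintegral_indicator hK.measurableSet]
    congr! with x
    by_cases hx : x ∈ K <;> simp [hx, enorm_dualPower_rpow hrq hq, hrq.pos]
  rw [hnorm, enorm_integral_mul_indicator_dualPower hF hK hq] at test
  set I := ∫⁻ x in K, ‖F x‖ₑ ^ q ∂μ
  have hI : I ≠ ∞ := (setLIntegral_enorm_rpow_lt_top hF hK hq0).ne
  rcases eq_or_ne I 0 with h0 | h0
  · simp [h0]
  have hsplit : I = I ^ (1 / q) * I ^ (1 / r) := by
    rw [← ENNReal.rpow_add _ _ h0 hI, one_div, one_div, add_comm, hrq.inv_add_inv_eq_one,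
      ENNReal.rpow_one]
  nth_rw 1 [hsplit] at test
  rwa [ENNReal.mul_le_mul_iff_left (by simp [ENNReal.rpow_eq_zero_iff, h0, hI])
    (ENNReal.rpow_ne_top_of_nonneg (one_div_nonneg.2 hrq.nonneg) hI), one_div,
    ENNReal.rpow_inv_le_iff hq0] at test

theorem lintegral_rpow_le_of_forall_integral_mul_le [SigmaCompactSpace X]
    (hrq : r.HolderConjugate q) (hq : 2 ≤ q) (hF : Continuous F) {D : ℝ≥0∞}
    (h : ∀ g : X → ℂ, Measurable g → Integrable g μ → MemLp g 2 μ →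
      ‖∫ x, F x * g x ∂μ‖ₑ ≤ D * (∫⁻ x, ‖g x‖ₑ ^ r ∂μ) ^ (1 / r)) :
    ∫⁻ x, ‖F x‖ₑ ^ q ∂μ ≤ D ^ q := by
  rw [← setLIntegral_univ, ← iUnion_compactCovering,
    setLIntegral_iUnion_of_directed _ (directed_of_isDirected_le (compactCovering_subset X))]
  exact iSup_le fun n => setLIntegral_rpow_le_of_forall_integral_mul_le hrq hq hF h
    (isCompact_compactCovering X n)

end Duality

section Sufficiency

variable {Γ : CompactC2Curve} {ω : Plane} {p q : ℝ≥0∞}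

theorem radonRoot_of_ne_top {F : Plane → ℂ} (hF : Continuous F) (hq : q ≠ ∞) (ω : Plane) (t : ℝ) :
    radonRoot F q ω t =
      (∫⁻ s : ℝ, ‖F (t • ω + s • rot ω)‖ₑ ^ q.toReal) ^ (1 / q.toReal) := by
  rw [radonRoot, if_neg hq, radon_eq_lintegral (hF.enorm.measurable.pow_const _)]

theorem eLpNorm_strip_le_of_radonRoot_le (hω : ‖ω‖ = 1) {F : Plane → ℂ} (hF : Continuous F)
    {D : ℝ≥0∞} (h : ∀ t, radonRoot F q ω t ≤ D) (t : ℝ) :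
    eLpNorm F q (volume.restrict (strip ω t)) ≤ D := by
  rcases eq_or_ne q 0 with rfl | hq0
  · simp
  rcases eq_or_ne q ∞ with rfl | hqt
  · rw [eLpNorm_exponent_top]
    refine eLpNormEssSup_le_of_ae_enorm_bound ?_
    have hmeas : MeasurableSet {x | ¬ ‖F x‖ₑ ≤ D} :=
      (measurableSet_le hF.enorm.measurable measurable_const).compl
    have hline (t' : ℝ) : lineMeasure ω t' {x | ¬ ‖F x‖ₑ ≤ D} = 0 := by
      have := h t'
      rw [radonRoot, if_pos rfl] at this
      exact (ENNReal.ae_le_essSup _).mono fun x hx => hx.trans this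
    rw [ae_iff, volume_strip_inter_eq_lintegral hω t hmeas]
    simp only [hline, lintegral_zero]
  · have hqr : 0 < q.toReal := ENNReal.toReal_pos hq0 hqt
    rw [eLpNorm_eq_lintegral_rpow_enorm_toReal hq0 hqt, one_div, ENNReal.rpow_inv_le_iff hqr,
      setLIntegral_strip_eq_lintegral_radon hω t (hF.enorm.measurable.pow_const _)]
    calc ∫⁻ t' in Icc (t - 1 / 2) (t + 1 / 2), radon (fun x => ‖F x‖ₑ ^ q.toReal) ω t'
        ≤ ∫⁻ _ in Icc (t - 1 / 2) (t + 1 / 2), D ^ q.toReal := by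
          gcongr with t'
          simpa only [radonRoot, if_neg hqt, one_div, ENNReal.rpow_inv_le_iff hqr] using h t'
      _ = D ^ q.toReal := by
          rw [setLIntegral_const, Real.volume_Icc, show t + 1 / 2 - (t - 1 / 2) = 1 by ring]
          simp

theorem RadonEstimate.stripEstimate (h : RadonEstimate Γ ω p q) (hω : ‖ω‖ = 1) :
    StripEstimate Γ ω p q :=
  let ⟨C, hC⟩ := h
  ⟨C, fun f => eLpNorm_strip_le_of_radonRoot_le hω
    (CompactC2Curve.continuous_extension f.continuous) (hC f)⟩

theorem StripEstimate.stripEstimateAt (h : StripEstimate Γ ω p q) (t : ℝ) :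
    StripEstimateAt Γ ω p q t :=
  let ⟨C, hC⟩ := h
  ⟨C, fun f => hC f t⟩

theorem radonEstimate_top (hp : 1 ≤ p) : RadonEstimate Γ ω p ∞ := by
  have hexp : 0 ≤ 1 / (1 : ℝ≥0∞).toReal - 1 / p.toReal := by
    rcases eq_or_ne p ∞ with rfl | hpt
    · simp
    · have : 1 ≤ p.toReal := by simpa using ENNReal.toReal_mono hpt hp
      simpa using inv_le_one_of_one_le₀ this
  refine ⟨(Γ.arcLength univ ^ (1 / (1 : ℝ≥0∞).toReal - 1 / p.toReal)).toNNReal, fun f t => ?_⟩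
  rw [radonRoot, if_pos rfl,
    ENNReal.coe_toNNReal (ENNReal.rpow_ne_top_of_nonneg hexp (measure_ne_top _ _)), mul_comm]
  refine essSup_le_of_ae_le _ (ae_of_all _ fun x => ?_)
  exact (CompactC2Curve.enorm_extension_le f x).trans
    (eLpNorm_le_eLpNorm_mul_rpow_measure_univ hp f.continuous.aestronglyMeasurable)

theorem enorm_integral_extension_mul_le {P : ℝ≥0∞} [P.HolderConjugate p] {f : Plane → ℂ}
    (hf : Continuous f) (t : ℝ) {g : ℝ → ℂ} (hg : Integrable g) :
    ‖∫ s : ℝ, Γ.extension f (t • ω + s • rot ω) * g s‖ₑ ≤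
      eLpNorm (fun σ => 𝓕 g (inner ℝ (rot (Γ.γ σ)) ω)) P Γ.paramMeasure *
        eLpNorm f p Γ.arcLength := by
  have hG : Continuous fun σ => 𝓕 g (inner ℝ (rot (Γ.γ σ)) ω) := by
    simp only [inner_rot_left]
    exact (continuous_fourier hg).comp (by fun_prop)
  calc ‖∫ s : ℝ, Γ.extension f (t • ω + s • rot ω) * g s‖ₑ
      ≤ ∫⁻ σ, ‖𝓕 g (inner ℝ (rot (Γ.γ σ)) ω) • f (Γ.γ σ)‖ₑ ∂Γ.paramMeasure := by
        rw [CompactC2Curve.integral_extension_mul hf ω t hg]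
        refine (enorm_integral_le_lintegral_enorm _).trans_eq (lintegral_congr fun σ => ?_)
        rw [enorm_mul, enorm_mul, enorm_exp_two_pi_I_mul, mul_one, enorm_smul, mul_comm]
    _ ≤ eLpNorm (fun σ => 𝓕 g (inner ℝ (rot (Γ.γ σ)) ω)) P Γ.paramMeasure *
          eLpNorm (f ∘ Γ.γ) p Γ.paramMeasure := by
        have holder := eLpNorm_smul_le_mul_eLpNorm (p := P) (q := p) (r := 1)
          (hf.comp Γ.continuous_γ).aestronglyMeasurable
          (hG.aestronglyMeasurable (μ := Γ.paramMeasure))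
        rwa [eLpNorm_one_eq_lintegral_enorm] at holder
    _ = _ := by rw [CompactC2Curve.eLpNorm_arcLength hf]

/- Duality on each line turns the Radon estimate into the bound for the Fourier transform at the
frequencies `rot (γ(σ)) · ω`; Hölder's inequality along the curve then separates off `f`. -/
theorem FourierBound.radonEstimate {r Q P : ℝ}
    (h : FourierBound ((volume.restrict (Icc Γ.a Γ.b)).map fun σ => inner ℝ (rot (Γ.γ σ)) ω) r P)
    (hrQ : r.HolderConjugate Q) (hQ : 2 ≤ Q) (hP : 0 < P)
    (hPp : (ENNReal.ofReal P).HolderConjugate p) :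
    RadonEstimate Γ ω p (ENNReal.ofReal Q) := by
  obtain ⟨C, hC⟩ := h
  obtain ⟨L, hL⟩ := Γ.exists_paramMeasure_le
  have hH : Continuous fun σ => inner ℝ (rot (Γ.γ σ)) ω := by
    simp only [inner_rot_left]; fun_prop
  refine ⟨(L * C) ^ (1 / P), fun f t => ?_⟩
  have hF := CompactC2Curve.continuous_extension (Γ := Γ) f.continuous
  have hQ0 : 0 < Q := by linarith
  rw [radonRoot_of_ne_top hF ENNReal.ofReal_ne_top, ENNReal.toReal_ofReal hQ0.le, one_div Q,
    ENNReal.rpow_inv_le_iff hQ0]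
  refine lintegral_rpow_le_of_forall_integral_mul_le hrQ hQ (by fun_prop) fun g hgm hg hg2 => ?_
  have fourier_le : eLpNorm (fun σ => 𝓕 g (inner ℝ (rot (Γ.γ σ)) ω)) (ENNReal.ofReal P)
      Γ.paramMeasure ≤ ((L * C : ℝ≥0) * (∫⁻ s, ‖g s‖ₑ ^ r) ^ (P / r)) ^ (1 / P) := by
    rw [eLpNorm_eq_lintegral_rpow_enorm_toReal (by simpa using hP) ENNReal.ofReal_ne_top,
      ENNReal.toReal_ofReal hP.le, ENNReal.coe_mul, mul_assoc]
    gcongr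
    refine (lintegral_mono' hL le_rfl).trans ?_
    rw [lintegral_smul_measure, ENNReal.smul_def, smul_eq_mul]
    gcongr
    rw [← lintegral_map ((continuous_fourier hg).enorm.measurable.pow_const _) hH.measurable]
    exact hC g hgm hg hg2
  refine (enorm_integral_extension_mul_le (p := p) f.continuous t hg).trans
    ((mul_le_mul_left fourier_le _).trans_eq ?_)
  rw [ENNReal.mul_rpow_of_nonneg _ _ (by positivity), ← ENNReal.rpow_mul,
    ENNReal.coe_rpow_of_nonneg _ (by positivity), div_mul_div_comm, mul_one,
    mul_comm r P, div_mul_cancel_left₀ hP.ne', one_div r, mul_right_comm]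

end Sufficiency

section Exponents

variable {p q : ℝ≥0∞}

theorem one_div_add_natCast_div_eq_ofReal (hp : p ≠ 0) (hq : q ≠ 0) (k : ℕ) :
    1 / p + k / q = ENNReal.ofReal (p⁻¹.toReal + k * q⁻¹.toReal) := by
  rw [ENNReal.ofReal_add ENNReal.toReal_nonneg (by positivity),
    ENNReal.ofReal_mul (Nat.cast_nonneg k), ENNReal.ofReal_natCast,
    ENNReal.ofReal_toReal (ENNReal.inv_ne_top.2 hp),
    ENNReal.ofReal_toReal (ENNReal.inv_ne_top.2 hq), one_div, div_eq_mul_inv]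

theorem one_div_add_natCast_div_le_one_iff (hp : p ≠ 0) (hq : q ≠ 0) (k : ℕ) :
    1 / p + k / q ≤ 1 ↔ p⁻¹.toReal + k * q⁻¹.toReal ≤ 1 := by
  rw [one_div_add_natCast_div_eq_ofReal hp hq, ENNReal.ofReal_le_one]

theorem one_div_add_natCast_div_lt_one_iff (hp : p ≠ 0) (hq : q ≠ 0) (k : ℕ) :
    1 / p + k / q < 1 ↔ p⁻¹.toReal + k * q⁻¹.toReal < 1 := by
  rw [one_div_add_natCast_div_eq_ofReal hp hq, ENNReal.ofReal_lt_one]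

theorem inv_toReal_lt_inv_toReal_iff (hp : p ≠ 0) (hq : q ≠ 0) :
    p⁻¹.toReal < q⁻¹.toReal ↔ q < p := by
  rw [ENNReal.toReal_lt_toReal (ENNReal.inv_ne_top.2 hp) (ENNReal.inv_ne_top.2 hq),
    ENNReal.inv_lt_inv]

theorem ofReal_holderConjugate (hp : p ≠ 0) (h : p⁻¹.toReal < 1) :
    (ENNReal.ofReal (1 - p⁻¹.toReal)⁻¹).HolderConjugate p := by
  have h₀ : 0 ≤ p⁻¹.toReal := ENNReal.toReal_nonneg
  rw [ENNReal.holderConjugate_iff, ENNReal.ofReal_inv_of_pos (by linarith), inv_inv]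
  nth_rw 2 [← ENNReal.ofReal_toReal (ENNReal.inv_ne_top.2 hp)]
  rw [← ENNReal.ofReal_add (by linarith) h₀, sub_add_cancel, ENNReal.ofReal_one]

theorem inv_one_sub_lt_or_eq {x Q : ℝ} (hQ : 0 < Q) (h : x + 2 * Q⁻¹ ≤ 1)
    (hlt : x < Q⁻¹ → x + 2 * Q⁻¹ < 1) :
    (1 - x)⁻¹ < Q / 2 ∨ 3 ≤ Q ∧ (1 - x)⁻¹ = Q / 2 := by
  rcases h.lt_or_eq with h | h
  · left
    refine inv_lt_of_inv_lt₀ (by positivity) ?_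
    rw [inv_div, div_eq_mul_inv]; linarith
  · right
    have hx : Q⁻¹ ≤ x := not_lt.1 fun hx => (hlt hx).ne h
    refine ⟨(inv_le_inv₀ hQ three_pos).1 (by linarith), ?_⟩
    rw [show 1 - x = 2 * Q⁻¹ by linarith]
    field_simp

end Exponents

section Sufficiency

variable {Γ : CompactC2Curve} {ω : Plane} {p q : ℝ≥0∞}

theorem continuous_inner_rot_deriv (Γ : CompactC2Curve) (ω : Plane) :
    Continuous fun σ => inner ℝ (rot (deriv Γ.γ σ)) ω :=
  continuous_iff_continuousAt.2 fun σ => (Γ.hasDerivAt_inner_rot_deriv ω σ).continuousAt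

theorem radonEstimate_of_fourierBound (hp : p ≠ 0) (hp' : p⁻¹.toReal < 1) (hq : 2 ≤ q)
    (hqt : q ≠ ∞)
    (h : ∀ r : ℝ, r.HolderConjugate q.toReal → r ≤ 2 → FourierBound
      ((volume.restrict (Icc Γ.a Γ.b)).map fun σ => inner ℝ (rot (Γ.γ σ)) ω) r
      (1 - p⁻¹.toReal)⁻¹) :
    RadonEstimate Γ ω p q := by
  have hQ : 2 ≤ q.toReal := by simpa using ENNReal.toReal_mono hqt hq
  have hconj := (Real.HolderConjugate.conjExponent (show 1 < q.toReal by linarith)).symm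
  have hr : q.toReal.conjExponent ≤ 2 := by
    rw [Real.conjExponent, div_le_iff₀ (by linarith)]; linarith
  have := (h _ hconj hr).radonEstimate hconj hQ (inv_pos.2 (by linarith))
    (ofReal_holderConjugate hp hp')
  rwa [ENNReal.ofReal_toReal hqt] at this

theorem radonEstimate_of_transversal (ht : Γ.Transversal ω) (h : 1 / p + 1 / q ≤ 1)
    (hq : 2 ≤ q) : RadonEstimate Γ ω p q := by
  have hp : 1 ≤ p := by simpa using le_self_add.trans h
  rcases eq_or_ne q ∞ with rfl | hqt
  · exact radonEstimate_top hp
  have hp0 : p ≠ 0 := (zero_lt_one.trans_le hp).ne'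
  have hq0 : q ≠ 0 := (zero_lt_two.trans_le hq).ne'
  have h' : p⁻¹.toReal + q⁻¹.toReal ≤ 1 := by
    simpa using (one_div_add_natCast_div_le_one_iff hp0 hq0 1).1 (by simpa using h)
  have hqinv : 0 < q⁻¹.toReal := by
    rw [ENNReal.toReal_inv]; exact inv_pos.2 (ENNReal.toReal_pos hq0 hqt)
  refine radonEstimate_of_fourierBound hp0 (by linarith) hq hqt fun r hr hr2 => ?_
  have hle : (1 - p⁻¹.toReal)⁻¹ ≤ q.toReal := by
    refine inv_le_of_inv_le₀ (ENNReal.toReal_pos hq0 hqt) ?_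
    rw [← ENNReal.toReal_inv]; linarith
  exact (fourierBound_map_of_deriv_ne_zero hr hr2 (Γ.hasDerivAt_inner_rot ω)
    (continuous_inner_rot_deriv Γ ω) isCompact_Icc fun s hs =>
      (CompactC2Curve.inner_normal_eq_zero_iff hs).not.1 (ht s hs)).of_le_of_isFiniteMeasure
    hr.pos (inv_nonneg.2 (by linarith)) hr.symm.pos hle

theorem radonEstimate_of_curvature_ne_zero (hω : ω ≠ 0)
    (hcurv : ∀ s ∈ Icc Γ.a Γ.b, inner ℝ (Γ.normal s) ω = 0 → Γ.curvature s ≠ 0)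
    (h : (p ≤ q → 1 / p + 2 / q ≤ 1) ∧ (q < p → 1 / p + 2 / q < 1)) :
    RadonEstimate Γ ω p q := by
  have hle : 1 / p + 2 / q ≤ 1 := (le_or_gt p q).elim h.1 fun hpq => (h.2 hpq).le
  have hp : 1 ≤ p := by simpa using le_self_add.trans hle
  have hq : 2 ≤ q := by
    simpa using (ENNReal.div_le_iff_le_mul (by simp) (by simp)).1 (le_add_self.trans hle)
  rcases eq_or_ne q ∞ with rfl | hqt
  · exact radonEstimate_top hp
  have hp0 : p ≠ 0 := (zero_lt_one.trans_le hp).ne'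
  have hq0 : q ≠ 0 := (zero_lt_two.trans_le hq).ne'
  have hQ : 0 < q.toReal := ENNReal.toReal_pos hq0 hqt
  have hle' : p⁻¹.toReal + 2 * q⁻¹.toReal ≤ 1 := by
    exact_mod_cast (one_div_add_natCast_div_le_one_iff hp0 hq0 2).1 (by exact_mod_cast hle)
  have hlt' : p⁻¹.toReal < q⁻¹.toReal → p⁻¹.toReal + 2 * q⁻¹.toReal < 1 := fun hpq => by
    have := h.2 ((inv_toReal_lt_inv_toReal_iff hp0 hq0).1 hpq)
    exact_mod_cast (one_div_add_natCast_div_lt_one_iff hp0 hq0 2).1 (by exact_mod_cast this)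
  rw [ENNReal.toReal_inv q] at hle' hlt'
  have hlt : p⁻¹.toReal < 1 := by have := inv_pos.2 hQ; linarith
  exact radonEstimate_of_fourierBound hp0 hlt hq hqt fun r hr hr2 =>
    fourierBound_map_of_nondegenerate hr hr2 (inv_pos.2 (by linarith))
      (inv_one_sub_lt_or_eq hQ hle' hlt') (Γ.hasDerivAt_inner_rot ω)
      (Γ.hasDerivAt_inner_rot_deriv ω) isCompact_Icc fun s hs h0 =>
        CompactC2Curve.inner_rot_deriv_deriv_ne_zero hω
          (hcurv s hs ((CompactC2Curve.inner_normal_eq_zero_iff hs).2 h0)) h0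

end Sufficiency

section Khintchine

/-- The sign of `k`: `1` if `k ∈ s` and `-1` otherwise. Averages over the subsets `s` of `range N`
stand for expectations over `N` independent random signs. -/
noncomputable def setSign (s : Finset ℕ) (k : ℕ) : ℝ := if k ∈ s then 1 else -1

/-- The sum of `z k` over `k < N`, with the signs given by `s`. -/
noncomputable def signedSum (N : ℕ) (z : ℕ → ℂ) (s : Finset ℕ) : ℂ :=
  ∑ k ∈ Finset.range N, (setSign s k : ℂ) * z k

theorem signedSum_succ {N : ℕ} {z : ℕ → ℂ} {s : Finset ℕ} (hs : s ⊆ Finset.range N) :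
    signedSum (N + 1) z s = signedSum N z s - z N := by
  have hN : N ∉ s := fun h => by simpa using hs h
  rw [signedSum, Finset.sum_range_succ, signedSum, setSign, if_neg hN]
  push_cast; ring

theorem signedSum_succ_insert (N : ℕ) (z : ℕ → ℂ) (s : Finset ℕ) :
    signedSum (N + 1) z (insert N s) = signedSum N z s + z N := by
  rw [signedSum, Finset.sum_range_succ, signedSum, setSign, if_pos (Finset.mem_insert_self _ _)]
  congr 1
  · refine Finset.sum_congr rfl fun k hk => ?_
    have : k ≠ N := (Finset.mem_range.1 hk).ne
    simp [setSign, this]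
  · simp

theorem sum_powerset_signedSum_succ (N : ℕ) (z : ℕ → ℂ) (φ : ℂ → ℝ) :
    ∑ s ∈ (Finset.range (N + 1)).powerset, φ (signedSum (N + 1) z s) =
      ∑ s ∈ (Finset.range N).powerset, (φ (signedSum N z s - z N) + φ (signedSum N z s + z N)) := by
  rw [Finset.range_add_one, Finset.sum_powerset_insert (by simp), Finset.sum_add_distrib]
  congr 1
  · refine Finset.sum_congr rfl fun s hs => ?_
    rw [signedSum_succ (Finset.mem_powerset.1 hs)]
  · refine Finset.sum_congr rfl fun s _ => ?_
    rw [signedSum_succ_insert]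

theorem norm_sub_sq_add_norm_add_sq (w z : ℂ) :
    ‖w - z‖ ^ 2 + ‖w + z‖ ^ 2 = 2 * (‖w‖ ^ 2 + ‖z‖ ^ 2) := by
  have := parallelogram_law_with_norm ℝ w z
  nlinarith

theorem norm_sub_pow_four_add_norm_add_pow_four_le (w z : ℂ) :
    ‖w - z‖ ^ 4 + ‖w + z‖ ^ 4 ≤ 2 * (‖w‖ ^ 4 + 6 * (‖w‖ ^ 2 * ‖z‖ ^ 2) + ‖z‖ ^ 4) := by
  have h1 := norm_sub_sq_real w z
  have h2 := norm_add_sq_real w z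
  have h3 := abs_real_inner_le_norm w z
  have h4 : (inner ℝ w z) ^ 2 ≤ (‖w‖ * ‖z‖) ^ 2 := sq_le_sq' (abs_le.1 h3).1 (abs_le.1 h3).2
  have e1 : ‖w - z‖ ^ 4 = (‖w - z‖ ^ 2) ^ 2 := by ring
  have e2 : ‖w + z‖ ^ 4 = (‖w + z‖ ^ 2) ^ 2 := by ring
  rw [e1, e2, h1, h2]
  nlinarith

theorem sum_norm_signedSum_sq (N : ℕ) (z : ℕ → ℂ) :
    ∑ s ∈ (Finset.range N).powerset, ‖signedSum N z s‖ ^ 2 =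
      2 ^ N * ∑ k ∈ Finset.range N, ‖z k‖ ^ 2 := by
  induction N with
  | zero => simp [signedSum]
  | succ N ih =>
    rw [sum_powerset_signedSum_succ N z fun w => ‖w‖ ^ 2]
    simp only [norm_sub_sq_add_norm_add_sq]
    rw [← Finset.mul_sum, Finset.sum_add_distrib, ih, Finset.sum_const, Finset.card_powerset,
      Finset.card_range, Finset.sum_range_succ, nsmul_eq_mul]
    push_cast
    ring

theorem sum_norm_signedSum_pow_four_le (N : ℕ) (z : ℕ → ℂ) :
    ∑ s ∈ (Finset.range N).powerset, ‖signedSum N z s‖ ^ 4 ≤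
      2 ^ N * (3 * (∑ k ∈ Finset.range N, ‖z k‖ ^ 2) ^ 2) := by
  induction N with
  | zero => simp [signedSum]
  | succ N ih =>
    rw [sum_powerset_signedSum_succ N z fun w => ‖w‖ ^ 4]
    refine (Finset.sum_le_sum fun s _ => norm_sub_pow_four_add_norm_add_pow_four_le _ _).trans ?_
    rw [← Finset.mul_sum, Finset.sum_add_distrib, Finset.sum_add_distrib, Finset.sum_const,
      ← Finset.mul_sum, ← Finset.sum_mul, sum_norm_signedSum_sq, Finset.card_powerset,
      Finset.card_range, Finset.sum_range_succ, nsmul_eq_mul]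
    push_cast
    have h2 : (0 : ℝ) < 2 ^ N := by positivity
    rw [pow_succ (2 : ℝ) N]
    nlinarith [mul_nonneg h2.le (by positivity : (0 : ℝ) ≤ ‖z N‖ ^ 4)]

theorem sq_le_rpow_add_pow_four {y A q : ℝ} (hy : 0 ≤ y) (hA : 0 < A) (hq0 : 0 < q) (hq : q ≤ 2) :
    y ^ 2 ≤ A ^ (2 - q) * y ^ q + y ^ 4 / A ^ 2 := by
  rcases le_or_gt y A with h | h
  · have h1 : y ^ 2 ≤ A ^ (2 - q) * y ^ q := by
      rcases hy.eq_or_lt with h0 | h0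
      · rw [← h0, Real.zero_rpow hq0.ne']; simp
      · calc y ^ 2 = y ^ (2 - q) * y ^ q := by
              rw [← Real.rpow_add h0, sub_add_cancel, Real.rpow_two]
          _ ≤ _ := by gcongr
    have : 0 ≤ y ^ 4 / A ^ 2 := by positivity
    linarith
  · have h1 : y ^ 2 ≤ y ^ 4 / A ^ 2 := by
      rw [le_div_iff₀ (by positivity), show y ^ 4 = y ^ 2 * y ^ 2 by ring]
      gcongr
    have : 0 ≤ A ^ (2 - q) * y ^ q := by positivity
    linarith

theorem sq_le_rpow_add_sq {y A q : ℝ} (hy : 0 ≤ y) (hA : 0 < A) (hq : 2 ≤ q) :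
    y ^ 2 ≤ A ^ (2 - q) * y ^ q + A ^ 2 := by
  rcases le_or_gt y A with h | h
  · have h1 : y ^ 2 ≤ A ^ 2 := by gcongr
    have : 0 ≤ A ^ (2 - q) * y ^ q := by positivity
    linarith
  · have h0 : 0 < y := hA.trans h
    have h1 : y ^ 2 ≤ A ^ (2 - q) * y ^ q := by
      calc y ^ 2 = y ^ (2 - q) * y ^ q := by
            rw [← Real.rpow_add h0, sub_add_cancel, Real.rpow_two]
        _ ≤ _ := mul_le_mul_of_nonneg_right
            (Real.rpow_le_rpow_of_nonpos hA h.le (by linarith)) (by positivity)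
    have : 0 ≤ A ^ 2 := by positivity
    linarith

theorem rpow_sub_div_two_eq_sqrt_rpow {x : ℝ} (hx : 0 ≤ x) (q : ℝ) :
    x ^ ((2 - q) / 2) = √x ^ (2 - q) := by
  rw [Real.sqrt_eq_rpow, ← Real.rpow_mul hx]; ring_nf

theorem sum_norm_sq_le_sum_norm_signedSum_rpow_of_le_two {q : ℝ} (hq0 : 0 < q) (hq : q ≤ 2) (N : ℕ)
    (z : ℕ → ℂ) (hz : 0 < ∑ k ∈ Finset.range N, ‖z k‖ ^ 2) :
    2 ^ N * ((∑ k ∈ Finset.range N, ‖z k‖ ^ 2) / 2) ≤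
      (6 * ∑ k ∈ Finset.range N, ‖z k‖ ^ 2) ^ ((2 - q) / 2) *
        ∑ s ∈ (Finset.range N).powerset, ‖signedSum N z s‖ ^ q := by
  set S := ∑ k ∈ Finset.range N, ‖z k‖ ^ 2 with hS
  have hA : 0 < √(6 * S) := Real.sqrt_pos.2 (by positivity)
  have second_moment := Finset.sum_le_sum fun s (_ : s ∈ (Finset.range N).powerset) =>
    sq_le_rpow_add_pow_four (norm_nonneg (signedSum N z s)) hA hq0 hq
  rw [sum_norm_signedSum_sq, Finset.sum_add_distrib, ← Finset.mul_sum, ← Finset.sum_div,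
    Real.sq_sqrt (by positivity)] at second_moment
  have fourth_moment :
      (∑ s ∈ (Finset.range N).powerset, ‖signedSum N z s‖ ^ 4) / (6 * S) ≤ 2 ^ N * (S / 2) := by
    rw [div_le_iff₀ (by positivity)]
    refine (sum_norm_signedSum_pow_four_le N z).trans_eq ?_
    rw [← hS]; ring
  rw [rpow_sub_div_two_eq_sqrt_rpow (by positivity)]
  linarith

theorem sum_norm_sq_le_sum_norm_signedSum_rpow_of_two_le {q : ℝ} (hq : 2 ≤ q) (N : ℕ)
    (z : ℕ → ℂ) (hz : 0 < ∑ k ∈ Finset.range N, ‖z k‖ ^ 2) :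
    2 ^ N * ((∑ k ∈ Finset.range N, ‖z k‖ ^ 2) / 2) ≤
      (1 / 2 * ∑ k ∈ Finset.range N, ‖z k‖ ^ 2) ^ ((2 - q) / 2) *
        ∑ s ∈ (Finset.range N).powerset, ‖signedSum N z s‖ ^ q := by
  set S := ∑ k ∈ Finset.range N, ‖z k‖ ^ 2
  have hA : 0 < √(1 / 2 * S) := Real.sqrt_pos.2 (by positivity)
  have second_moment := Finset.sum_le_sum fun s (_ : s ∈ (Finset.range N).powerset) =>
    sq_le_rpow_add_sq (norm_nonneg (signedSum N z s)) hA hq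
  rw [sum_norm_signedSum_sq, Finset.sum_add_distrib, ← Finset.mul_sum, Finset.sum_const,
    Finset.card_powerset, Finset.card_range, nsmul_eq_mul, Real.sq_sqrt (by positivity)]
    at second_moment
  push_cast at second_moment
  rw [rpow_sub_div_two_eq_sqrt_rpow (by positivity)]
  linarith

theorem exists_khintchine_lower {q : ℝ} (hq : 0 < q) :
    ∃ c : ℝ, 0 < c ∧ ∀ (N : ℕ) (z : ℕ → ℂ),
      2 ^ N * (c * (∑ k ∈ Finset.range N, ‖z k‖ ^ 2) ^ (q / 2)) ≤
        ∑ s ∈ (Finset.range N).powerset, ‖signedSum N z s‖ ^ q := by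
  obtain ⟨B, hB, hmoment⟩ : ∃ B : ℝ, 0 < B ∧ ∀ (N : ℕ) (z : ℕ → ℂ),
      0 < ∑ k ∈ Finset.range N, ‖z k‖ ^ 2 →
      2 ^ N * ((∑ k ∈ Finset.range N, ‖z k‖ ^ 2) / 2) ≤
        (B * ∑ k ∈ Finset.range N, ‖z k‖ ^ 2) ^ ((2 - q) / 2) *
          ∑ s ∈ (Finset.range N).powerset, ‖signedSum N z s‖ ^ q :=
    (le_total q 2).elim
      (fun h => ⟨6, by norm_num, sum_norm_sq_le_sum_norm_signedSum_rpow_of_le_two hq h⟩)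
      (fun h => ⟨1 / 2, by norm_num, sum_norm_sq_le_sum_norm_signedSum_rpow_of_two_le h⟩)
  refine ⟨(2 * B ^ ((2 - q) / 2))⁻¹, by positivity, fun N z => ?_⟩
  have hS0 : 0 ≤ ∑ k ∈ Finset.range N, ‖z k‖ ^ 2 := Finset.sum_nonneg fun k _ => by positivity
  have hmoment := hmoment N z
  set S := ∑ k ∈ Finset.range N, ‖z k‖ ^ 2
  set X := ∑ s ∈ (Finset.range N).powerset, ‖signedSum N z s‖ ^ q
  rcases hS0.eq_or_lt with hS | hS
  · rw [← hS, Real.zero_rpow (by positivity), mul_zero, mul_zero]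
    exact Finset.sum_nonneg fun s _ => by positivity
  have hsplit : S = S ^ ((2 - q) / 2) * S ^ (q / 2) := by
    rw [← Real.rpow_add hS, ← add_div, sub_add_cancel, div_self two_ne_zero, Real.rpow_one]
  have hmoment := hmoment hS
  rw [Real.mul_rpow hB.le hS0] at hmoment
  nth_rewrite 1 [hsplit] at hmoment
  have hcancel : 2 ^ N * (S ^ (q / 2) / 2) ≤ B ^ ((2 - q) / 2) * X :=
    le_of_mul_le_mul_left (by linarith) (by positivity : 0 < S ^ ((2 - q) / 2))
  rw [show 2 ^ N * ((2 * B ^ ((2 - q) / 2))⁻¹ * S ^ (q / 2)) =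
    2 ^ N * (S ^ (q / 2) / 2) / B ^ ((2 - q) / 2) by field_simp]
  exact (div_le_iff₀' (by positivity)).2 hcancel

theorem exists_lintegral_squareFunction_le {q : ℝ} (hq : 0 < q) :
    ∃ c : ℝ, 0 < c ∧ ∀ {α : Type*} [MeasurableSpace α] (μ : Measure α) (N : ℕ) (F : ℕ → α → ℂ)
      (B : ℝ≥0∞), (∀ k, Measurable (F k)) →
      (∀ s, ∫⁻ x, ‖signedSum N (fun k => F k x) s‖ₑ ^ q ∂μ ≤ B) →
      ENNReal.ofReal c * ∫⁻ x, ENNReal.ofReal ((∑ k ∈ Finset.range N, ‖F k x‖ ^ 2) ^ (q / 2)) ∂μ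
        ≤ B := by
  obtain ⟨c, hc, hK⟩ := exists_khintchine_lower hq
  refine ⟨c, hc, fun {α} _ μ N F B hF hB => ?_⟩
  have hm : ∀ s, Measurable fun x => signedSum N (fun k => F k x) s := fun s => by
    unfold signedSum
    exact Finset.measurable_fun_sum _ fun k _ => (hF k).const_mul _
  have h2 : (2 : ℝ≥0∞) ^ N ≠ 0 := by simp
  have h2' : (2 : ℝ≥0∞) ^ N ≠ ∞ := by simp
  rw [← ENNReal.mul_le_mul_iff_right h2 h2']
  calc (2 : ℝ≥0∞) ^ N * (ENNReal.ofReal c *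
        ∫⁻ x, ENNReal.ofReal ((∑ k ∈ Finset.range N, ‖F k x‖ ^ 2) ^ (q / 2)) ∂μ)
      = ∫⁻ x, ENNReal.ofReal
          (2 ^ N * (c * (∑ k ∈ Finset.range N, ‖F k x‖ ^ 2) ^ (q / 2))) ∂μ := by
        rw [← lintegral_const_mul' _ _ ENNReal.ofReal_ne_top, ← lintegral_const_mul' _ _ h2']
        refine lintegral_congr fun x => ?_
        rw [ENNReal.ofReal_mul (by positivity), ENNReal.ofReal_mul hc.le,
          ENNReal.ofReal_pow (by norm_num)]
        simp
    _ ≤ ∫⁻ x, ∑ s ∈ (Finset.range N).powerset, ‖signedSum N (fun k => F k x) s‖ₑ ^ q ∂μ := by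
        refine lintegral_mono fun x => ?_
        refine (ENNReal.ofReal_le_ofReal (hK N fun k => F k x)).trans_eq ?_
        rw [ENNReal.ofReal_sum_of_nonneg fun s _ => by positivity]
        refine Finset.sum_congr rfl fun s _ => ?_
        rw [enorm_rpow_eq_ofReal _ hq.le]
    _ = ∑ s ∈ (Finset.range N).powerset, ∫⁻ x, ‖signedSum N (fun k => F k x) s‖ₑ ^ q ∂μ :=
        lintegral_finsetSum _ fun s _ => (hm s).enorm.pow_const q
    _ ≤ ∑ _s ∈ (Finset.range N).powerset, B := Finset.sum_le_sum fun s _ => hB s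
    _ = 2 ^ N * B := by simp

end Khintchine

section Phase

variable {E : Type*} [NormedAddCommGroup E] [InnerProductSpace ℝ E] [MeasurableSpace E]
  {ν : Measure E}

theorem half_le_re_exp_two_pi_I_mul {y : ℝ} (hy : |y| ≤ 1 / 6) :
    1 / 2 ≤ (Complex.exp (2 * Real.pi * Complex.I * y)).re := by
  rw [show (2 * Real.pi * Complex.I * y : ℂ) = ((2 * Real.pi * y : ℝ) : ℂ) * Complex.I by
    push_cast; ring, Complex.exp_ofReal_mul_I_re, ← Real.cos_pi_div_three, ← Real.cos_abs (_ * y)]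
  refine Real.cos_le_cos_of_nonneg_of_le_pi (abs_nonneg _) (by linarith [Real.pi_pos]) ?_
  rw [abs_mul, abs_of_pos (by positivity : 0 < 2 * Real.pi)]
  nlinarith [Real.pi_pos]

theorem norm_integral_mul_exp_inner_sub (f : E → ℂ) (ξ₀ x : E) :
    ‖∫ ξ, f ξ * Complex.exp (2 * Real.pi * Complex.I * (inner ℝ (ξ - ξ₀) x : ℝ)) ∂ν‖ =
      ‖∫ ξ, f ξ * Complex.exp (2 * Real.pi * Complex.I * (inner ℝ ξ x : ℝ)) ∂ν‖ := by
  have modulation : ∀ ξ,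
      f ξ * Complex.exp (2 * Real.pi * Complex.I * (inner ℝ (ξ - ξ₀) x : ℝ)) =
        Complex.exp (2 * Real.pi * Complex.I * (-inner ℝ ξ₀ x : ℝ)) *
          (f ξ * Complex.exp (2 * Real.pi * Complex.I * (inner ℝ ξ x : ℝ))) := fun ξ => by
    rw [mul_left_comm, ← Complex.exp_add, inner_sub_left]
    congr 2
    push_cast
    ring
  simp_rw [modulation]
  rw [integral_const_mul, norm_mul, norm_exp_two_pi_I_mul, one_mul]

theorem half_integral_le_norm_integral_mul_exp [BorelSpace E] [SecondCountableTopology E]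
    {φ : E → ℝ} (hφ : Integrable φ ν) (h0 : ∀ ξ, 0 ≤ φ ξ) (ξ₀ x : E)
    (h : ∀ᵐ ξ ∂ν, φ ξ ≠ 0 → |inner ℝ (ξ - ξ₀) x| ≤ 1 / 6) :
    (∫ ξ, φ ξ ∂ν) / 2 ≤
      ‖∫ ξ, (φ ξ : ℂ) * Complex.exp (2 * Real.pi * Complex.I * (inner ℝ ξ x : ℝ)) ∂ν‖ := by
  have hint : Integrable (fun ξ => (φ ξ : ℂ) *
      Complex.exp (2 * Real.pi * Complex.I * (inner ℝ (ξ - ξ₀) x : ℝ))) ν :=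
    hφ.ofReal.mul_bdd (c := 1) (Continuous.aestronglyMeasurable (by fun_prop))
      (ae_of_all _ fun _ => (norm_exp_two_pi_I_mul _).le)
  rw [← norm_integral_mul_exp_inner_sub _ ξ₀, ← integral_div]
  refine le_trans ?_ (Complex.re_le_norm _)
  rw [← RCLike.re_eq_complex_re, ← integral_re hint]
  refine integral_mono_ae (hφ.div_const 2) hint.re ?_
  filter_upwards [h] with ξ hξ
  rw [RCLike.re_eq_complex_re, Complex.re_ofReal_mul]
  rcases eq_or_ne (φ ξ) 0 with hzero | hne
  · simp [hzero]
  · nlinarith [half_le_re_exp_two_pi_I_mul (hξ hne), h0 ξ]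

end Phase

namespace CompactC2Curve

variable {Γ : CompactC2Curve}

theorem ae_arcLength {P : Plane → Prop} (hP : MeasurableSet {ξ | P ξ})
    (h : ∀ s ∈ Icc Γ.a Γ.b, P (Γ.γ s)) : ∀ᵐ ξ ∂Γ.arcLength, P ξ := by
  rw [arcLength_eq_map, ae_map_iff Γ.continuous_γ.measurable.aemeasurable hP]
  exact Γ.ae_paramMeasure_mem.mono h

theorem integrable_arcLength {E : Type*} [NormedAddCommGroup E] {f : Plane → E}
    (hf : Continuous f) : Integrable f Γ.arcLength := by
  rw [arcLength_eq_map, integrable_map_measure hf.aestronglyMeasurable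
    Γ.continuous_γ.measurable.aemeasurable]
  exact integrable_comp hf

theorem extension_signedSum {f : ℕ → Plane → ℂ} (hf : ∀ k, Continuous (f k)) (N : ℕ)
    (s : Finset ℕ) (x : Plane) :
    Γ.extension (fun ξ => signedSum N (fun k => f k ξ) s) x =
      signedSum N (fun k => Γ.extension (f k) x) s := by
  simp only [extension, signedSum, Finset.sum_mul, mul_assoc, ← integral_const_mul]
  exact integral_finsetSum _ fun k _ => integrable_arcLength (by have := hf k; fun_prop)

theorem half_integral_le_norm_extension {φ : Plane → ℝ} (hφ : Continuous φ) (h0 : ∀ ξ, 0 ≤ φ ξ)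
    (ξ₀ x : Plane)
    (h : ∀ s ∈ Icc Γ.a Γ.b, φ (Γ.γ s) ≠ 0 → |inner ℝ (Γ.γ s - ξ₀) x| ≤ 1 / 6) :
    (∫ ξ, φ ξ ∂Γ.arcLength) / 2 ≤ ‖Γ.extension (fun ξ => φ ξ) x‖ := by
  refine half_integral_le_norm_integral_mul_exp (integrable_arcLength hφ) h0 ξ₀ x
    (ae_arcLength ?_ h)
  have : Measurable fun ξ => |inner ℝ (ξ - ξ₀) x| := Continuous.measurable (by fun_prop)
  exact (measurableSet_eq_fun hφ.measurable measurable_const).compl.imp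
    (measurableSet_le this measurable_const)

end CompactC2Curve

section Compactness

theorem isBigO_principal_of_isCompact {X E F : Type*} [TopologicalSpace X] [NormedAddCommGroup E]
    [NormedAddCommGroup F] {K : Set X} {f : X → E} {g : X → F} (hK : IsCompact K)
    (h : ∀ τ ∈ K, f =O[𝓝 τ] g) : f =O[𝓟 K] g := by
  refine hK.induction_on (p := fun T => f =O[𝓟 T] g) (by simp)
    (fun S T hST hT => hT.mono (principal_mono.2 hST)) (fun S T hS hT => ?_) fun τ hτ => ?_
  · rw [← sup_principal]; exact hS.sup hT
  · obtain ⟨C, hC⟩ := (h τ hτ).bound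
    exact ⟨_, mem_nhdsWithin_of_mem_nhds hC, .of_bound C (mem_principal.2 subset_rfl)⟩

theorem isBigO_nhds_of_continuousAt_of_ne_zero {X E F : Type*} [TopologicalSpace X]
    [NormedAddCommGroup E] [NormedAddCommGroup F] {f : X → E} {g : X → F} {τ : X}
    (hf : ContinuousAt f τ) (hg : ContinuousAt g τ) (h : g τ ≠ 0) : f =O[𝓝 τ] g :=
  (hf.tendsto.isBigO_one ℝ).trans <| (Asymptotics.isBigO_const_left_iff_pos_le_norm one_ne_zero).2
    ⟨‖g τ‖ / 2, half_pos (norm_pos_iff.2 h),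
      (hg.norm.eventually (lt_mem_nhds (half_lt_self (norm_pos_iff.2 h)))).mono fun _ => le_of_lt⟩

variable {E : Type*} [NormedAddCommGroup E] [NormedSpace ℝ E] {f f' : ℝ → E} {y : E}

theorem exists_volume_nhds_inter_preimage_closedBall_le {τ : ℝ} (hf : HasDerivAt f (f' τ) τ)
    (h : f τ = y → f' τ ≠ 0) :
    ∃ U ∈ 𝓝 τ, ∃ C : ℝ, 0 < C ∧ ∀ ρ, 0 < ρ →
      volume (U ∩ f ⁻¹' Metric.closedBall y ρ) ≤ ENNReal.ofReal (C * ρ) := by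
  rcases eq_or_ne (f τ) y with rfl | hne
  · have hc : 0 < ‖f' τ‖ / 2 := half_pos (norm_pos_iff.2 (h rfl))
    refine ⟨_, eventually_mul_norm_sub_le_norm_sub hf (h rfl), 2 / (‖f' τ‖ / 2), by positivity,
      fun ρ _ => ?_⟩
    refine (measure_mono (t := Metric.closedBall τ (ρ / (‖f' τ‖ / 2))) ?_).trans_eq ?_
    · rintro s ⟨hs, hsρ⟩
      rw [Metric.mem_closedBall, dist_eq_norm, le_div_iff₀' hc]
      exact hs.trans (mem_closedBall_iff_norm.1 hsρ)
    · rw [Real.volume_closedBall]; congr 1; ring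
  · have he : 0 < dist (f τ) y / 2 := half_pos (dist_pos.2 hne)
    have hfar : ∀ᶠ s in 𝓝 τ, dist (f τ) y / 2 < dist (f s) y :=
      (hf.continuousAt.dist continuousAt_const).eventually
        (lt_mem_nhds (half_lt_self (dist_pos.2 hne)))
    refine ⟨_, hfar.and (Metric.ball_mem_nhds τ one_pos), 2 / (dist (f τ) y / 2), by positivity,
      fun ρ _ => ?_⟩
    rcases le_or_gt ρ (dist (f τ) y / 2) with hρe | hρe
    · refine (measure_mono (t := ∅) fun s hs => ?_).trans (by simp)
      exact (hs.1.1.trans_le (Metric.mem_closedBall.1 hs.2)).not_ge hρe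
    · refine (measure_mono (t := Metric.ball τ 1) fun s hs => hs.1.2).trans ?_
      rw [Real.volume_ball]
      refine ENNReal.ofReal_le_ofReal ?_
      rw [div_mul_eq_mul_div, le_div_iff₀ he]
      linarith

theorem exists_volume_inter_preimage_closedBall_le {K : Set ℝ} (hK : IsCompact K)
    (hf : ∀ τ, HasDerivAt f (f' τ) τ) (h : ∀ τ ∈ K, f τ = y → f' τ ≠ 0) :
    ∃ C : ℝ, 0 < C ∧ ∀ ρ, 0 < ρ →
      volume (K ∩ f ⁻¹' Metric.closedBall y ρ) ≤ ENNReal.ofReal (C * ρ) := by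
  refine hK.induction_on (p := fun T => ∃ C : ℝ, 0 < C ∧ ∀ ρ, 0 < ρ →
    volume (T ∩ f ⁻¹' Metric.closedBall y ρ) ≤ ENNReal.ofReal (C * ρ)) ?_ ?_ ?_ ?_
  · exact ⟨1, one_pos, fun ρ _ => by simp⟩
  · rintro S T hST ⟨C, hC, hT⟩
    exact ⟨C, hC, fun ρ hρ => (measure_mono (inter_subset_inter_left _ hST)).trans (hT ρ hρ)⟩
  · rintro S T ⟨C, hC, hS⟩ ⟨C', hC', hT⟩
    refine ⟨C + C', by positivity, fun ρ hρ => ?_⟩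
    rw [union_inter_distrib_right, add_mul, ENNReal.ofReal_add (by positivity) (by positivity)]
    exact (measure_union_le _ _).trans (add_le_add (hS ρ hρ) (hT ρ hρ))
  · intro τ hτ
    obtain ⟨U, hU, hC⟩ := exists_volume_nhds_inter_preimage_closedBall_le (hf τ) (h τ hτ)
    exact ⟨U, mem_nhdsWithin_of_mem_nhds hU, hC⟩

theorem exists_mul_abs_sub_le_of_deriv_ne_zero {H H' : ℝ → ℝ} {a b : ℝ} (hab : a ≤ b)
    (hH : ∀ s, HasDerivAt H (H' s) s) (hH' : Continuous H') (h : ∀ s ∈ Icc a b, H' s ≠ 0) :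
    ∃ d, 0 < d ∧ ∀ x ∈ Icc a b, ∀ y ∈ Icc a b, d * |y - x| ≤ |H y - H x| := by
  obtain ⟨σ, hσ, hmin⟩ := isCompact_Icc.exists_isMinOn (nonempty_Icc.2 hab)
    (hH'.abs.continuousOn (s := Icc a b))
  have lt_case : ∀ x ∈ Icc a b, ∀ y ∈ Icc a b, x < y → |H' σ| * |y - x| ≤ |H y - H x| := by
    intro x hx y hy hxy
    obtain ⟨z, hz, hslope⟩ := exists_hasDerivAt_eq_slope H H' hxy
      (fun s _ => (hH s).continuousAt.continuousWithinAt) fun s _ => hH s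
    have hle : |H' σ| ≤ |H' z| := hmin ⟨hx.1.trans hz.1.le, hz.2.le.trans hy.2⟩
    rwa [hslope, abs_div, le_div_iff₀ (abs_pos.2 (sub_pos.2 hxy).ne')] at hle
  refine ⟨|H' σ|, abs_pos.2 (h σ hσ), fun x hx y hy => ?_⟩
  rcases lt_trichotomy x y with hxy | rfl | hxy
  · exact lt_case x hx y hy hxy
  · simp
  · rw [abs_sub_comm y, abs_sub_comm (H y)]
    exact lt_case y hy x hx hxy

theorem exists_Icc_subset_inter_closedBall {a b s δ : ℝ} (hs : s ∈ Icc a b) (hδ : 0 ≤ δ)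
    (hδ' : δ ≤ (b - a) / 2) : ∃ u, Icc u (u + δ) ⊆ Icc a b ∩ Metric.closedBall s δ := by
  rw [Real.closedBall_eq_Icc, Icc_inter_Icc]
  rcases le_total s ((a + b) / 2) with h | h
  · exact ⟨s, Icc_subset_Icc (max_le hs.1 (by linarith)) (le_min (by linarith) le_rfl)⟩
  · exact ⟨s - δ, Icc_subset_Icc (max_le (by linarith) le_rfl)
      (le_min (by linarith [hs.2]) (by linarith))⟩

end Compactness

theorem abs_inner_rot_le {ω : Plane} (hω : ‖ω‖ = 1) (v : Plane) : |inner ℝ (rot v) ω| ≤ ‖v‖ := by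
  simpa [norm_rot, hω] using abs_real_inner_le_norm (rot v) ω

theorem rot_sub (v w : Plane) : rot (v - w) = rot v - rot w := by
  ext i; fin_cases i <;> simp [rot]; ring

namespace CompactC2Curve

variable {Γ : CompactC2Curve} {ω : Plane}

theorem exists_mem_Ico_of_periodic (hper : Function.Periodic Γ.γ (Γ.b - Γ.a)) {x : ℝ}
    (hx : x ∈ Icc Γ.a Γ.b) :
    ∃ y ∈ Ico Γ.a Γ.b, Γ.γ y = Γ.γ x ∧ deriv Γ.γ y = deriv Γ.γ x := by
  rcases hx.2.lt_or_eq with hlt | rfl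
  · exact ⟨x, ⟨hx.1, hlt⟩, rfl, rfl⟩
  have hderiv : deriv Γ.γ (Γ.a + (Γ.b - Γ.a)) = deriv Γ.γ Γ.a := by
    rw [← deriv_comp_add_const]
    exact congrArg (deriv · Γ.a) (funext hper)
  have heq := hper Γ.a
  rw [add_sub_cancel] at hderiv heq
  exact ⟨Γ.a, left_mem_Ico.2 Γ.lt, heq.symm, hderiv.symm⟩

theorem deriv_eq_of_apply_eq {s τ : ℝ} (hs : s ∈ Icc Γ.a Γ.b) (hτ : τ ∈ Icc Γ.a Γ.b)
    (h : Γ.γ s = Γ.γ τ) : deriv Γ.γ s = deriv Γ.γ τ := by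
  rcases Γ.simple with hinj | ⟨hper, hinj⟩
  · rw [hinj hs hτ h]
  · obtain ⟨s', hs', hγs, hds⟩ := exists_mem_Ico_of_periodic hper hs
    obtain ⟨τ', hτ', hγτ, hdτ⟩ := exists_mem_Ico_of_periodic hper hτ
    rw [← hds, ← hdτ, hinj hs' hτ' (by rw [hγs, hγτ, h])]

theorem isBigO_inner_rot_sub_sq {s₀ : ℝ} (hs₀ : s₀ ∈ Icc Γ.a Γ.b)
    (h0 : inner ℝ (rot (deriv Γ.γ s₀)) ω = 0) :
    (fun s => inner ℝ (rot (Γ.γ s - Γ.γ s₀)) ω) =O[𝓟 (Icc Γ.a Γ.b)]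
      fun s => ‖Γ.γ s - Γ.γ s₀‖ ^ 2 := by
  simp only [rot_sub, inner_sub_left]
  refine isBigO_principal_of_isCompact isCompact_Icc fun τ hτ => ?_
  rcases eq_or_ne (Γ.γ τ) (Γ.γ s₀) with heq | hne
  · rw [← deriv_eq_of_apply_eq hτ hs₀ heq] at h0
    obtain ⟨K, -, hK⟩ := eventually_norm_sub_le_of_deriv_eq_zero (Γ.hasDerivAt_inner_rot ω)
      (Γ.hasDerivAt_inner_rot_deriv ω τ) h0
    have quadratic : (fun s => inner ℝ (rot (Γ.γ s)) ω - inner ℝ (rot (Γ.γ τ)) ω) =O[𝓝 τ]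
        fun s => ‖s - τ‖ ^ 2 := .of_bound K (by simpa using hK)
    rw [← heq]
    have hc : 0 < ‖deriv Γ.γ τ‖ / 2 := half_pos (norm_pos_iff.2 (Γ.regular τ hτ))
    have linear : (fun s => s - τ) =O[𝓝 τ] fun s => Γ.γ s - Γ.γ τ :=
      .of_bound (‖deriv Γ.γ τ‖ / 2)⁻¹ <|
        (eventually_mul_norm_sub_le_norm_sub (Γ.hasDerivAt_γ τ) (Γ.regular τ hτ)).mono fun s hs =>
          (le_inv_mul_iff₀ hc).2 hs
    exact quadratic.trans (linear.norm_norm.pow 2)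
  · refine isBigO_nhds_of_continuousAt_of_ne_zero
      ((Γ.hasDerivAt_inner_rot ω τ).continuousAt.sub continuousAt_const)
      (Continuous.continuousAt (by fun_prop)) ?_
    exact pow_ne_zero 2 (norm_ne_zero_iff.2 (sub_ne_zero.2 hne))

/-- The curve stays within `K * ‖ξ - γ s₀‖ ^ m` of the line through `γ s₀` parallel to `ω`: every
curve satisfies this with `m = 1`, and with `m = 2` at the points where `ω` is tangent. -/
def ContactBound (Γ : CompactC2Curve) (ω : Plane) (s₀ : ℝ) (m : ℕ) (K : ℝ) : Prop :=
  ∀ s ∈ Icc Γ.a Γ.b, |inner ℝ (rot (Γ.γ s - Γ.γ s₀)) ω| ≤ K * ‖Γ.γ s - Γ.γ s₀‖ ^ m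

theorem contactBound_one (Γ : CompactC2Curve) (hω : ‖ω‖ = 1) (s₀ : ℝ) :
    Γ.ContactBound ω s₀ 1 1 := fun s _ => by
  rw [one_mul, pow_one]
  exact abs_inner_rot_le hω _

theorem exists_contactBound_two {s₀ : ℝ} (hs₀ : s₀ ∈ Icc Γ.a Γ.b)
    (h0 : inner ℝ (Γ.normal s₀) ω = 0) : ∃ K, 0 < K ∧ Γ.ContactBound ω s₀ 2 K := by
  obtain ⟨K, hK, h⟩ :=
    (isBigO_inner_rot_sub_sq hs₀ ((inner_normal_eq_zero_iff hs₀).1 h0)).exists_pos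
  exact ⟨K, hK, fun s hs => by simpa using Asymptotics.isBigOWith_principal.1 h s hs⟩

theorem exists_mul_abs_sub_le_norm_sub (hω : ‖ω‖ = 1) (ht : Γ.Transversal ω) :
    ∃ d, 0 < d ∧ ∀ x ∈ Icc Γ.a Γ.b, ∀ y ∈ Icc Γ.a Γ.b, d * |y - x| ≤ ‖Γ.γ y - Γ.γ x‖ := by
  obtain ⟨d, hd, h⟩ := exists_mul_abs_sub_le_of_deriv_ne_zero Γ.lt.le (Γ.hasDerivAt_inner_rot ω)
    (continuous_inner_rot_deriv Γ ω) fun s hs => (inner_normal_eq_zero_iff hs).not.1 (ht s hs)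
  refine ⟨d, hd, fun x hx y hy => (h x hx y hy).trans ?_⟩
  rw [← inner_sub_left, ← rot_sub]
  exact abs_inner_rot_le hω _

theorem arcLength_closedBall (Γ : CompactC2Curve) (ξ : Plane) (ρ : ℝ) :
    Γ.arcLength (Metric.closedBall ξ ρ) = Γ.paramMeasure (Γ.γ ⁻¹' Metric.closedBall ξ ρ) := by
  rw [arcLength_eq_map, Measure.map_apply Γ.continuous_γ.measurable measurableSet_closedBall]

theorem exists_arcLength_closedBall_le (Γ : CompactC2Curve) (ξ : Plane) :
    ∃ C : ℝ, 0 < C ∧ ∀ ρ, 0 < ρ →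
      Γ.arcLength (Metric.closedBall ξ ρ) ≤ ENNReal.ofReal (C * ρ) := by
  obtain ⟨C, hC, h⟩ := exists_volume_inter_preimage_closedBall_le (y := ξ) isCompact_Icc
    Γ.hasDerivAt_γ fun τ hτ _ => Γ.regular τ hτ
  obtain ⟨L, hL⟩ := Γ.exists_paramMeasure_le
  refine ⟨(L + 1) * C, by positivity, fun ρ hρ => ?_⟩
  rw [arcLength_closedBall, mul_assoc, ENNReal.ofReal_mul (by positivity)]
  refine (hL _).trans ?_
  rw [Measure.smul_apply, Measure.restrict_apply
    (Γ.continuous_γ.measurable measurableSet_closedBall), inter_comm, ENNReal.smul_def, smul_eq_mul,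
    ← ENNReal.ofReal_coe_nnreal]
  gcongr
  · linarith
  · exact h ρ hρ

theorem ofReal_mul_volume_le_paramMeasure {c : ℝ}
    (hc : ∀ s ∈ Icc Γ.a Γ.b, c ≤ ‖deriv Γ.γ s‖) {T : Set ℝ} (hT : MeasurableSet T)
    (hsub : T ⊆ Icc Γ.a Γ.b) : ENNReal.ofReal c * volume T ≤ Γ.paramMeasure T := by
  rw [paramMeasure, withDensity_apply _ hT, Measure.restrict_restrict hT, inter_eq_left.2 hsub,
    ← setLIntegral_const]
  refine setLIntegral_mono' hT fun s hs => ?_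
  rw [← ofReal_norm]
  exact ENNReal.ofReal_le_ofReal (hc s (hsub hs))

theorem exists_le_arcLength_closedBall (Γ : CompactC2Curve) :
    ∃ c r₀ : ℝ, 0 < c ∧ 0 < r₀ ∧ ∀ s ∈ Icc Γ.a Γ.b, ∀ ρ, 0 < ρ → ρ ≤ r₀ →
      ENNReal.ofReal (c * ρ) ≤ Γ.arcLength (Metric.closedBall (Γ.γ s) ρ) := by
  obtain ⟨L, hL0, hL⟩ := Γ.exists_norm_deriv_le
  obtain ⟨c, hc0, hc⟩ := Γ.exists_le_norm_deriv
  have hL0' : (0 : ℝ) < L := hL0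
  have hab := sub_pos.2 Γ.lt
  refine ⟨c / L, L * ((Γ.b - Γ.a) / 2), by positivity, by positivity, fun s hs ρ hρ hρ0 => ?_⟩
  obtain ⟨u, hu⟩ := exists_Icc_subset_inter_closedBall hs (by positivity : 0 ≤ ρ / L)
    ((div_le_iff₀' hL0').2 hρ0)
  have hball : Icc u (u + ρ / L) ⊆ Γ.γ ⁻¹' Metric.closedBall (Γ.γ s) ρ := fun x hx => by
    have hlip := (convex_Icc Γ.a Γ.b).norm_image_sub_le_of_norm_hasDerivWithin_le
      (fun y _ => (Γ.hasDerivAt_γ y).hasDerivWithinAt) hL hs (hu hx).1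
    have hx := mem_closedBall_iff_norm.1 (hu hx).2
    rw [le_div_iff₀' hL0'] at hx
    exact mem_closedBall_iff_norm.2 (hlip.trans hx)
  rw [arcLength_closedBall]
  refine le_trans ?_ ((ofReal_mul_volume_le_paramMeasure hc measurableSet_Icc
    (hu.trans inter_subset_left)).trans (measure_mono hball))
  rw [Real.volume_Icc, add_sub_cancel_left, ← ENNReal.ofReal_mul hc0.le, div_mul_eq_mul_div,
    mul_div_assoc]

end CompactC2Curve

section Cutoff

variable {E : Type*} [NormedAddCommGroup E] [NormedSpace ℝ E] {φ ψ : E → ℝ}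

/-- Smooth compactly supported functions with values in `[0, 1]`, the building blocks of the test
functions for the estimates. -/
structure IsCutoff (φ : E → ℝ) : Prop where
  contDiff : ContDiff ℝ ((⊤ : ℕ∞) : WithTop ℕ∞) φ
  hasCompactSupport : HasCompactSupport φ
  nonneg : ∀ ξ, 0 ≤ φ ξ
  le_one : ∀ ξ, φ ξ ≤ 1

namespace IsCutoff

theorem mul_one_sub (hφ : IsCutoff φ) (hψ : IsCutoff ψ) : IsCutoff fun ξ => φ ξ * (1 - ψ ξ) where
  contDiff := hφ.contDiff.mul (contDiff_const.sub hψ.contDiff)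
  hasCompactSupport := hφ.hasCompactSupport.mul_right
  nonneg ξ := mul_nonneg (hφ.nonneg ξ) (sub_nonneg.2 (hψ.le_one ξ))
  le_one ξ := mul_le_one₀ (hφ.le_one ξ) (sub_nonneg.2 (hψ.le_one ξ)) (sub_le_self 1 (hψ.nonneg ξ))

/-- A cutoff as a complex valued Schwartz function. -/
noncomputable def toSchwartzMap (hφ : IsCutoff φ) : SchwartzMap E ℂ :=
  HasCompactSupport.toSchwartzMap (f := fun ξ => (φ ξ : ℂ))
    (hφ.hasCompactSupport.comp_left Complex.ofReal_zero)
    (Complex.ofRealCLM.contDiff.comp hφ.contDiff)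

@[simp]
theorem toSchwartzMap_apply (hφ : IsCutoff φ) (ξ : E) : hφ.toSchwartzMap ξ = φ ξ := rfl

theorem norm_toSchwartzMap_le_one (hφ : IsCutoff φ) (ξ : E) : ‖hφ.toSchwartzMap ξ‖ ≤ 1 := by
  rw [toSchwartzMap_apply, Complex.norm_real, Real.norm_of_nonneg (hφ.nonneg ξ)]
  exact hφ.le_one ξ

theorem support_toSchwartzMap (hφ : IsCutoff φ) :
    Function.support hφ.toSchwartzMap = Function.support φ := by
  ext ξ; simp

theorem measureReal_le_integral [MeasurableSpace E] [OpensMeasurableSpace E] {ν : Measure E}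
    [IsFiniteMeasureOnCompacts ν] (hφ : IsCutoff φ) {A : Set E} (hA : MeasurableSet A)
    (h1 : EqOn φ 1 A) : ν.real A ≤ ∫ ξ, φ ξ ∂ν :=
  calc ν.real A = ∫ ξ in A, φ ξ ∂ν := by rw [setIntegral_congr_fun hA h1]; simp
    _ ≤ ∫ ξ, φ ξ ∂ν := setIntegral_le_integral
      (hφ.contDiff.continuous.integrable_of_hasCompactSupport hφ.hasCompactSupport)
      (ae_of_all _ hφ.nonneg)

end IsCutoff

variable [HasContDiffBump E] [FiniteDimensional ℝ E]

theorem exists_isCutoff_ball (ξ₀ : E) {ρ r : ℝ} (hρ : 0 < ρ) (hr : ρ < r) :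
    ∃ φ : E → ℝ, IsCutoff φ ∧ Function.support φ ⊆ Metric.ball ξ₀ r ∧
      EqOn φ 1 (Metric.closedBall ξ₀ ρ) :=
  let φ : ContDiffBump ξ₀ := ⟨ρ, r, hρ, hr⟩
  ⟨φ, ⟨φ.contDiff, φ.hasCompactSupport, fun _ => φ.nonneg, fun _ => φ.le_one⟩,
    φ.support_eq.le, fun _ => φ.one_of_mem_closedBall⟩

theorem exists_isCutoff_annulus (ξ₀ : E) {ρ₁ ρ₂ r₁ r₂ : ℝ} (hρ₁ : 0 < ρ₁) (hρ : ρ₁ < ρ₂)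
    (hr₁ : 0 < r₁) (hr : r₁ < r₂) :
    ∃ φ : E → ℝ, IsCutoff φ ∧
      Function.support φ ⊆ Metric.ball ξ₀ r₂ \ Metric.closedBall ξ₀ ρ₁ ∧
      EqOn φ 1 (Metric.closedBall ξ₀ r₁ \ Metric.ball ξ₀ ρ₂) := by
  obtain ⟨φ, hφ, hφr, hφ1⟩ := exists_isCutoff_ball ξ₀ hr₁ hr
  obtain ⟨ψ, hψ, hψρ, hψ1⟩ := exists_isCutoff_ball ξ₀ hρ₁ hρ
  refine ⟨_, hφ.mul_one_sub hψ, fun ξ hξ => ⟨hφr (left_ne_zero_of_mul hξ), fun hmem => ?_⟩,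
    fun ξ hξ => ?_⟩
  · exact right_ne_zero_of_mul hξ (by simp [hψ1 hmem])
  · have hψ0 : ψ ξ = 0 := Function.notMem_support.1 fun h => hξ.2 (hψρ h)
    simp [hφ1 hξ.1, hψ0]

end Cutoff

theorem eLpNorm_le_measure_rpow {α E : Type*} [MeasurableSpace α] [NormedAddCommGroup E]
    {μ : Measure α} {f : α → E} {A : Set α} (hA : Function.support f ⊆ A) (hf : ∀ x, ‖f x‖ ≤ 1)
    (p : ℝ≥0∞) : eLpNorm f p μ ≤ μ A ^ p⁻¹.toReal :=
  calc eLpNorm f p μ ≤ eLpNorm (A.indicator fun _ => (1 : ℝ)) p μ := by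
        refine eLpNorm_mono_real fun x => ?_
        by_cases hx : x ∈ A
        · rw [indicator_of_mem hx]; exact hf x
        · rw [Function.notMem_support.1 (notMem_subset hA hx), norm_zero, indicator_of_notMem hx]
    _ ≤ ‖(1 : ℝ)‖ₑ * μ A ^ (1 / p.toReal) := eLpNorm_indicator_const_le _ _
    _ = μ A ^ p⁻¹.toReal := by simp [ENNReal.toReal_inv]

section Plane

variable {ω : Plane}

theorem abs_inner_smul_add_smul_rot_le (hω : ‖ω‖ = 1) (ξ : Plane) (t s : ℝ) :
    |inner ℝ ξ (t • ω + s • rot ω)| ≤ |t| * ‖ξ‖ + |s| * |inner ℝ (rot ξ) ω| := by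
  have hξ : |inner ℝ ξ ω| ≤ ‖ξ‖ := by simpa [hω] using abs_real_inner_le_norm ξ ω
  rw [inner_add_right, real_inner_smul_right, real_inner_smul_right, inner_rot_left, abs_neg,
    ← abs_mul s]
  refine (abs_add_le _ _).trans ?_
  rw [abs_mul]
  gcongr

theorem mul_volume_rpow_le_eLpNorm_strip (hω : ‖ω‖ = 1) (t : ℝ) {E : Type*}
    [NormedAddCommGroup E] [MeasurableSpace E] [OpensMeasurableSpace E] {F : Plane → E}
    (hF : Measurable F) {q : ℝ≥0∞} (hq : q ≠ 0) {J : Set ℝ} (hJ : volume J ≠ 0) {v : ℝ≥0}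
    (h : ∀ t' ∈ Icc (t - 1 / 2) (t + 1 / 2), ∀ s ∈ J, v ≤ ‖F (t' • ω + s • rot ω)‖₊) :
    v * volume J ^ q⁻¹.toReal ≤ eLpNorm F q (volume.restrict (strip ω t)) := by
  set A := {x | v ≤ ‖F x‖₊}
  have hAm : MeasurableSet A := measurableSet_le measurable_const hF.nnnorm
  have hJA : volume J ≤ volume.restrict (strip ω t) A := by
    rw [volume_strip_inter_eq_lintegral hω t hAm]
    calc volume J = ∫⁻ _ in Icc (t - 1 / 2) (t + 1 / 2), volume J := by
          rw [setLIntegral_const, Real.volume_Icc, show t + 1 / 2 - (t - 1 / 2) = 1 by ring]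
          simp
      _ ≤ _ := setLIntegral_mono' measurableSet_Icc fun t' ht' => by
          rw [lineMeasure, Measure.map_apply (by fun_prop) hAm]
          exact measure_mono (h t' ht')
  calc v * volume J ^ q⁻¹.toReal
      ≤ v * volume.restrict (strip ω t) A ^ q⁻¹.toReal := by gcongr
    _ = eLpNorm (A.indicator fun _ => (v : ℝ)) q (volume.restrict (strip ω t)) := by
        rw [eLpNorm_indicator_const' hAm (hJ.bot_lt.trans_le hJA).ne' hq, ENNReal.toReal_inv,
          one_div]
        simp
    _ ≤ _ := eLpNorm_mono fun x => by
        rw [norm_indicator_eq_indicator_norm]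
        exact indicator_apply_le' (fun hx => by simpa using NNReal.coe_le_coe.2 hx)
          fun _ => norm_nonneg _

end Plane

theorem abs_le_add_one_of_mem_Icc_half {t t' : ℝ} (h : t' ∈ Icc (t - 1 / 2) (t + 1 / 2)) :
    |t'| ≤ |t| + 1 := by
  have := abs_sub_le_iff.2 ⟨sub_le_iff_le_add'.2 h.2, sub_le_comm.1 h.1⟩
  linarith [abs_add_le t (t' - t), congrArg abs (add_sub_cancel t t')]

namespace CompactC2Curve

variable {Γ : CompactC2Curve} {ω : Plane}

/- Knapp's example: the phase `ξ · x` is almost constant on the support of `φ`. -/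
theorem half_integral_le_norm_extension_of_contactBound (hω : ‖ω‖ = 1) {s₀ K : ℝ} {m : ℕ}
    (hK : 0 < K) (hc : Γ.ContactBound ω s₀ m K) {φ : Plane → ℝ} (hφ : Continuous φ)
    (h0 : ∀ ξ, 0 ≤ φ ξ) {r : ℝ} (hr : 0 < r)
    (hsupp : Function.support φ ⊆ Metric.ball (Γ.γ s₀) r) {t t' s : ℝ}
    (hrt : (|t| + 1) * r ≤ 1 / 12) (ht' : t' ∈ Icc (t - 1 / 2) (t + 1 / 2))
    (hs : |s| ≤ (12 * K)⁻¹ / r ^ m) :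
    (∫ ξ, φ ξ ∂Γ.arcLength) / 2 ≤ ‖Γ.extension (fun ξ => φ ξ) (t' • ω + s • rot ω)‖ := by
  refine half_integral_le_norm_extension hφ h0 (Γ.γ s₀) _ fun σ hσ hne => ?_
  have hlt : ‖Γ.γ σ - Γ.γ s₀‖ < r := mem_ball_iff_norm.1 (hsupp hne)
  have hnormal : |t'| * ‖Γ.γ σ - Γ.γ s₀‖ ≤ (|t| + 1) * r := by
    gcongr
    exact abs_le_add_one_of_mem_Icc_half ht'
  have htangential : |s| * |inner ℝ (rot (Γ.γ σ - Γ.γ s₀)) ω| ≤ 1 / 12 :=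
    calc |s| * |inner ℝ (rot (Γ.γ σ - Γ.γ s₀)) ω|
        ≤ (12 * K)⁻¹ / r ^ m * (K * r ^ m) := by
          gcongr
          refine (hc σ hσ).trans ?_
          gcongr
      _ = 1 / 12 := by field_simp
  linarith [abs_inner_smul_add_smul_rot_le hω (Γ.γ σ - Γ.γ s₀) t' s]

theorem exists_isCutoff_ball_le_integral (Γ : CompactC2Curve) :
    ∃ c r₀ : ℝ, 0 < c ∧ 0 < r₀ ∧ ∀ s₀ ∈ Icc Γ.a Γ.b, ∀ r, 0 < r → r ≤ r₀ →
      ∃ φ : Plane → ℝ, IsCutoff φ ∧ Function.support φ ⊆ Metric.ball (Γ.γ s₀) r ∧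
        c * r ≤ ∫ ξ, φ ξ ∂Γ.arcLength := by
  obtain ⟨c, r₀, hc, hr₀, hlow⟩ := Γ.exists_le_arcLength_closedBall
  refine ⟨c / 2, r₀, half_pos hc, hr₀, fun s₀ hs₀ r hr hr' => ?_⟩
  obtain ⟨φ, hφ, hsupp, h1⟩ := exists_isCutoff_ball (Γ.γ s₀) (half_pos hr) (half_lt_self hr)
  refine ⟨φ, hφ, hsupp, ?_⟩
  calc c / 2 * r = c * (r / 2) := by ring
    _ ≤ Γ.arcLength.real (Metric.closedBall (Γ.γ s₀) (r / 2)) :=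
      (ENNReal.ofReal_le_iff_le_toReal (measure_ne_top _ _)).1
        (hlow s₀ hs₀ _ (half_pos hr) (by linarith))
    _ ≤ ∫ ξ, φ ξ ∂Γ.arcLength :=
      hφ.measureReal_le_integral Metric.isClosed_closedBall.measurableSet h1

theorem exists_le_arcLength_annulus (Γ : CompactC2Curve) {s₀ : ℝ} (hs₀ : s₀ ∈ Icc Γ.a Γ.b) :
    ∃ M c r₀ : ℝ, 1 < M ∧ 0 < c ∧ 0 < r₀ ∧ ∀ r, 0 < r → r ≤ r₀ →
      c * r ≤ Γ.arcLength.real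
        (Metric.closedBall (Γ.γ s₀) (r / 2) \ Metric.ball (Γ.γ s₀) (2 * (r / M))) := by
  obtain ⟨c, r₀, hc, hr₀, hlow⟩ := Γ.exists_le_arcLength_closedBall
  obtain ⟨C, hC, hup⟩ := Γ.exists_arcLength_closedBall_le (Γ.γ s₀)
  refine ⟨8 * C / c + 2, c / 4, r₀, by linarith [show 0 < 8 * C / c by positivity],
    by positivity, hr₀, fun r hr hr' => ?_⟩
  set M := 8 * C / c + 2
  have hM : 0 < M := by positivity
  have hCM : C * (2 * (r / M)) ≤ c / 4 * r := by
    have : 8 * C ≤ c * M := by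
      rw [show c * M = 8 * C + 2 * c by simp only [M]; field_simp]
      linarith
    rw [← mul_div_assoc, ← mul_div_assoc, div_le_iff₀ hM]
    nlinarith
  have hin : c * (r / 2) ≤ Γ.arcLength.real (Metric.closedBall (Γ.γ s₀) (r / 2)) :=
    (ENNReal.ofReal_le_iff_le_toReal (measure_ne_top _ _)).1
      (hlow s₀ hs₀ _ (half_pos hr) (by linarith))
  have hout : Γ.arcLength.real (Metric.ball (Γ.γ s₀) (2 * (r / M))) ≤ C * (2 * (r / M)) :=
    ENNReal.toReal_le_of_le_ofReal (by positivity)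
      ((measure_mono Metric.ball_subset_closedBall).trans (hup _ (by positivity)))
  linarith [le_measureReal_sdiff (μ := Γ.arcLength) (s₁ := Metric.closedBall (Γ.γ s₀) (r / 2))
    (s₂ := Metric.ball (Γ.γ s₀) (2 * (r / M)))]

theorem exists_isCutoff_annulus_le_integral (Γ : CompactC2Curve) {s₀ : ℝ}
    (hs₀ : s₀ ∈ Icc Γ.a Γ.b) :
    ∃ M c r₀ : ℝ, 1 < M ∧ 0 < c ∧ 0 < r₀ ∧ ∀ r, 0 < r → r ≤ r₀ →
      ∃ φ : Plane → ℝ, IsCutoff φ ∧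
        Function.support φ ⊆ Metric.ball (Γ.γ s₀) r \ Metric.closedBall (Γ.γ s₀) (r / M) ∧
        c * r ≤ ∫ ξ, φ ξ ∂Γ.arcLength := by
  obtain ⟨M, c, r₀, hM, hc, hr₀, h⟩ := Γ.exists_le_arcLength_annulus hs₀
  refine ⟨M, c, r₀, hM, hc, hr₀, fun r hr hr' => ?_⟩
  have hrM : 0 < r / M := by positivity
  obtain ⟨φ, hφ, hsupp, h1⟩ := exists_isCutoff_annulus (Γ.γ s₀) hrM
    (by linarith : r / M < 2 * (r / M)) (half_pos hr) (half_lt_self hr)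
  exact ⟨φ, hφ, hsupp, (h r hr hr').trans (hφ.measureReal_le_integral
    (Metric.isClosed_closedBall.measurableSet.diff Metric.isOpen_ball.measurableSet) h1)⟩

end CompactC2Curve

theorem le_of_forall_small_mul_rpow_le {A B α β r₁ : ℝ} (hA : 0 < A) (hr₁ : 0 < r₁)
    (h : ∀ r, 0 < r → r ≤ r₁ → A * r ^ α ≤ B * r ^ β) : β ≤ α := by
  by_contra! hlt
  have hlim : Tendsto (fun r : ℝ => B * r ^ (β - α)) (𝓝[>] 0) (𝓝 0) := by
    have := (Real.continuousAt_rpow_const 0 (β - α) (Or.inr (sub_pos.2 hlt).le)).tendsto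
    rw [Real.zero_rpow (sub_pos.2 hlt).ne'] at this
    simpa only [mul_zero] using (this.mono_left nhdsWithin_le_nhds).const_mul B
  refine hA.not_ge (ge_of_tendsto hlim ?_)
  filter_upwards [Ioc_mem_nhdsGT hr₁] with r hr
  have := h r hr.1 hr.2
  rwa [← add_sub_cancel α β, Real.rpow_add hr.1, ← mul_assoc, mul_right_comm,
    mul_le_mul_iff_left₀ (Real.rpow_pos_of_pos hr.1 _)] at this

theorem not_forall_natCast_mul_rpow_le {A B α : ℝ} (hA : 0 < A) (hα : 0 < α) (N₀ : ℕ) :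
    ¬ ∀ N : ℕ, N₀ ≤ N → A * (N : ℝ) ^ α ≤ B := fun h => by
  have hlim : Tendsto (fun N : ℕ => A * (N : ℝ) ^ α) atTop atTop :=
    ((tendsto_rpow_atTop hα).comp tendsto_natCast_atTop_atTop).const_mul_atTop hA
  obtain ⟨N, hN, hN'⟩ := ((hlim.eventually_gt_atTop B).and (eventually_ge_atTop N₀)).exists
  exact (h N hN').not_gt hN

section Knapp

variable {Γ : CompactC2Curve} {ω : Plane} {p q : ℝ≥0∞} {t : ℝ}

theorem StripEstimateAt.exists_mul_rpow_le_mul_rpow (h : StripEstimateAt Γ ω p q t)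
    (hω : ‖ω‖ = 1) (hq : q ≠ 0) {s₀ K : ℝ} (hs₀ : s₀ ∈ Icc Γ.a Γ.b) (hK : 0 < K) {m : ℕ}
    (hc : Γ.ContactBound ω s₀ m K) :
    ∃ A B r₁ : ℝ, 0 < A ∧ 0 < r₁ ∧ ∀ r, 0 < r → r ≤ r₁ →
      A * r * (1 / r ^ m) ^ q⁻¹.toReal ≤ B * r ^ p⁻¹.toReal := by
  obtain ⟨D, hD⟩ := h
  obtain ⟨c, r₀, hc0, hr₀, hcut⟩ := Γ.exists_isCutoff_ball_le_integral
  obtain ⟨C, hC, hball⟩ := Γ.exists_arcLength_closedBall_le (Γ.γ s₀)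
  refine ⟨c / 2 * (12 * K)⁻¹ ^ q⁻¹.toReal, D * C ^ p⁻¹.toReal, min r₀ (1 / 12 / (|t| + 1)),
    by positivity, lt_min hr₀ (by positivity), fun r hr hr' => ?_⟩
  obtain ⟨φ, hφ, hsupp, hint⟩ := hcut s₀ hs₀ r hr (hr'.trans (min_le_left _ _))
  have hrt : (|t| + 1) * r ≤ 1 / 12 :=
    (le_div_iff₀' (by positivity)).1 (hr'.trans (min_le_right _ _))
  have hupper : eLpNorm hφ.toSchwartzMap p Γ.arcLength ≤ ENNReal.ofReal (C * r) ^ p⁻¹.toReal :=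
    (eLpNorm_le_measure_rpow ((hφ.support_toSchwartzMap.trans_subset hsupp).trans
      Metric.ball_subset_closedBall) hφ.norm_toSchwartzMap_le_one p).trans
      (ENNReal.rpow_le_rpow (hball r hr) ENNReal.toReal_nonneg)
  have hlower := mul_volume_rpow_le_eLpNorm_strip hω t
    (Γ.continuous_extension hφ.toSchwartzMap.continuous).measurable hq
    (J := Icc 0 ((12 * K)⁻¹ / r ^ m)) (v := (c / 2 * r).toNNReal)
    (by simp only [Real.volume_Icc, sub_zero, ne_eq, ENNReal.ofReal_eq_zero, not_le]; positivity)
    fun t' ht' s hs => Real.toNNReal_le_iff_le_coe.2 <|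
      (by linarith : c / 2 * r ≤ (∫ ξ, φ ξ ∂Γ.arcLength) / 2).trans <|
        CompactC2Curve.half_integral_le_norm_extension_of_contactBound hω hK hc
          hφ.contDiff.continuous hφ.nonneg hr hsupp hrt ht' ((abs_of_nonneg hs.1).trans_le hs.2)
  have hreal := hlower.trans ((hD _).trans (mul_le_mul_right hupper _))
  rw [Real.volume_Icc, sub_zero, ← ENNReal.ofReal_coe_nnreal (p := D), ← ENNReal.ofReal,
    ENNReal.ofReal_rpow_of_nonneg (by positivity) ENNReal.toReal_nonneg,
    ENNReal.ofReal_rpow_of_nonneg (by positivity) ENNReal.toReal_nonneg,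
    ← ENNReal.ofReal_mul (by positivity), ← ENNReal.ofReal_mul (by positivity),
    ENNReal.ofReal_le_ofReal_iff (by positivity), Real.mul_rpow hC.le hr.le, ← mul_assoc,
    div_eq_mul_one_div (12 * K)⁻¹, Real.mul_rpow (by positivity) (by positivity)] at hreal
  exact (by ring : _ = _).trans_le hreal

theorem StripEstimateAt.inv_toReal_add_mul_inv_toReal_le_one (h : StripEstimateAt Γ ω p q t)
    (hω : ‖ω‖ = 1) (hq : q ≠ 0) {s₀ K : ℝ} (hs₀ : s₀ ∈ Icc Γ.a Γ.b) (hK : 0 < K) {m : ℕ}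
    (hc : Γ.ContactBound ω s₀ m K) : p⁻¹.toReal + m * q⁻¹.toReal ≤ 1 := by
  obtain ⟨A, B, r₁, hA, hr₁, hAB⟩ := h.exists_mul_rpow_le_mul_rpow hω hq hs₀ hK hc
  have : p⁻¹.toReal ≤ 1 - m * q⁻¹.toReal :=
    le_of_forall_small_mul_rpow_le hA hr₁ fun r hr hr' => by
      refine Eq.trans_le ?_ (hAB r hr hr')
      rw [Real.rpow_sub hr, Real.rpow_one, Real.rpow_mul hr.le, Real.rpow_natCast,
        Real.div_rpow zero_le_one (by positivity), Real.one_rpow]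
      ring
  linarith

theorem StripEstimateAt.one_div_add_one_div_le_one (h : StripEstimateAt Γ ω p q t)
    (hω : ‖ω‖ = 1) (hp : p ≠ 0) (hq : q ≠ 0) : 1 / p + 1 / q ≤ 1 := by
  simpa using (one_div_add_natCast_div_le_one_iff hp hq 1).2
    (h.inv_toReal_add_mul_inv_toReal_le_one hω hq (left_mem_Icc.2 Γ.lt.le) one_pos
      (Γ.contactBound_one hω Γ.a))

theorem StripEstimateAt.one_div_add_two_div_le_one (h : StripEstimateAt Γ ω p q t)
    (hω : ‖ω‖ = 1) (hp : p ≠ 0) (hq : q ≠ 0) {s₀ : ℝ} (hs₀ : s₀ ∈ Icc Γ.a Γ.b)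
    (h0 : inner ℝ (Γ.normal s₀) ω = 0) : 1 / p + 2 / q ≤ 1 := by
  obtain ⟨K, hK, hc⟩ := Γ.exists_contactBound_two hs₀ h0
  exact (one_div_add_natCast_div_le_one_iff hp hq 2).2
    (h.inv_toReal_add_mul_inv_toReal_le_one hω hq hs₀ hK hc)

end Knapp

theorem abs_setSign (s : Finset ℕ) (k : ℕ) : |setSign s k| = 1 := by
  unfold setSign
  split_ifs <;> simp

theorem norm_signedSum_of_forall_ne_eq_zero {N : ℕ} {z : ℕ → ℂ} (s : Finset ℕ) {k : ℕ}
    (hk : k ∈ Finset.range N) (h : ∀ j ∈ Finset.range N, j ≠ k → z j = 0) :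
    ‖signedSum N z s‖ = ‖z k‖ := by
  rw [signedSum, Finset.sum_eq_single_of_mem k hk fun j hj hjk => by rw [h j hj hjk, mul_zero],
    norm_mul, Complex.norm_real, Real.norm_eq_abs, abs_setSign, one_mul]

theorem signedSum_apply_eq_zero_or {α : Type*} {N : ℕ} {g : ℕ → α → ℂ} (hg :
    (↑(Finset.range N) : Set ℕ).PairwiseDisjoint fun k => Function.support (g k))
    (s : Finset ℕ) (x : α) : signedSum N (fun k => g k x) s = 0 ∨
      ∃ k ∈ Finset.range N, g k x ≠ 0 ∧ ‖signedSum N (fun k => g k x) s‖ = ‖g k x‖ := by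
  by_cases hx : ∃ k ∈ Finset.range N, g k x ≠ 0
  · obtain ⟨k, hk, hkx⟩ := hx
    refine Or.inr ⟨k, hk, hkx, norm_signedSum_of_forall_ne_eq_zero s hk fun j hj hjk => ?_⟩
    exact Function.notMem_support.1 ((hg hj hk hjk).notMem_of_mem_right hkx)
  · push Not at hx
    exact Or.inl (Finset.sum_eq_zero fun k hk => by simp only [hx k hk, mul_zero])

theorem norm_signedSum_apply_le {α : Type*} {N : ℕ} {g : ℕ → α → ℂ} (hg :
    (↑(Finset.range N) : Set ℕ).PairwiseDisjoint fun k => Function.support (g k))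
    {C : ℝ} (hC : 0 ≤ C) {x : α} (hle : ∀ k ∈ Finset.range N, ‖g k x‖ ≤ C) (s : Finset ℕ) :
    ‖signedSum N (fun k => g k x) s‖ ≤ C := by
  rcases signedSum_apply_eq_zero_or hg s x with h0 | ⟨k, hk, _, hnorm⟩
  · rwa [h0, norm_zero]
  · exact hnorm.trans_le (hle k hk)

theorem sum_smul_apply_eq_signedSum {E : Type*} [NormedAddCommGroup E] [NormedSpace ℝ E] (N : ℕ)
    (f : ℕ → SchwartzMap E ℂ) (s : Finset ℕ) (ξ : E) :
    (∑ k ∈ Finset.range N, (setSign s k : ℂ) • f k) ξ = signedSum N (fun k => f k ξ) s := by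
  simp [_root_.sum_apply, signedSum]

theorem sum_mul_volume_le_setLIntegral_strip {ω : Plane} (hω : ‖ω‖ = 1) (t : ℝ)
    {φ : Plane → ℝ≥0∞} (hφ : Measurable φ) {ι : Type*} (A : Finset ι) {J : ι → Set ℝ}
    {v : ι → ℝ≥0∞} (hJm : ∀ k ∈ A, MeasurableSet (J k)) (hJ : (↑A : Set ι).PairwiseDisjoint J)
    (h : ∀ k ∈ A, ∀ t' ∈ Icc (t - 1 / 2) (t + 1 / 2), ∀ s ∈ J k, v k ≤ φ (t' • ω + s • rot ω)) :
    ∑ k ∈ A, v k * volume (J k) ≤ ∫⁻ x in strip ω t, φ x :=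
  calc ∑ k ∈ A, v k * volume (J k)
      = ∫⁻ _ in Icc (t - 1 / 2) (t + 1 / 2), ∑ k ∈ A, v k * volume (J k) := by
        rw [setLIntegral_const, Real.volume_Icc, show t + 1 / 2 - (t - 1 / 2) = 1 by ring,
          ENNReal.ofReal_one, mul_one]
    _ ≤ ∫⁻ t' in Icc (t - 1 / 2) (t + 1 / 2), ∫⁻ s, φ (t' • ω + s • rot ω) :=
        setLIntegral_mono' measurableSet_Icc fun t' ht' =>
          calc ∑ k ∈ A, v k * volume (J k)
              ≤ ∑ k ∈ A, ∫⁻ s in J k, φ (t' • ω + s • rot ω) :=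
                Finset.sum_le_sum fun k hk => by
                  rw [← setLIntegral_const]
                  exact setLIntegral_mono' (hJm k hk) (h k hk t' ht')
            _ = ∫⁻ s in ⋃ k ∈ A, J k, φ (t' • ω + s • rot ω) :=
                (lintegral_biUnion_finset hJ hJm _).symm
            _ ≤ ∫⁻ s, φ (t' • ω + s • rot ω) := setLIntegral_le_lintegral _ _
    _ = ∫⁻ x in strip ω t, φ x := (setLIntegral_strip hω t hφ).symm

section SquareFunction

variable {Γ : CompactC2Curve} {ω : Plane} {p q : ℝ≥0∞} {t : ℝ}

theorem StripEstimateAt.exists_lintegral_squareFunction_le (h : StripEstimateAt Γ ω p q t)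
    (hq : q ≠ 0) (hq' : q ≠ ∞) :
    ∃ D : ℝ≥0, ∀ (N : ℕ) (f : ℕ → SchwartzMap Plane ℂ) (B : ℝ≥0∞),
      (∀ s, eLpNorm (fun ξ => signedSum N (fun k => f k ξ) s) p Γ.arcLength ≤ B) →
      ∫⁻ x in strip ω t, ENNReal.ofReal
        ((∑ k ∈ Finset.range N, ‖Γ.extension (f k) x‖ ^ 2) ^ (q.toReal / 2)) ≤
        D * B ^ q.toReal := by
  obtain ⟨C, hC⟩ := h
  have hQ : 0 < q.toReal := ENNReal.toReal_pos hq hq'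
  obtain ⟨c, hc, hK⟩ := _root_.exists_lintegral_squareFunction_le hQ
  refine ⟨c⁻¹.toNNReal * C ^ q.toReal, fun N f B hB => ?_⟩
  have hsigned : ∀ s, ∫⁻ x in strip ω t, ‖signedSum N (fun k => Γ.extension (f k) x) s‖ₑ ^
      q.toReal ≤ (C * B) ^ q.toReal := fun s => by
    simp_rw [← CompactC2Curve.extension_signedSum fun k => (f k).continuous,
      ← sum_smul_apply_eq_signedSum]
    rw [lintegral_rpow_enorm_eq_rpow_eLpNorm' hQ, ← eLpNorm_eq_eLpNorm' hq hq']
    have := hB s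
    simp_rw [← sum_smul_apply_eq_signedSum] at this
    gcongr
    exact (hC _).trans (mul_le_mul_right this _)
  have hsq := hK (volume.restrict (strip ω t)) N (fun k => Γ.extension (f k)) _
    (fun k => (Γ.continuous_extension (f k).continuous).measurable) hsigned
  rw [mul_comm, ← ENNReal.le_div_iff_mul_le (by simp [hc]) (by simp), ENNReal.div_eq_inv_mul,
    ← ENNReal.ofReal_inv_of_pos hc, ENNReal.mul_rpow_of_nonneg _ _ hQ.le, ← mul_assoc,
    ← ENNReal.coe_rpow_of_nonneg _ hQ.le] at hsq
  exact_mod_cast hsq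

theorem StripEstimateAt.exists_sum_rpow_mul_volume_le (h : StripEstimateAt Γ ω p q t)
    (hω : ‖ω‖ = 1) (hq : q ≠ 0) (hq' : q ≠ ∞) :
    ∃ D : ℝ≥0, ∀ (N : ℕ) (f : ℕ → SchwartzMap Plane ℂ) (B : ℝ≥0∞),
      (∀ s, eLpNorm (fun ξ => signedSum N (fun k => f k ξ) s) p Γ.arcLength ≤ B) →
      ∀ (A : Finset ℕ) (J : ℕ → Set ℝ) (v : ℕ → ℝ), (∀ k ∈ A, MeasurableSet (J k)) →
      (↑A : Set ℕ).PairwiseDisjoint J → (∀ k ∈ A, 0 ≤ v k) →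
      (∀ k ∈ A, ∀ t' ∈ Icc (t - 1 / 2) (t + 1 / 2), ∀ s ∈ J k,
        v k ≤ ∑ j ∈ Finset.range N, ‖Γ.extension (f j) (t' • ω + s • rot ω)‖ ^ 2) →
      ∑ k ∈ A, ENNReal.ofReal (v k ^ (q.toReal / 2)) * volume (J k) ≤ D * B ^ q.toReal := by
  obtain ⟨D, hD⟩ := h.exists_lintegral_squareFunction_le hq hq'
  refine ⟨D, fun N f B hB A J v hJm hJ hv hle => le_trans ?_ (hD N f B hB)⟩
  refine sum_mul_volume_le_setLIntegral_strip hω t ?_ A hJm hJ fun k hk t' ht' s hs => ?_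
  · have := fun k => (Γ.continuous_extension (f k).continuous).measurable
    fun_prop
  · exact ENNReal.ofReal_le_ofReal
      (Real.rpow_le_rpow (hv k hk) (hle k hk t' ht' s hs) (by positivity))

end SquareFunction

namespace CompactC2Curve

variable {Γ : CompactC2Curve} {ω : Plane}

theorem exists_forall_dist_ge (hω : ‖ω‖ = 1) (ht : Γ.Transversal ω) :
    ∃ d > 0, ∀ N : ℕ, 0 < N → ∃ σ : ℕ → ℝ, (∀ k, σ k ∈ Icc Γ.a Γ.b) ∧
      (↑(Finset.range N) : Set ℕ).Pairwise fun j k => d / N ≤ dist (Γ.γ (σ j)) (Γ.γ (σ k)) := by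
  obtain ⟨d, hd, hsep⟩ := exists_mul_abs_sub_le_norm_sub hω ht
  have hab : 0 < Γ.b - Γ.a := sub_pos.2 Γ.lt
  refine ⟨d * (Γ.b - Γ.a), by positivity, fun N hN => ?_⟩
  have hN' : (0 : ℝ) < N := by exact_mod_cast hN
  set σ : ℕ → ℝ := fun k => Γ.a + (Γ.b - Γ.a) * ((min k N : ℕ) / N)
  have hσ : ∀ k, σ k ∈ Icc Γ.a Γ.b := fun k => by
    have hle : ((min k N : ℕ) : ℝ) / N ≤ 1 := by
      rw [div_le_one hN']; exact_mod_cast min_le_right k N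
    constructor
    · exact le_add_of_nonneg_right (by positivity)
    · have := mul_le_of_le_one_right hab.le hle
      simp only [σ]
      linarith
  refine ⟨σ, hσ, fun j hj k hk hjk => ?_⟩
  have hdiff : σ j - σ k = (Γ.b - Γ.a) * (((j - k : ℤ) : ℝ) / N) := by
    simp only [σ, min_eq_left (Finset.mem_range.1 hj).le, min_eq_left (Finset.mem_range.1 hk).le]
    push_cast
    ring
  have hone : (1 : ℝ) ≤ |((j - k : ℤ) : ℝ)| := by
    exact_mod_cast Int.one_le_abs (sub_ne_zero.2 (Nat.cast_injective.ne hjk))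
  calc d * (Γ.b - Γ.a) / N = d * ((Γ.b - Γ.a) * (1 / N)) := by ring
    _ ≤ d * |σ j - σ k| := by
      rw [hdiff, abs_mul, abs_div, abs_of_pos hab, abs_of_pos hN']
      gcongr
    _ ≤ dist (Γ.γ (σ j)) (Γ.γ (σ k)) := by
      rw [dist_eq_norm]
      exact hsep _ (hσ k) _ (hσ j)

theorem exists_disjoint_cutoffs (hω : ‖ω‖ = 1) (ht : Γ.Transversal ω) :
    ∃ c κ : ℝ, 0 < c ∧ 0 < κ ∧ ∀ N : ℕ, 0 < N → ∃ (σ : ℕ → ℝ) (φ : ℕ → Plane → ℝ),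
      (∀ k, IsCutoff (φ k)) ∧ (∀ k, Function.support (φ k) ⊆ Metric.ball (Γ.γ (σ k)) (κ / N)) ∧
      (∀ k, c / N ≤ ∫ ξ, φ k ξ ∂Γ.arcLength) ∧
      (↑(Finset.range N) : Set ℕ).PairwiseDisjoint fun k => Function.support (φ k) := by
  obtain ⟨d, hd, hsep⟩ := exists_forall_dist_ge hω ht
  obtain ⟨c, r₀, hc, hr₀, hcut⟩ := Γ.exists_isCutoff_ball_le_integral
  set κ := min (d / 2) r₀
  have hκ : 0 < κ := lt_min (half_pos hd) hr₀
  refine ⟨c * κ, κ, by positivity, hκ, fun N hN => ?_⟩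
  obtain ⟨σ, hσ, hdist⟩ := hsep N hN
  have hN' : (1 : ℝ) ≤ N := by exact_mod_cast hN
  choose φ hφ hsupp hint using fun k =>
    hcut (σ k) (hσ k) (κ / N) (by positivity) ((div_le_self hκ.le hN').trans (min_le_right _ _))
  refine ⟨σ, φ, hφ, hsupp, fun k => by rw [mul_div_assoc]; exact hint k, fun j hj k hk hjk => ?_⟩
  refine (Metric.ball_disjoint_ball ?_).mono (hsupp j) (hsupp k)
  calc κ / N + κ / N = 2 * κ / N := by ring
    _ ≤ d / N := by gcongr; linarith [min_le_left (d / 2) r₀]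
    _ ≤ _ := hdist hj hk hjk

theorem exists_disjoint_cutoffs_le_norm_extension (hω : ‖ω‖ = 1) (ht : Γ.Transversal ω) (t : ℝ) :
    ∃ c η : ℝ, 0 < c ∧ 0 < η ∧ ∃ N₀ : ℕ, ∀ N : ℕ, N₀ < N → ∃ φ : ℕ → Plane → ℝ,
      (∀ k, IsCutoff (φ k)) ∧
      (↑(Finset.range N) : Set ℕ).PairwiseDisjoint (fun k => Function.support (φ k)) ∧
      ∀ k, ∀ t' ∈ Icc (t - 1 / 2) (t + 1 / 2), ∀ s ∈ Icc 0 (η * N),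
        c / N ≤ ‖Γ.extension (fun ξ => φ k ξ) (t' • ω + s • rot ω)‖ := by
  obtain ⟨c, κ, hc, hκ, hcut⟩ := exists_disjoint_cutoffs hω ht
  obtain ⟨N₀, hN₀⟩ := exists_nat_ge (12 * κ * (|t| + 1))
  refine ⟨c / 2, (12 * κ)⁻¹, half_pos hc, by positivity, N₀, fun N hN => ?_⟩
  obtain ⟨σ, φ, hφ, hsupp, hint, hdisj⟩ := hcut N (N₀.zero_le.trans_lt hN)
  have hN' : (N₀ : ℝ) < N := by exact_mod_cast hN
  have hNpos : (0 : ℝ) < N := N₀.cast_nonneg.trans_lt hN'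
  have hsmall : (|t| + 1) * (κ / N) ≤ 1 / 12 := by
    rw [← mul_div_assoc, div_le_iff₀ hNpos]
    linarith
  refine ⟨φ, hφ, hdisj, fun k t' ht' s hs => le_trans ?_
    (half_integral_le_norm_extension_of_contactBound hω one_pos (Γ.contactBound_one hω (σ k))
      (hφ k).contDiff.continuous (hφ k).nonneg (by positivity) (hsupp k) hsmall ht' ?_)⟩
  · rw [div_right_comm]
    exact div_le_div_of_nonneg_right (hint k) zero_le_two
  · rw [abs_of_nonneg hs.1]
    exact hs.2.trans_eq (by field_simp)

end CompactC2Curve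

section Transversal

variable {Γ : CompactC2Curve} {ω : Plane} {p q : ℝ≥0∞} {t : ℝ}

/- The square function of `N` disjoint Knapp examples of size `1 / N` is compared with the `L^p`
norm of their signed sums, which stays bounded. -/
theorem StripEstimateAt.exists_mul_rpow_le_of_transversal (h : StripEstimateAt Γ ω p q t)
    (hω : ‖ω‖ = 1) (ht : Γ.Transversal ω) (hq : q ≠ 0) (hq' : q ≠ ∞) :
    ∃ A B : ℝ, 0 < A ∧ ∃ N₀ : ℕ, ∀ N : ℕ, N₀ ≤ N → A * (N : ℝ) ^ (1 - q.toReal / 2) ≤ B := by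
  obtain ⟨D, hD⟩ := h.exists_sum_rpow_mul_volume_le hω hq hq'
  obtain ⟨c, η, hc, hη, N₀, hcut⟩ :=
    CompactC2Curve.exists_disjoint_cutoffs_le_norm_extension hω ht t
  have hB : Γ.arcLength univ ^ p⁻¹.toReal ≠ ∞ :=
    ENNReal.rpow_ne_top_of_nonneg ENNReal.toReal_nonneg (measure_ne_top _ _)
  refine ⟨(c ^ 2) ^ (q.toReal / 2) * η, (D * (Γ.arcLength univ ^ p⁻¹.toReal) ^ q.toReal).toReal,
    by positivity, N₀ + 1, fun N hN => ?_⟩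
  have hN' : (0 : ℝ) < N := by exact_mod_cast (by omega : 0 < N)
  obtain ⟨φ, hφ, hdisj, hextension⟩ := hcut N hN
  have hdisj' : (↑(Finset.range N) : Set ℕ).PairwiseDisjoint
      fun k => Function.support (hφ k).toSchwartzMap := by
    simpa only [IsCutoff.support_toSchwartzMap] using hdisj
  have hbound := hD N (fun k => (hφ k).toSchwartzMap) _ (fun s => eLpNorm_le_measure_rpow
      (subset_univ _) (fun ξ => norm_signedSum_apply_le hdisj' zero_le_one
        (fun k _ => (hφ k).norm_toSchwartzMap_le_one ξ) s) p)
    {0} (fun _ => Icc 0 (η * N)) (fun _ => c ^ 2 * (N : ℝ)⁻¹)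
    (fun _ _ => measurableSet_Icc) (by simp) (fun _ _ => by positivity) fun _ _ t' ht' s hs =>
      calc c ^ 2 * (N : ℝ)⁻¹ = ∑ _k ∈ Finset.range N, (c / N) ^ 2 := by
            rw [Finset.sum_const, Finset.card_range, nsmul_eq_mul]
            field_simp
        _ ≤ _ := Finset.sum_le_sum fun _ _ =>
            pow_le_pow_left₀ (by positivity) (hextension _ t' ht' s hs) 2
  rw [Finset.sum_singleton, Real.volume_Icc, sub_zero, ← ENNReal.ofReal_mul (by positivity),
    ENNReal.ofReal_le_iff_le_toReal (by finiteness)] at hbound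
  refine Eq.trans_le ?_ hbound
  rw [Real.mul_rpow (by positivity) (by positivity), Real.inv_rpow hN'.le, Real.rpow_sub hN',
    Real.rpow_one]
  ring

theorem StripEstimateAt.two_le_of_transversal (h : StripEstimateAt Γ ω p q t) (hω : ‖ω‖ = 1)
    (ht : Γ.Transversal ω) (hq : q ≠ 0) : 2 ≤ q := by
  by_contra! hlt
  obtain ⟨A, B, hA, N₀, hAB⟩ := h.exists_mul_rpow_le_of_transversal hω ht hq hlt.ne_top
  have : q.toReal < 2 := by simpa using (ENNReal.toReal_lt_toReal hlt.ne_top (by simp)).2 hlt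
  exact not_forall_natCast_mul_rpow_le hA (by linarith) N₀ hAB

end Transversal

theorem enorm_signedSum_apply_rpow_le {α : Type*} {N : ℕ} {g : ℕ → α → ℂ} (hg :
    (↑(Finset.range N) : Set ℕ).PairwiseDisjoint fun k => Function.support (g k))
    {P : ℝ} (hP : 0 < P) (s : Finset ℕ) (x : α) :
    ‖signedSum N (fun k => g k x) s‖ₑ ^ P ≤ ∑ k ∈ Finset.range N, ‖g k x‖ₑ ^ P := by
  rcases signedSum_apply_eq_zero_or hg s x with h0 | ⟨k, hk, _, hnorm⟩
  · simp [h0, hP]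
  · rw [enorm_eq_iff_norm_eq.2 hnorm]
    exact Finset.single_le_sum (f := fun k => ‖g k x‖ₑ ^ P) (fun _ _ => zero_le) hk

theorem eLpNorm_signedSum_le {α : Type*} [MeasurableSpace α] {μ : Measure α} {p : ℝ≥0∞}
    (hp : p ≠ 0) {N : ℕ} {g : ℕ → α → ℂ} (hg :
    (↑(Finset.range N) : Set ℕ).PairwiseDisjoint fun k => Function.support (g k))
    (hgm : ∀ k ∈ Finset.range N, AEStronglyMeasurable (g k) μ) {B : ℝ≥0∞}
    (hB : ∀ k ∈ Finset.range N, eLpNorm (g k) p μ ≤ B) (s : Finset ℕ) :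
    eLpNorm (fun x => signedSum N (fun k => g k x) s) p μ ≤ N ^ p⁻¹.toReal * B := by
  rcases eq_or_ne p ∞ with rfl | hp'
  · simp only [ENNReal.inv_top, ENNReal.toReal_zero, ENNReal.rpow_zero, one_mul]
    refine essSup_le_of_ae_le B ?_
    have hae : ∀ᵐ x ∂μ, ∀ k ∈ Finset.range N, ‖g k x‖ₑ ≤ B :=
      (Finset.range N).eventually_all.2 fun k hk =>
        ae_le_eLpNormEssSup.mono fun x hx => hx.trans (hB k hk)
    filter_upwards [hae] with x hx
    rcases signedSum_apply_eq_zero_or hg s x with h0 | ⟨k, hk, _, hnorm⟩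
    · simp [h0]
    · exact (enorm_eq_iff_norm_eq.2 hnorm).trans_le (hx k hk)
  · have hP : 0 < p.toReal := ENNReal.toReal_pos hp hp'
    simp_rw [eLpNorm_eq_eLpNorm' hp hp'] at hB ⊢
    rw [← ENNReal.rpow_le_rpow_iff hP, ← lintegral_rpow_enorm_eq_rpow_eLpNorm' hP,
      ENNReal.mul_rpow_of_nonneg _ _ hP.le, ← ENNReal.rpow_mul, ENNReal.toReal_inv,
      inv_mul_cancel₀ hP.ne', ENNReal.rpow_one]
    calc ∫⁻ x, ‖signedSum N (fun k => g k x) s‖ₑ ^ p.toReal ∂μ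
        ≤ ∫⁻ x, ∑ k ∈ Finset.range N, ‖g k x‖ₑ ^ p.toReal ∂μ :=
          lintegral_mono fun x => enorm_signedSum_apply_rpow_le hg hP s x
      _ = ∑ k ∈ Finset.range N, ∫⁻ x, ‖g k x‖ₑ ^ p.toReal ∂μ :=
          lintegral_finsetSum' _ fun k hk => (hgm k hk).enorm.pow_const _
      _ ≤ ∑ _k ∈ Finset.range N, B ^ p.toReal := Finset.sum_le_sum fun k hk => by
          rw [lintegral_rpow_enorm_eq_rpow_eLpNorm' hP]
          gcongr
          exact hB k hk
      _ = N * B ^ p.toReal := by rw [Finset.sum_const, Finset.card_range, nsmul_eq_mul]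

namespace CompactC2Curve

variable {Γ : CompactC2Curve} {ω : Plane}

theorem extension_const_smul (z : ℂ) (f : Plane → ℂ) (x : Plane) :
    Γ.extension (z • f) x = z * Γ.extension f x := by
  simp only [extension, Pi.smul_apply, smul_eq_mul, mul_assoc, integral_const_mul]

theorem exists_lacunary_cutoffs (Γ : CompactC2Curve) {s₀ : ℝ} (hs₀ : s₀ ∈ Icc Γ.a Γ.b) {ε : ℝ}
    (hε : 0 < ε) :
    ∃ (M c : ℝ) (r : ℕ → ℝ) (φ : ℕ → Plane → ℝ), 1 < M ∧ 0 < c ∧ (∀ k, 0 < r k) ∧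
      (∀ k, r (k + 1) = r k / M) ∧ (∀ k, r k ≤ ε) ∧ (∀ k, IsCutoff (φ k)) ∧
      Pairwise (Function.onFun Disjoint fun k => Function.support (φ k)) ∧
      (∀ k, Function.support (φ k) ⊆ Metric.ball (Γ.γ s₀) (r k)) ∧
      ∀ k, c * r k ≤ ∫ ξ, φ k ξ ∂Γ.arcLength := by
  obtain ⟨M, c, r₀, hM, hc, hr₀, hcut⟩ := Γ.exists_isCutoff_annulus_le_integral hs₀
  set r : ℕ → ℝ := fun k => min r₀ ε / M ^ k
  have hmin : 0 < min r₀ ε := lt_min hr₀ hε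
  have hr : ∀ k, 0 < r k := fun k => by positivity
  have hle : ∀ k, r k ≤ min r₀ ε := fun k => div_le_self hmin.le (one_le_pow₀ hM.le)
  have hsucc : ∀ k, r (k + 1) = r k / M := fun k => by simp only [r, pow_succ, div_div]
  have hanti : Antitone r := antitone_nat_of_succ_le fun k => by
    rw [hsucc]
    exact div_le_self (hr k).le hM.le
  choose φ hφ hsupp hint using fun k => hcut (r k) (hr k) ((hle k).trans (min_le_left _ _))
  refine ⟨M, c, r, φ, hM, hc, hr, hsucc, fun k => (hle k).trans (min_le_right _ _), hφ,
    (pairwise_disjoint_on _).2 fun j k hjk => ?_, fun k => (hsupp k).trans sdiff_subset, hint⟩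
  refine disjoint_left.2 fun ξ hj hk => (hsupp j hj).2 (Metric.ball_subset_closedBall ?_)
  rw [← hsucc]
  exact Metric.ball_subset_ball (hanti hjk) (hsupp k hk).1

end CompactC2Curve

theorem IsCutoff.eLpNorm_rpow_neg_smul_toSchwartzMap_le {φ : Plane → ℝ} (hφ : IsCutoff φ)
    {μ : Measure Plane} {ξ₀ : Plane} {r C : ℝ} (hr : 0 < r)
    (hsupp : Function.support φ ⊆ Metric.ball ξ₀ r)
    (hball : μ (Metric.closedBall ξ₀ r) ≤ ENNReal.ofReal (C * r)) (p : ℝ≥0∞) :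
    eLpNorm (((r ^ (-p⁻¹.toReal) : ℝ) : ℂ) • hφ.toSchwartzMap) p μ
      ≤ ENNReal.ofReal C ^ p⁻¹.toReal :=
  calc eLpNorm (((r ^ (-p⁻¹.toReal) : ℝ) : ℂ) • hφ.toSchwartzMap) p μ
      = ENNReal.ofReal (r ^ (-p⁻¹.toReal)) * eLpNorm hφ.toSchwartzMap p μ := by
        rw [FunLike.coe_smul, eLpNorm_const_smul, ← ofReal_norm, Complex.norm_real,
          Real.norm_of_nonneg (by positivity)]
    _ ≤ ENNReal.ofReal (r ^ (-p⁻¹.toReal)) * ENNReal.ofReal (C * r) ^ p⁻¹.toReal := by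
        gcongr
        exact (eLpNorm_le_measure_rpow ((hφ.support_toSchwartzMap.trans_subset hsupp).trans
          Metric.ball_subset_closedBall) hφ.norm_toSchwartzMap_le_one p).trans
          (ENNReal.rpow_le_rpow hball ENNReal.toReal_nonneg)
    _ = ENNReal.ofReal C ^ p⁻¹.toReal := by
        rw [ENNReal.ofReal_mul' hr.le, ENNReal.mul_rpow_of_nonneg _ _ ENNReal.toReal_nonneg,
          ENNReal.ofReal_rpow_of_pos hr, mul_left_comm, ← ENNReal.ofReal_mul (by positivity),
          ← Real.rpow_add hr, neg_add_cancel, Real.rpow_zero, ENNReal.ofReal_one, mul_one]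

theorem rpow_neg_mul_rpow_mul_sub_eq {r c M η x Q : ℝ} (hr : 0 < r) (hc : 0 < c) {m : ℕ}
    (hQ : 0 < Q) (hx : x + m * Q⁻¹ = 1) :
    (r ^ (-x) * (c * r)) ^ Q * (η / r ^ m - η / (M * r) ^ m) =
      c ^ Q * η * (1 - (M ^ m)⁻¹) := by
  have hexp : (-x + 1) * Q = m := by
    field_simp at hx
    linarith
  rw [mul_left_comm, ← Real.rpow_add_one hr.ne', Real.mul_rpow hc.le (by positivity),
    ← Real.rpow_mul hr.le, hexp, Real.rpow_natCast, mul_pow]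
  field_simp

section Lacunary

variable {Γ : CompactC2Curve} {ω : Plane} {p q : ℝ≥0∞} {t : ℝ}

theorem CompactC2Curve.mul_le_norm_extension_smul_toSchwartzMap (hω : ‖ω‖ = 1) {s₀ K : ℝ} {m : ℕ}
    (hK : 0 < K) (hc : Γ.ContactBound ω s₀ m K) {φ : Plane → ℝ} (hφ : IsCutoff φ) {w r c : ℝ}
    (hw : 0 ≤ w) (hr : 0 < r) (hsupp : Function.support φ ⊆ Metric.ball (Γ.γ s₀) r)
    (hint : c * r ≤ ∫ ξ, φ ξ ∂Γ.arcLength) {t' s : ℝ} (hrt : (|t| + 1) * r ≤ 1 / 12)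
    (ht' : t' ∈ Icc (t - 1 / 2) (t + 1 / 2)) (hs : |s| ≤ (12 * K)⁻¹ / r ^ m) :
    w * (c / 2 * r) ≤ ‖Γ.extension ((w : ℂ) • hφ.toSchwartzMap) (t' • ω + s • rot ω)‖ := by
  rw [extension_const_smul, norm_mul, Complex.norm_real, Real.norm_of_nonneg hw]
  refine mul_le_mul_of_nonneg_left ?_ hw
  exact (by linarith : c / 2 * r ≤ (∫ ξ, φ ξ ∂Γ.arcLength) / 2).trans
    (half_integral_le_norm_extension_of_contactBound hω hK hc hφ.contDiff.continuous hφ.nonneg hr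
      hsupp hrt ht' hs)

theorem CompactC2Curve.exists_lacunary_schwartzMaps (hω : ‖ω‖ = 1) {s₀ K : ℝ}
    (hs₀ : s₀ ∈ Icc Γ.a Γ.b) (hK : 0 < K) {m : ℕ} (hm : m ≠ 0) (hc : Γ.ContactBound ω s₀ m K)
    {Q : ℝ} (hQ : 0 < Q) (hx : p⁻¹.toReal + m * Q⁻¹ = 1) (t : ℝ) :
    ∃ (B : ℝ≥0) (V : ℝ) (f : ℕ → SchwartzMap Plane ℂ) (J : ℕ → Set ℝ) (v : ℕ → ℝ), 0 < V ∧
      Pairwise (Function.onFun Disjoint fun k => Function.support (f k)) ∧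
      (∀ k, eLpNorm (f k) p Γ.arcLength ≤ B) ∧ (∀ k, MeasurableSet (J k)) ∧
      Pairwise (Function.onFun Disjoint J) ∧ (∀ k, 0 ≤ v k) ∧
      (∀ k, ∀ t' ∈ Icc (t - 1 / 2) (t + 1 / 2), ∀ s ∈ J k,
        v k ≤ ‖Γ.extension (f k) (t' • ω + s • rot ω)‖) ∧
      ∀ k, ENNReal.ofReal (v k ^ Q) * volume (J k) = ENNReal.ofReal V := by
  obtain ⟨C, -, hball⟩ := Γ.exists_arcLength_closedBall_le (Γ.γ s₀)
  obtain ⟨M, c, r, φ, hM, hc0, hr, hsucc, hrε, hφ, hdisj, hsupp, hint⟩ :=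
    Γ.exists_lacunary_cutoffs hs₀ (by positivity : 0 < 1 / 12 / (|t| + 1))
  have hM0 : 0 < M := one_pos.trans hM
  set F : ℕ → ℝ := fun k => (12 * K)⁻¹ / (M * r k) ^ m
  have hF : ∀ k, 0 < F k := fun k => by have := hr k; positivity
  have hFsucc : ∀ k, F (k + 1) = (12 * K)⁻¹ / r k ^ m := fun k => by
    simp only [F, hsucc, mul_div_cancel₀ _ hM0.ne']
  have hFmono : Monotone F := monotone_nat_of_le_succ fun k => by
    have := hr k
    rw [hFsucc]
    exact div_le_div_of_nonneg_left (by positivity) (by positivity)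
      (pow_le_pow_left₀ this.le (le_mul_of_one_le_left this.le hM.le) m)
  refine ⟨(ENNReal.ofReal C ^ p⁻¹.toReal).toNNReal,
    (c / 2) ^ Q * (12 * K)⁻¹ * (1 - (M ^ m)⁻¹),
    fun k => ((r k ^ (-p⁻¹.toReal) : ℝ) : ℂ) • (hφ k).toSchwartzMap,
    fun k => Ioc (F k) (F (k + 1)), fun k => r k ^ (-p⁻¹.toReal) * (c / 2 * r k),
    mul_pos (by positivity) (sub_pos.2 (inv_lt_one_of_one_lt₀ (one_lt_pow₀ hM hm))),
    fun j k hjk => (hdisj hjk).mono ?_ ?_, fun k => ?_, fun _ => measurableSet_Ioc,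
    hFmono.pairwise_disjoint_on_Ioc_succ, fun k => by have := hr k; positivity,
    fun k t' ht' s hs => ?_, fun k => ?_⟩
  iterate 2
    simp only [← (hφ _).support_toSchwartzMap]
    exact Function.support_const_smul_subset _ _
  · rw [ENNReal.coe_toNNReal (by finiteness)]
    exact (hφ k).eLpNorm_rpow_neg_smul_toSchwartzMap_le (hr k) (hsupp k) (hball _ (hr k)) p
  · refine mul_le_norm_extension_smul_toSchwartzMap hω hK hc (hφ k)
      (Real.rpow_nonneg (hr k).le _) (hr k) (hsupp k) (hint k)
      ((le_div_iff₀' (by positivity)).1 (hrε k)) ht' ?_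
    rw [abs_of_pos ((hF k).trans hs.1), ← hFsucc]
    exact hs.2
  · rw [Real.volume_Ioc, ← ENNReal.ofReal_mul (by have := hr k; positivity), hFsucc,
      rpow_neg_mul_rpow_mul_sub_eq (hr k) (half_pos hc0) hQ hx]

/- Superposing the Knapp examples at lacunary scales with random signs: all of them contribute
the same amount to the `L^q` norm on pairwise disjoint parts of the strip. -/
theorem StripEstimateAt.inv_toReal_add_mul_inv_toReal_ne_one (h : StripEstimateAt Γ ω p q t)
    (hω : ‖ω‖ = 1) (hq : q ≠ 0) (hqp : q < p) {s₀ K : ℝ} (hs₀ : s₀ ∈ Icc Γ.a Γ.b) (hK : 0 < K)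
    {m : ℕ} (hm : m ≠ 0) (hc : Γ.ContactBound ω s₀ m K) :
    p⁻¹.toReal + m * q⁻¹.toReal ≠ 1 := fun hx => by
  have hp : p ≠ 0 := (pos_of_gt hqp).ne'
  have hq' : q ≠ ∞ := hqp.ne_top
  have hQ : 0 < q.toReal := ENNReal.toReal_pos hq hq'
  obtain ⟨D, hD⟩ := h.exists_sum_rpow_mul_volume_le hω hq hq'
  obtain ⟨B, V, f, J, v, hV, hdisj, hB, hJm, hJ, hv, hlower, hvJ⟩ :=
    CompactC2Curve.exists_lacunary_schwartzMaps hω hs₀ hK hm hc hQ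
      (by rwa [← ENNReal.toReal_inv]) t
  have hexp : 0 < 1 - p⁻¹.toReal * q.toReal := by
    rw [sub_pos, ← lt_div_iff₀ hQ, one_div, ← ENNReal.toReal_inv]
    exact (inv_toReal_lt_inv_toReal_iff hp hq).2 hqp
  refine not_forall_natCast_mul_rpow_le (B := D * B ^ q.toReal) hV hexp 1 fun N hN => ?_
  have hN' : (0 : ℝ) < N := by exact_mod_cast hN
  have hbound := hD N f _ (eLpNorm_signedSum_le hp (hdisj.set_pairwise _)
    (fun k _ => (f k).continuous.aestronglyMeasurable) fun k _ => hB k) (Finset.range N) J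
    (fun k => v k ^ 2) (fun k _ => hJm k) (hJ.set_pairwise _) (fun k _ => sq_nonneg _)
    fun k hk t' ht' s hs => (pow_le_pow_left₀ (hv k) (hlower k t' ht' s hs) 2).trans
      (Finset.single_le_sum (f := fun j => ‖Γ.extension (f j) (t' • ω + s • rot ω)‖ ^ 2)
        (fun _ _ => sq_nonneg _) hk)
  have hterm : ∀ k, ENNReal.ofReal ((v k ^ 2) ^ (q.toReal / 2)) * volume (J k) =
      ENNReal.ofReal V := fun k => by
    rw [← hvJ, ← Real.rpow_natCast_mul (hv k), Nat.cast_ofNat, mul_div_cancel₀ _ two_ne_zero]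
  rw [Finset.sum_congr rfl fun k _ => hterm k, Finset.sum_const, Finset.card_range, nsmul_eq_mul,
    ENNReal.mul_rpow_of_nonneg _ _ hQ.le, ← ENNReal.rpow_mul, ← ENNReal.ofReal_natCast,
    ENNReal.ofReal_rpow_of_pos hN', ← ENNReal.ofReal_coe_nnreal (p := B),
    ENNReal.ofReal_rpow_of_nonneg B.coe_nonneg hQ.le, ← ENNReal.ofReal_coe_nnreal (p := D),
    ← ENNReal.ofReal_mul (by positivity), ← ENNReal.ofReal_mul (by positivity),
    ← ENNReal.ofReal_mul (by positivity), ENNReal.ofReal_le_ofReal_iff (by positivity)] at hbound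
  rw [Real.rpow_sub hN', Real.rpow_one, ← mul_div_assoc, div_le_iff₀ (by positivity)]
  linarith

end Lacunary

section Characterization

variable {Γ : CompactC2Curve} {ω : Plane} {p q : ℝ≥0∞}

theorem StripEstimateAt.exponents_of_transversal {t : ℝ} (h : StripEstimateAt Γ ω p q t)
    (hω : ‖ω‖ = 1) (ht : Γ.Transversal ω) (hp : p ≠ 0) (hq : q ≠ 0) :
    1 / p + 1 / q ≤ 1 ∧ 2 ≤ q :=
  ⟨h.one_div_add_one_div_le_one hω hp hq, h.two_le_of_transversal hω ht hq⟩

theorem StripEstimateAt.exponents_of_not_transversal {t : ℝ} (h : StripEstimateAt Γ ω p q t)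
    (hω : ‖ω‖ = 1) (ht : ¬ Γ.Transversal ω) (hp : p ≠ 0) (hq : q ≠ 0) :
    (p ≤ q → 1 / p + 2 / q ≤ 1) ∧ (q < p → 1 / p + 2 / q < 1) := by
  simp only [CompactC2Curve.Transversal, not_forall, not_not] at ht
  obtain ⟨s₀, hs₀, h0⟩ := ht
  have hle := h.one_div_add_two_div_le_one hω hp hq hs₀ h0
  refine ⟨fun _ => hle, fun hqp => ?_⟩
  obtain ⟨K, hK, hc⟩ := Γ.exists_contactBound_two hs₀ h0
  exact (one_div_add_natCast_div_lt_one_iff hp hq 2).2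
    (((one_div_add_natCast_div_le_one_iff hp hq 2).1 hle).lt_of_ne
      (h.inv_toReal_add_mul_inv_toReal_ne_one hω hq hqp hs₀ hK two_ne_zero hc))

theorem estimates_iff_of_imp {P : Prop} (hω : ‖ω‖ = 1) (hradon : P → RadonEstimate Γ ω p q)
    (hstrip : ∀ t, StripEstimateAt Γ ω p q t → P) :
    (StripEstimate Γ ω p q ↔ P) ∧ (∀ t, StripEstimateAt Γ ω p q t ↔ P) ∧
      (RadonEstimate Γ ω p q ↔ P) :=
  have hP : P → StripEstimate Γ ω p q := fun h => (hradon h).stripEstimate hω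
  ⟨⟨fun h => hstrip 0 (h.stripEstimateAt 0), hP⟩,
    fun t => ⟨hstrip t, fun h => (hP h).stripEstimateAt t⟩,
    ⟨fun h => hstrip 0 ((h.stripEstimate hω).stripEstimateAt 0), hradon⟩⟩

end Characterization

theorem theorem1_general (Γ : CompactC2Curve) (ω : Plane) (hω : ‖ω‖ = 1)
    (hcurv : ∀ s ∈ Set.Icc Γ.a Γ.b, inner ℝ (Γ.normal s) ω = 0 → Γ.curvature s ≠ 0)
    (p q : ℝ≥0∞) (hp : p ≠ 0) (hq : q ≠ 0) :
    (Γ.Transversal ω →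
      (StripEstimate Γ ω p q ↔ (1 / p + 1 / q ≤ 1 ∧ 2 ≤ q)) ∧
      (∀ t : ℝ, StripEstimateAt Γ ω p q t ↔ (1 / p + 1 / q ≤ 1 ∧ 2 ≤ q)) ∧
      (RadonEstimate Γ ω p q ↔ (1 / p + 1 / q ≤ 1 ∧ 2 ≤ q))) ∧
    (¬ Γ.Transversal ω →
      (StripEstimate Γ ω p q ↔
        ((p ≤ q → 1 / p + 2 / q ≤ 1) ∧ (q < p → 1 / p + 2 / q < 1))) ∧
      (∀ t : ℝ, StripEstimateAt Γ ω p q t ↔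
        ((p ≤ q → 1 / p + 2 / q ≤ 1) ∧ (q < p → 1 / p + 2 / q < 1))) ∧
      (RadonEstimate Γ ω p q ↔
        ((p ≤ q → 1 / p + 2 / q ≤ 1) ∧ (q < p → 1 / p + 2 / q < 1)))) :=
  ⟨fun ht => estimates_iff_of_imp hω (fun h => radonEstimate_of_transversal ht h.1 h.2)
      fun _ h => h.exponents_of_transversal hω ht hp hq,
    fun ht => estimates_iff_of_imp hω (radonEstimate_of_curvature_ne_zero
      (ne_zero_of_norm_ne_zero (hω.trans_ne one_ne_zero)) hcurv)
      fun _ h => h.exponents_of_not_transversal hω ht hp hq⟩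

theorem theorem1 (Γ : CompactC2Curve)
    (hcurv : ∀ s ∈ Set.Icc Γ.a Γ.b, Γ.curvature s ≠ 0)
    (ω : Plane) (hω : ‖ω‖ = 1)
    (p q : ℝ≥0∞) (hp : 1 ≤ p) (hq : 1 ≤ q) :
    (Γ.Transversal ω →
      (StripEstimate Γ ω p q ↔ (1 / p + 1 / q ≤ 1 ∧ 2 ≤ q)) ∧
      (∀ t : ℝ, StripEstimateAt Γ ω p q t ↔ (1 / p + 1 / q ≤ 1 ∧ 2 ≤ q)) ∧
      (RadonEstimate Γ ω p q ↔ (1 / p + 1 / q ≤ 1 ∧ 2 ≤ q))) ∧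
    (¬ Γ.Transversal ω →
      (StripEstimate Γ ω p q ↔
        ((p ≤ q → 1 / p + 2 / q ≤ 1) ∧ (q < p → 1 / p + 2 / q < 1))) ∧
      (∀ t : ℝ, StripEstimateAt Γ ω p q t ↔
        ((p ≤ q → 1 / p + 2 / q ≤ 1) ∧ (q < p → 1 / p + 2 / q < 1))) ∧
      (RadonEstimate Γ ω p q ↔
        ((p ≤ q → 1 / p + 2 / q ≤ 1) ∧ (q < p → 1 / p + 2 / q < 1)))) :=
  theorem1_general Γ ω hω (fun s hs _ => hcurv s hs) p q (zero_lt_one.trans_le hp).ne'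
    (zero_lt_one.trans_le hq).ne'
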